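/- **Free fields.** Let $V$ be a complex vector space of dimension $2r$ with a non-degenerate symmetric (Clifford case) or anti-symmetric (Weyl case) bilinear form, a polarization $V=V^+\oplus V^-$ into isotropic subspaces, and bases $a_i^\pm$ of $V^\pm$ with $\langle a_i^-,a_j^+\rangle=\delta_{ij}$. Let $A(V)$ be the Clifford (resp. Weyl) module super vertex algebra: the Fock space generated from the vacuum $\mathbf v$ by the modes $v(n+\frac12)$, $n\in\mathbb Z$, $v\in V$, with $v(n+\frac12)\mathbf v=0$ for $n\ge 0$, where $[v(r),w(r')]_\pm=\langle v,w\rangle\delta_{r+r',0}$ (anticommutators in the Clifford case, commutators in the Weyl case), and $Y(v(-\frac12)\mathbf v,z)=\sum_n v(n+\frac12)z^{-n-1}$. Let $A(V)_{\rm tw}$ be its canonically twisted module: the Fock space generated from $\mathbf v_{\rm tw}$ by modes $v(n)$, $n\in\mathbb Z$, with the same relations, with $v(n)\mathbf v_{\rm tw}=0$ for $n>0$ and for $n=0$, $v\in V^+$, and $Y_{\rm tw}(v(-\frac12)\mathbf v,z)=\sum_n v(n)z^{-n-1/2}$. Put $\jmath=\sum_i a_i^+(-\frac12)a_i^-(-\frac12)\mathbf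 v$ and $\omega=\frac12\sum_i\bigl(a_i^+(-\frac32)a_i^-(-\frac12)-a_i^+(-\frac12)a_i^-(-\frac32)\bigr)\mathbf v$, and let $J(0)$, $L(0)$ be the coefficients of $z^{-1}$ in $Y_{\rm tw}(\jmath,z)$ and of $z^{-2}$ in $Y_{\rm tw}(\omega,z)$. Explicitly, with $s=-1$ in the Clifford case and $s=1$ in the Weyl case, $$J(0)=\tfrac12\sum_i\bigl(a_i^+(0)a_i^-(0)+s\,a_i^-(0)a_i^+(0)\bigr)+\sum_{k>0}\sum_i\bigl(a_i^+(-k)a_i^-(k)+s\,a_i^-(-k)a_i^+(k)\bigr),$$ $$L(0)=\sum_{k>0}k\sum_i\bigl(a_i^+(-k)a_i^-(k)-s\,a_i^-(-k)a_i^+(k)\bigr)-\tfrac{s\,r}{8}.$$ An element $g\in GL(V^+)$ acts on $V$ by $(g,g')$, where $g'\in GL(V^-)$ is determined by $\langle gx,g'y\rangle=\langle x,y\rangle$, and on Fock spaces by $v_1(n_1)\cdots v_m(n_m)\mathbf v_{\rm tw}\mapsto (gv_1)(n_1)\cdots(gv_m)(n_m)\mathbf v_{\rm tw}$. **The twisted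 module.** Let $\mathfrak e,\mathfrak a$ be of this kind with symmetric forms and dimensions $2$ and $6$, and $\mathfrak b$ with an anti-symmetric form and dimension $8$. Put $W^{(4)}_{\rm tw}=A(\mathfrak e)_{\rm tw}\otimes A(\mathfrak a)_{\rm tw}\otimes A(\mathfrak b)_{\rm tw}$. On it let $J_{\mathfrak e}(0)$ be the zero mode of $\jmath\otimes\mathbf v\otimes\mathbf v$, let $J(0)$ be the zero mode of $2\,\mathbf v\otimes\jmath\otimes\mathbf v+\mathbf v\otimes\mathbf v\otimes\jmath$, let $L(0)$ be the sum of the operators $L(0)$ of the three factors, and let $(-1)^F=(-I)\otimes(-I)\otimes I\in GL(\mathfrak e^+)\otimes GL(\mathfrak a^+)\otimes GL(\mathfrak b^+)$. **The group.** Let $N$ be the Niemeier lattice with root system $A_3^{\oplus 8}$, let $G^{(4)}=\mathrm{Aut}(N)/\mathrm{Inn}(N)$, where $\mathrm{Inn}(N)$ is generated by the reflections in roots, and let $G^{(4)}_{336}$ be a subgroup of $G^{(4)}$ isomorphic to $SL_2(\mathbb F_7)$. Choose an element $u\in G^{(4)}_{336}$ of order $7$, and put $b_7=\frac{-1+\sqrt{-7}}2$.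 Let $\varrho:G^{(4)}_{336}\to GL(\mathfrak a^+)$ and $\varrho':G^{(4)}_{336}\to GL(\mathfrak b^+)$ be homomorphisms with characters $\chi_2$ and $\chi_8$, where, on elements of order $1,2,4,3,6,8$, $\chi_2$ takes the values $3,3,-1,0,0,1$ and $\chi_8$ the values $4,-4,0,1,-1,0$; on the conjugates of $u$ the values are $\chi_2=b_7$, $\chi_8=-\overline{b_7}$, and on the other elements of order $7$ the complex conjugates of these; if $c$ is the involution of $G^{(4)}_{336}$ and $h$ has order $7$, then $\chi_2(ch)=\chi_2(h)$ and $\chi_8(ch)=-\chi_8(h)$. Let $g\in G^{(4)}_{336}$ act on $W^{(4)}_{\rm tw}$ by $I\otimes\varrho(g)\otimes\varrho'(g)$. **The Jacobi forms.** Let $q=e^{2\pi i\tau}$, $y=e^{2\pi iz}$, $\eta(\tau)=q^{1/24}\prod_{n>0}(1-q^n)$, $\theta_1(\tau,z)=-iq^{1/8}y^{1/2}\prod_{n>0}(1-y^{-1}q^{n-1})(1-yq^n)(1-q^n)$ and $\theta_2(\tau,z)=q^{1/8}y^{1/2}\prod_{n>0}(1+y^{-1}q^{n-1})(1+yq^n)(1-q^n)$.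 For $g\in G^{(4)}_{336}$ the function $\psi^{(4)}_g(\tau,z)$ depends only on the order of $g$; it is - order 1 (class 1A): $2i\,\eta(\tau)^3\theta_1(\tau,2z)^3/\theta_1(\tau,z)^4$; - order 2 (2A): $2i\,\eta(\tau)^3\theta_1(\tau,2z)^3/\theta_2(\tau,z)^4$; - order 4 (4A): $-2i\,\eta(2\tau)^2\theta_1(\tau,2z)\theta_2(\tau,2z)^2/(\eta(\tau)\theta_2(2\tau,2z)^2)$; - order 3 (3A): $2i\,\eta(\tau)^3\theta_1(3\tau,6z)/(\theta_1(\tau,z)\theta_1(3\tau,3z))$; - order 6 (6A): $-2i\,\eta(\tau)^3\theta_1(3\tau,6z)/(\theta_2(\tau,z)\theta_2(3\tau,3z))$; - order 8 (8A): $-2i\,\eta(\tau)\eta(4\tau)\theta_1(\tau,2z)\theta_2(2\tau,4z)/(\eta(2\tau)\theta_2(4\tau,4z))$; - order 7 (7AB): $-i\,\dfrac{\eta(7\tau)}{\eta(\tau)^4\theta_1(7\tau,7z)}\displaystyle\sum_{\epsilon=\pm1}\prod_{k\in\{1,2,4\}}\theta_1(\tau,2z+\tfrac{\epsilon k}7)\,\theta_1(\tau,z-\tfrac{\epsilon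 k}7)$; - order 14 (14AB): $i\,\dfrac{\eta(7\tau)}{\eta(\tau)^4\theta_2(7\tau,7z)}\displaystyle\sum_{\epsilon=\pm1}\prod_{k\in\{1,2,4\}}\theta_1(\tau,2z+\tfrac{\epsilon k}7)\,\theta_2(\tau,z-\tfrac{\epsilon k}7)$. **Proposition.** $W^{(4)}_{\rm tw}$ is the direct sum of the simultaneous eigenspaces of $J(0)$ and $L(0)$ with eigenvalues $k\in\mathbb Z$ and $n\in\mathbb Z_{\ge0}$; these are finite-dimensional, and for each $n$ they vanish for all large $k$. They are preserved by $(g+g^{-1})J_{\mathfrak e}(0)(-1)^F$ for $g\in G^{(4)}_{336}$, so that $$\widetilde\psi^{(4)}_g:=-\operatorname{tr}\bigl((g+g^{-1})\,J_{\mathfrak e}(0)\,(-1)^F\,y^{J(0)}q^{L(0)}\,\big|\,W^{(4)}_{\rm tw}\bigr)\in\mathbb C[y][[y^{-1}]][[q]]$$ is well defined. For every $g\in G^{(4)}_{336}$ the series $\widetilde\psi^{(4)}_g$ is the expansion of $\psi^{(4)}_g$ in the domain $0<-\operatorname{Im}z<\operatorname{Im}\tau$: at every point $(\tau,z)$ of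 this domain it converges absolutely, with sum $\psi^{(4)}_g(\tau,z)$. -/

import Mathlib

open scoped TensorProduct

namespace UmbralFour

noncomputable section

/-! ### Clifford and Weyl algebras, free field Fock spaces

The parameter `s` is `-1` for the Clifford (fermionic) and `1` for the Weyl (bosonic) case. -/

/-- The defining relations `x ⊗ y - s (y ⊗ x) = B(x, y) 1` of the Clifford algebra (`s = -1`) or the
Weyl algebra (`s = 1`) of the space `U` with bilinear form `B`. -/
inductive FreeRel {U : Type*} [AddCommGroup U] [Module ℂ U] (s : ℂ) (B : U →ₗ[ℂ] U →ₗ[ℂ] ℂ) :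
    TensorAlgebra ℂ U → TensorAlgebra ℂ U → Prop
  | rel (x y : U) : FreeRel s B
      (TensorAlgebra.ι ℂ x * TensorAlgebra.ι ℂ y
        - s • (TensorAlgebra.ι ℂ y * TensorAlgebra.ι ℂ x))
      (algebraMap ℂ (TensorAlgebra ℂ U) (B x y))

/-- The Clifford (`s = -1`) or Weyl (`s = 1`) algebra: the quotient of the tensor algebra by the
ideal generated by the relations. -/
abbrev FreeAlg {U : Type*} [AddCommGroup U] [Module ℂ U] (s : ℂ) (B : U →ₗ[ℂ] U →ₗ[ℂ] ℂ) : Type _ :=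
  RingQuot (FreeRel s B)

/-- The image of a vector in the Clifford or Weyl algebra. -/
def FreeAlg.ι {U : Type*} [AddCommGroup U] [Module ℂ U] (s : ℂ) (B : U →ₗ[ℂ] U →ₗ[ℂ] ℂ) :
    U →ₗ[ℂ] FreeAlg s B :=
  (RingQuot.mkAlgHom ℂ (FreeRel s B)).toLinearMap ∘ₗ TensorAlgebra.ι ℂ

/-- A complex vector space with a non-degenerate bilinear form that is symmetric (`s = -1`) or
anti-symmetric (`s = 1`), a polarization `V = pos ⊕ neg` into isotropic subspaces, and bases
`a_i^±` of `pos` and `neg` with `⟨a_i^-, a_j^+⟩ = δ_{ij}`. -/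
structure PolarizedSpace (s : ℂ) (V : Type*) [AddCommGroup V] [Module ℂ V]
    (ι : Type) [Fintype ι] [DecidableEq ι] where
  /-- the bilinear form -/
  form : V →ₗ[ℂ] V →ₗ[ℂ] ℂ
  form_swap : ∀ x y, form y x = -s * form x y
  nondegenerate : form.Nondegenerate
  /-- the first summand of the polarization -/
  pos : Submodule ℂ V
  /-- the second summand of the polarization -/
  neg : Submodule ℂ V
  isCompl : IsCompl pos neg
  pos_isotropic : ∀ x ∈ pos, ∀ y ∈ pos, form x y = 0
  neg_isotropic : ∀ x ∈ neg, ∀ y ∈ neg, form x y = 0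
  /-- the basis `a_i^+` -/
  bpos : Module.Basis ι ℂ pos
  /-- the basis `a_i^-` -/
  bneg : Module.Basis ι ℂ neg
  dual : ∀ i j, form (bneg i) (bpos j) = if i = j then 1 else 0

/-- On `⨁_{n ∈ ℤ} V`, with `v` in the `n`-th summand written `v[n]`, the bilinear form
`⟨v[m], w[n]⟩ = B(v, w) δ_{m + n, c}`. -/
def hatForm {V : Type*} [AddCommGroup V] [Module ℂ V] (B : V →ₗ[ℂ] V →ₗ[ℂ] ℂ) (c : ℤ) :
    (ℤ →₀ V) →ₗ[ℂ] (ℤ →₀ V) →ₗ[ℂ] ℂ :=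
  Finsupp.lsum ℂ (fun m : ℤ => B.compl₂ (Finsupp.lapply (c - m)))

theorem hatForm_single {V : Type*} [AddCommGroup V] [Module ℂ V] (B : V →ₗ[ℂ] V →ₗ[ℂ] ℂ)
    (c m n : ℤ) (v w : V) :
    hatForm B c (Finsupp.single m v) (Finsupp.single n w) = if m + n = c then B v w else 0 := by
  simp only [hatForm, Finsupp.lsum_single, LinearMap.compl₂_apply, Finsupp.lapply_apply,
    Finsupp.single_apply]
  by_cases h : m + n = c
  · rw [if_pos h, if_pos (by omega)]
  · rw [if_neg h, if_neg (by omega), map_zero]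

namespace PolarizedSpace

variable {s : ℂ} {V : Type*} [AddCommGroup V] [Module ℂ V] {ι : Type} [Fintype ι] [DecidableEq ι]

/-- The mode algebra with parameter `c`: for `c = -1` it is the algebra of the space
`⨁ V(n + 1/2)`, with `v(n + 1/2)` stored in degree `n`; for `c = 0` it is the algebra of
`⨁ V(n)`. In both cases `⟨v(r), w(r')⟩ = ⟨v, w⟩ δ_{r + r', 0}`. -/
abbrev Modes (P : PolarizedSpace s V ι) (c : ℤ) : Type _ := FreeAlg s (hatForm P.form c)

/-- The generator `v(n + 1/2)` (if `c = -1`) or `v(n)` (if `c = 0`) of the mode algebra. -/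
def gen (P : PolarizedSpace s V ι) (c : ℤ) (v : V) (n : ℤ) : P.Modes c :=
  FreeAlg.ι s (hatForm P.form c) (Finsupp.single n v)

/-- The modes that annihilate the vacuum: for `c = 0` (twisted sector) these are the `v(0)` with
`v ∈ pos` and the `v(n)` with `n > 0`; otherwise they are the `v[n]` with `n ≥ 0`. -/
def annihilators (P : PolarizedSpace s V ι) (c : ℤ) : Set (P.Modes c) :=
  {x | ∃ (v : V) (n : ℤ), x = P.gen c v n ∧
    (0 < n ∨ (n = 0 ∧ (c = 0 → v ∈ P.pos)))}

/-- The left ideal generated by the annihilators of the vacuum. -/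
def vacIdeal (P : PolarizedSpace s V ι) (c : ℤ) : Submodule (P.Modes c) (P.Modes c) :=
  Submodule.span (P.Modes c) (P.annihilators c)

/-- The Fock module induced from the one-dimensional module of the algebra generated by the
annihilators: for `c = -1` the super vertex algebra itself, for `c = 0` its canonically twisted
module. -/
def Fock (P : PolarizedSpace s V ι) (c : ℤ) : Type _ := P.Modes c ⧸ P.vacIdeal c

instance (P : PolarizedSpace s V ι) (c : ℤ) : AddCommGroup (P.Fock c) :=
  inferInstanceAs (AddCommGroup (P.Modes c ⧸ P.vacIdeal c))

instance (P : PolarizedSpace s V ι) (c : ℤ) : Module (P.Modes c) (P.Fock c) :=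
  inferInstanceAs (Module (P.Modes c) (P.Modes c ⧸ P.vacIdeal c))

instance (P : PolarizedSpace s V ι) (c : ℤ) : Module ℂ (P.Fock c) :=
  inferInstanceAs (Module ℂ (P.Modes c ⧸ P.vacIdeal c))

instance (P : PolarizedSpace s V ι) (c : ℤ) : IsScalarTower ℂ (P.Modes c) (P.Fock c) :=
  inferInstanceAs (IsScalarTower ℂ (P.Modes c) (P.Modes c ⧸ P.vacIdeal c))

/-- The quotient map `x ↦ x · vac` onto the Fock module. -/
def toFock (P : PolarizedSpace s V ι) (c : ℤ) : P.Modes c →ₗ[P.Modes c] P.Fock c :=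
  (P.vacIdeal c).mkQ

theorem toFock_surjective (P : PolarizedSpace s V ι) (c : ℤ) :
    Function.Surjective (P.toFock c) := Submodule.mkQ_surjective _

theorem toFock_eq_zero (P : PolarizedSpace s V ι) (c : ℤ) (x : P.Modes c) :
    P.toFock c x = 0 ↔ x ∈ P.vacIdeal c := Submodule.Quotient.mk_eq_zero _

/-- The vacuum vector. -/
def vac (P : PolarizedSpace s V ι) (c : ℤ) : P.Fock c := P.toFock c 1

/-- The action of `v[n]` on the Fock module. -/
def mode (P : PolarizedSpace s V ι) (c : ℤ) (v : V) (n : ℤ) : Module.End ℂ (P.Fock c) :=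
  Algebra.lsmul ℂ ℂ (P.Fock c) (P.gen c v n)

theorem gen_mul (P : PolarizedSpace s V ι) (c : ℤ) (v w : V) (m n : ℤ) :
    P.gen c v m * P.gen c w n - s • (P.gen c w n * P.gen c v m)
      = algebraMap ℂ (P.Modes c) (if m + n = c then P.form v w else 0) := by
  have h := RingQuot.mkAlgHom_rel ℂ
    (FreeRel.rel (s := s) (B := hatForm P.form c) (Finsupp.single m v) (Finsupp.single n w))
  rw [hatForm_single] at h
  simpa [gen, FreeAlg.ι] using h

/-! ### The action of `GL(pos)` -/

/-- The linear automorphism `(g, g')` of `V = pos ⊕ neg`, where `g'` is determined by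
`⟨g x, g' y⟩ = ⟨x, y⟩`, that is, `g' y = ∑ i, ⟨y, g⁻¹ a_i^+⟩ a_i^-`. -/
def extend (P : PolarizedSpace s V ι) (g : LinearMap.GeneralLinearGroup ℂ P.pos) : V →ₗ[ℂ] V :=
  P.pos.subtype ∘ₗ (g : Module.End ℂ P.pos) ∘ₗ P.pos.projectionOnto P.neg P.isCompl
    + ∑ i, (P.form.flip (((g⁻¹ : LinearMap.GeneralLinearGroup ℂ P.pos) : Module.End ℂ P.pos)
        (P.bpos i) : V)).smulRight (P.bneg i : V)

theorem extend_of_pos (P : PolarizedSpace s V ι) (g : LinearMap.GeneralLinearGroup ℂ P.pos)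
    (x : P.pos) : P.extend g x = ((g : Module.End ℂ P.pos) x : V) := by
  simp [extend, P.pos_isotropic _ x.2]

theorem extend_of_neg (P : PolarizedSpace s V ι) (g : LinearMap.GeneralLinearGroup ℂ P.pos)
    (y : P.neg) : P.extend g y = ∑ i, P.form y
      (((g⁻¹ : LinearMap.GeneralLinearGroup ℂ P.pos) : Module.End ℂ P.pos) (P.bpos i) : V) •
        (P.bneg i : V) := by
  simp [extend]

theorem extend_pos_neg (P : PolarizedSpace s V ι) (g : LinearMap.GeneralLinearGroup ℂ P.pos)
    (y : P.neg) (x : P.pos) : P.form (P.extend g y) (P.extend g x) = P.form y x := by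
  have key : ∀ z : P.pos, ∑ i, P.form (P.bneg i) z • P.bpos i = z := by
    intro z
    conv_rhs => rw [← P.bpos.sum_repr z]
    refine Finset.sum_congr rfl fun i _ => ?_
    congr 1
    have e : (z : V) = ∑ j, P.bpos.repr z j • (P.bpos j : V) := by
      have h := congrArg P.pos.subtype (P.bpos.sum_repr z)
      simp only [map_sum, map_smul, Submodule.subtype_apply] at h
      exact h.symm
    rw [e]
    simp [P.dual]
  rw [extend_of_pos, extend_of_neg]
  set G := (g : Module.End ℂ P.pos)
  set G' := ((g⁻¹ : LinearMap.GeneralLinearGroup ℂ P.pos) : Module.End ℂ P.pos)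
  have hG : G' (G x) = x := by
    have : G' * G = 1 := g.inv_mul
    exact LinearMap.congr_fun this x
  have h2 : (x : V) = ∑ i, P.form (P.bneg i) (G x) • (G' (P.bpos i) : V) := by
    conv_lhs => rw [← hG, ← key (G x)]
    simp
  conv_rhs => rw [h2]
  simp only [map_sum, map_smul, LinearMap.sum_apply, LinearMap.smul_apply, smul_eq_mul]
  exact Finset.sum_congr rfl fun i _ => mul_comm _ _

theorem extend_mem_neg (P : PolarizedSpace s V ι) (g : LinearMap.GeneralLinearGroup ℂ P.pos)
    (y : P.neg) : P.extend g y ∈ P.neg := by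
  rw [extend_of_neg]
  exact Submodule.sum_mem _ fun i _ => Submodule.smul_mem _ _ (P.bneg i).2

theorem form_extend (P : PolarizedSpace s V ι) (g : LinearMap.GeneralLinearGroup ℂ P.pos)
    (x y : V) : P.form (P.extend g x) (P.extend g y) = P.form x y := by
  have hpos : ∀ x : P.pos, P.extend g x ∈ P.pos := fun x => by
    rw [extend_of_pos]; exact Subtype.coe_prop _
  obtain ⟨x₁, hx₁, x₂, hx₂, rfl⟩ := Submodule.mem_sup.1
    (P.isCompl.sup_eq_top ▸ Submodule.mem_top : x ∈ P.pos ⊔ P.neg)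
  obtain ⟨y₁, hy₁, y₂, hy₂, rfl⟩ := Submodule.mem_sup.1
    (P.isCompl.sup_eq_top ▸ Submodule.mem_top : y ∈ P.pos ⊔ P.neg)
  have a1 := P.pos_isotropic _ (hpos ⟨x₁, hx₁⟩) _ (hpos ⟨y₁, hy₁⟩)
  have a2 := P.neg_isotropic _ (P.extend_mem_neg g ⟨x₂, hx₂⟩) _ (P.extend_mem_neg g ⟨y₂, hy₂⟩)
  have a3 := P.extend_pos_neg g ⟨x₂, hx₂⟩ ⟨y₁, hy₁⟩
  have a4 := P.extend_pos_neg g ⟨y₂, hy₂⟩ ⟨x₁, hx₁⟩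
  simp only [map_add, LinearMap.add_apply]
  simp only at a1 a2 a3 a4
  rw [a1, a2, a3, P.form_swap (P.extend g y₂) (P.extend g x₁), a4,
    P.pos_isotropic _ hx₁ _ hy₁, P.neg_isotropic _ hx₂ _ hy₂, P.form_swap y₂ x₁]

/-- The algebra endomorphism of the mode algebra with `v[n] ↦ ((g, g') v)[n]`. -/
def modesMap (P : PolarizedSpace s V ι) (c : ℤ) (g : LinearMap.GeneralLinearGroup ℂ P.pos) :
    P.Modes c →ₐ[ℂ] P.Modes c :=
  RingQuot.liftAlgHom ℂ
    ⟨TensorAlgebra.lift ℂ (FreeAlg.ι s (hatForm P.form c) ∘ₗ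
      Finsupp.mapRange.linearMap (P.extend g)), by
    rintro _ _ ⟨x, y⟩
    have hB : hatForm P.form c (Finsupp.mapRange.linearMap (P.extend g) x)
        (Finsupp.mapRange.linearMap (P.extend g) y) = hatForm P.form c x y := by
      induction x using Finsupp.induction_linear with
      | zero => simp
      | add x x' h h' => simp only [map_add, LinearMap.add_apply, h, h']
      | single m v =>
        induction y using Finsupp.induction_linear with
        | zero => simp
        | add y y' h h' => simp only [map_add, h, h']
        | single n w =>
          simp only [Finsupp.mapRange.linearMap_apply, Finsupp.mapRange_single, hatForm_single,
            P.form_extend]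
    have h := RingQuot.mkAlgHom_rel ℂ (FreeRel.rel (s := s) (B := hatForm P.form c)
      (Finsupp.mapRange.linearMap (P.extend g) x) (Finsupp.mapRange.linearMap (P.extend g) y))
    rw [hB] at h
    simpa [FreeAlg.ι] using h⟩

theorem modesMap_gen (P : PolarizedSpace s V ι) (c : ℤ)
    (g : LinearMap.GeneralLinearGroup ℂ P.pos) (v : V) (n : ℤ) :
    P.modesMap c g (P.gen c v n) = P.gen c (P.extend g v) n := by
  simp [modesMap, gen, FreeAlg.ι]

theorem modesMap_mem (P : PolarizedSpace s V ι) (c : ℤ)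
    (g : LinearMap.GeneralLinearGroup ℂ P.pos) (x : P.Modes c) (hx : x ∈ P.vacIdeal c) :
    P.modesMap c g x ∈ P.vacIdeal c := by
  induction hx using Submodule.span_induction with
  | mem x h =>
    obtain ⟨v, n, rfl, h⟩ := h
    rw [modesMap_gen]
    refine Submodule.subset_span ⟨_, n, rfl, h.imp id fun h' => ⟨h'.1, fun hc => ?_⟩⟩
    have := P.extend_of_pos g ⟨v, h'.2 hc⟩
    simp only at this
    rw [this]
    exact Subtype.coe_prop _
  | zero => simp
  | add x y _ _ hx hy => rw [map_add]; exact Submodule.add_mem _ hx hy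
  | smul a x _ hx => rw [smul_eq_mul, map_mul]; exact Submodule.smul_mem _ _ hx

/-- The action of `g ∈ GL(pos)` on the Fock module:
`g · v₁[n₁] ⋯ v_k[n_k] vac = (g v₁)[n₁] ⋯ (g v_k)[n_k] vac`. -/
def act (P : PolarizedSpace s V ι) (c : ℤ) (g : LinearMap.GeneralLinearGroup ℂ P.pos) :
    Module.End ℂ (P.Fock c) :=
  Submodule.liftQ ((P.vacIdeal c).restrictScalars ℂ)
      ((P.toFock c).restrictScalars ℂ ∘ₗ (P.modesMap c g).toLinearMap)
      (fun x hx => (P.toFock_eq_zero c _).2 (P.modesMap_mem c g x hx)) ∘ₗ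
    (Submodule.Quotient.restrictScalarsEquiv ℂ (P.vacIdeal c)).symm.toLinearMap

theorem act_toFock (P : PolarizedSpace s V ι) (c : ℤ) (g : LinearMap.GeneralLinearGroup ℂ P.pos)
    (x : P.Modes c) : P.act c g (P.toFock c x) = P.toFock c (P.modesMap c g x) := rfl

/-! ### The zero modes `J(0)` and `L(0)` in the twisted sector -/

/-- Every vector of the twisted module is annihilated by all `v(n)` with `n` large. -/
theorem exists_mode_eq_zero (P : PolarizedSpace s V ι) (w : P.Fock 0) :
    ∃ N : ℤ, ∀ n, N ≤ n → ∀ v, P.mode 0 v n w = 0 := by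
  have hcomm : ∀ (v v' : V) (m n : ℤ) (x : P.Fock 0), P.mode 0 v m (P.mode 0 v' n x)
      = s • P.mode 0 v' n (P.mode 0 v m x) + (if m + n = 0 then P.form v v' else 0) • x := by
    intro v v' m n x
    have h := congrArg (fun a => a • x) (P.gen_mul 0 v v' m n)
    simp only [sub_smul, mul_smul, algebraMap_smul, smul_assoc] at h
    exact eq_add_of_sub_eq' h
  have key : ∀ (t : TensorAlgebra ℂ (ℤ →₀ V)) (x : P.Fock 0),
      (∃ N : ℤ, ∀ n, N ≤ n → ∀ v, P.mode 0 v n x = 0) →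
      ∃ N : ℤ, ∀ n, N ≤ n → ∀ v, P.mode 0 v n
        (RingQuot.mkAlgHom ℂ (FreeRel s (hatForm P.form 0)) t • x) = 0 := by
    intro t
    induction t using TensorAlgebra.induction with
    | algebraMap r =>
      rintro x ⟨N, hN⟩
      refine ⟨N, fun n hn v => ?_⟩
      rw [AlgHom.commutes, algebraMap_smul, map_smul, hN n hn v, smul_zero]
    | ι u =>
      rintro x hx
      induction u using Finsupp.induction_linear with
      | zero => exact ⟨0, fun n _ v => by simp⟩
      | add a b ha hb =>
        obtain ⟨N, hN⟩ := ha
        obtain ⟨M, hM⟩ := hb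
        refine ⟨max N M, fun n hn v => ?_⟩
        rw [map_add, map_add, add_smul, map_add, hN n (le_trans (le_max_left _ _) hn),
          hM n (le_trans (le_max_right _ _) hn), add_zero]
      | single m v' =>
        obtain ⟨N, hN⟩ := hx
        refine ⟨max N (1 - m), fun n hn v => ?_⟩
        have h := hcomm v v' n m x
        rw [hN n (le_trans (le_max_left _ _) hn) v, map_zero, smul_zero, zero_add,
          if_neg (by have := le_trans (le_max_right _ _) hn; omega), zero_smul] at h
        exact h
    | mul a b ha hb =>
      intro x hx
      rw [map_mul]
      simp only [mul_smul]
      exact ha _ (hb x hx)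
    | add a b ha hb =>
      intro x hx
      obtain ⟨N, hN⟩ := ha x hx
      obtain ⟨M, hM⟩ := hb x hx
      refine ⟨max N M, fun n hn v => ?_⟩
      rw [map_add, add_smul, map_add, hN n (le_trans (le_max_left _ _) hn),
        hM n (le_trans (le_max_right _ _) hn), add_zero]
  obtain ⟨a, rfl⟩ := P.toFock_surjective 0 w
  obtain ⟨t, rfl⟩ := RingQuot.mkAlgHom_surjective ℂ (FreeRel s (hatForm P.form 0)) a
  have := key t (P.vac 0) ⟨1, fun n hn v => by
    change P.gen 0 v n • P.toFock 0 1 = 0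
    rw [← map_smul, smul_eq_mul, mul_one, toFock_eq_zero]
    exact Submodule.subset_span ⟨v, n, rfl, Or.inl (by omega)⟩⟩
  rwa [vac, ← map_smul, smul_eq_mul, mul_one] at this

theorem modeSum_finite (P : PolarizedSpace s V ι) (p : ℕ) (t : ℂ) (w : P.Fock 0) :
    (Function.support fun n : ℕ => ((n : ℂ) + 1) ^ p • ∑ i,
      (P.mode 0 (P.bpos i) (-(n + 1)) (P.mode 0 (P.bneg i) (n + 1) w)
        + t • P.mode 0 (P.bneg i) (-(n + 1)) (P.mode 0 (P.bpos i) (n + 1) w))).Finite := by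
  obtain ⟨N, hN⟩ := P.exists_mode_eq_zero w
  refine (Set.finite_lt_nat N.toNat).subset fun n hn => ?_
  by_contra hlt
  refine hn ?_
  have h : N ≤ (n : ℤ) + 1 := by
    have : N.toNat ≤ n := not_lt.1 hlt
    omega
  simp [hN _ h]

/-- The operator `∑_{k > 0} k^p ∑_i (a_i^+(-k) a_i^-(k) + t a_i^-(-k) a_i^+(k))` on the twisted
module (a finite sum on every vector). -/
def modeSum (P : PolarizedSpace s V ι) (p : ℕ) (t : ℂ) : Module.End ℂ (P.Fock 0) where
  toFun w := ∑ᶠ n : ℕ, ((n : ℂ) + 1) ^ p • ∑ i,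
    (P.mode 0 (P.bpos i) (-(n + 1)) (P.mode 0 (P.bneg i) (n + 1) w)
      + t • P.mode 0 (P.bneg i) (-(n + 1)) (P.mode 0 (P.bpos i) (n + 1) w))
  map_add' x y := by
    rw [← finsum_add_distrib (P.modeSum_finite p t x) (P.modeSum_finite p t y)]
    refine finsum_congr fun n => ?_
    simp only [map_add, smul_add, Finset.sum_add_distrib]
    abel
  map_smul' r x := by
    rw [RingHom.id_apply, smul_finsum' r (P.modeSum_finite p t x)]
    refine finsum_congr fun n => ?_
    simp only [map_smul, Finset.smul_sum, smul_add]
    refine Finset.sum_congr rfl fun i _ => ?_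
    simp only [smul_smul]
    congr 2 <;> ring

/-- `J(0)` on the twisted module. -/
def zeroJ (P : PolarizedSpace s V ι) : Module.End ℂ (P.Fock 0) :=
  (1 / 2 : ℂ) • ∑ i, (P.mode 0 (P.bpos i) 0 * P.mode 0 (P.bneg i) 0
    + s • (P.mode 0 (P.bneg i) 0 * P.mode 0 (P.bpos i) 0)) + P.modeSum 0 s

/-- `L(0)` on the twisted module. -/
def zeroL (P : PolarizedSpace s V ι) : Module.End ℂ (P.Fock 0) :=
  P.modeSum 1 (-s) - (s * Fintype.card ι / 8) • (1 : Module.End ℂ (P.Fock 0))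

/-! ### Super vertex algebra and canonically twisted module structures -/

/-- The span of the vectors `v₁[n₁] ⋯ v_k[n_k] vac` with `k ≡ i` modulo `2`. -/
def part (P : PolarizedSpace s V ι) (c : ℤ) (i : ZMod 2) : Submodule ℂ (P.Fock c) :=
  Submodule.span ℂ {w | ∃ l : List (V × ℤ), (l.length : ZMod 2) = i ∧
    w = P.toFock c (l.map fun p => P.gen c p.1 p.2).prod}

/-- `Y` is a super vertex algebra structure on `A(V)` with vacuum `vac` and
`Y(v(-1/2) vac, z) = ∑ n, v(n + 1/2) z^{-n-1}`. Here `Y u n` is the coefficient of `z^{-n-1}` in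
`Y(u, z)`. The main axiom is the Borcherds identity; generators have statistics sign `s`. -/
structure IsVertexStructure (P : PolarizedSpace s V ι)
    (Y : P.Fock (-1) →ₗ[ℂ] ℤ → Module.End ℂ (P.Fock (-1))) : Prop where
  vacuum : ∀ n, Y (P.vac (-1)) n = if n = -1 then 1 else 0
  creation : ∀ u, Y u (-1) (P.vac (-1)) = u ∧ ∀ n, 0 ≤ n → Y u n (P.vac (-1)) = 0
  truncation : ∀ u v, ∃ N, ∀ n, N ≤ n → Y u n v = 0
  parity : ∀ i j, ∀ u ∈ P.part (-1) i, ∀ v ∈ P.part (-1) j, ∀ n, Y u n v ∈ P.part (-1) (i + j)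
  borcherds : ∀ i j, ∀ u ∈ P.part (-1) i, ∀ v ∈ P.part (-1) j, ∀ (w : P.Fock (-1)) (l m n : ℤ),
    ∑ᶠ k : ℕ, (Ring.choose m k : ℂ) • Y (Y u (l + k) v) (m + n - k) w =
      ∑ᶠ k : ℕ, ((-1) ^ k * (Ring.choose l k : ℂ)) •
        (Y u (m + l - k) (Y v (n + k) w)
          - ((-1) ^ l * (if i = 1 ∧ j = 1 then s else 1)) • Y v (n + l - k) (Y u (m + k) w))
  generators : ∀ v n, Y (P.mode (-1) v (-1) (P.vac (-1))) n = P.mode (-1) v n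

/-- `Ytw` is a structure of canonically twisted module on `A(V)_tw`, for the super vertex algebra
structure `Y` on `A(V)`, with `Ytw(v(-1/2) vac, z) = ∑ n, v(n) z^{-n-1/2}`. Here `Ytw u a` is the
coefficient of `z^{-a/2-1}` in `Ytw(u, z)`; only exponents with `a ≡ i` modulo `2` occur for `u` a
combination of products of `i` modulo `2` generators. The main axiom is the twisted Borcherds
identity. -/
structure IsTwistedStructure (P : PolarizedSpace s V ι)
    (Y : P.Fock (-1) →ₗ[ℂ] ℤ → Module.End ℂ (P.Fock (-1)))
    (Ytw : P.Fock (-1) →ₗ[ℂ] ℤ → Module.End ℂ (P.Fock 0)) : Prop where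
  vacuum : ∀ a, Ytw (P.vac (-1)) a = if a = -2 then 1 else 0
  exponents : ∀ i, ∀ u ∈ P.part (-1) i, ∀ a : ℤ, (a : ZMod 2) ≠ i → Ytw u a = 0
  truncation : ∀ u w, ∃ N, ∀ a, N ≤ a → Ytw u a w = 0
  borcherds : ∀ i j, ∀ u ∈ P.part (-1) i, ∀ v ∈ P.part (-1) j, ∀ (w : P.Fock 0) (l a b : ℤ),
    (a : ZMod 2) = i → (b : ZMod 2) = j →
    ∑ᶠ k : ℕ, Ring.choose ((a : ℂ) / 2) k • Ytw (Y u (l + k) v) (a + b - 2 * k) w =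
      ∑ᶠ k : ℕ, ((-1) ^ k * (Ring.choose l k : ℂ)) •
        (Ytw u (a + 2 * l - 2 * k) (Ytw v (b + 2 * k) w)
          - ((-1) ^ l * (if i = 1 ∧ j = 1 then s else 1)) •
            Ytw v (b + 2 * l - 2 * k) (Ytw u (a + 2 * k) w))
  generators : ∀ v n, Ytw (P.mode (-1) v (-1) (P.vac (-1))) (2 * n - 1) = P.mode 0 v n

/-- The vector `∑ i, a_i^+(-1/2) a_i^-(-1/2) vac`. -/
def jVec (P : PolarizedSpace s V ι) : P.Fock (-1) :=
  ∑ i, P.mode (-1) (P.bpos i) (-1) (P.mode (-1) (P.bneg i) (-1) (P.vac (-1)))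

/-- The Virasoro element
`1/2 ∑ i, (a_i^+(-3/2) a_i^-(-1/2) - a_i^+(-1/2) a_i^-(-3/2)) vac`. -/
def omegaVec (P : PolarizedSpace s V ι) : P.Fock (-1) :=
  (1 / 2 : ℂ) • ∑ i,
    (P.mode (-1) (P.bpos i) (-2) (P.mode (-1) (P.bneg i) (-1) (P.vac (-1)))
      - P.mode (-1) (P.bpos i) (-1) (P.mode (-1) (P.bneg i) (-2) (P.vac (-1))))

/-- The operators `zeroJ` and `zeroL` are the coefficient of `z^{-1}` in `Ytw(j, z)` and the
coefficient of `z^{-2}` in `Ytw(ω, z)`. -/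
def ZeroModesAreCoefficients (P : PolarizedSpace s V ι) : Prop :=
  ∀ Y Ytw, P.IsVertexStructure Y → P.IsTwistedStructure Y Ytw →
    Ytw P.jVec 0 = P.zeroJ ∧ Ytw P.omegaVec 2 = P.zeroL

end PolarizedSpace

/-! ### The twisted module `W_tw` and its trace function -/

section Trace

variable {E A B : Type*} [AddCommGroup E] [Module ℂ E] [AddCommGroup A] [Module ℂ A]
  [AddCommGroup B] [Module ℂ B]

/-- `W_tw = A(e)_tw ⊗ A(a)_tw ⊗ A(b)_tw`, with `dim e = 2`, `dim a = 6`, `dim b = 8`. -/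
abbrev Wtw (PE : PolarizedSpace (-1) E (Fin 1)) (PA : PolarizedSpace (-1) A (Fin 3))
    (PB : PolarizedSpace 1 B (Fin 4)) : Type _ :=
  PE.Fock 0 ⊗[ℂ] (PA.Fock 0 ⊗[ℂ] PB.Fock 0)

variable (PE : PolarizedSpace (-1) E (Fin 1)) (PA : PolarizedSpace (-1) A (Fin 3))
  (PB : PolarizedSpace 1 B (Fin 4))

/-- The operator `x ⊗ y ⊗ z` on `W_tw`. -/
def tensorOp (x : Module.End ℂ (PE.Fock 0)) (y : Module.End ℂ (PA.Fock 0))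
    (z : Module.End ℂ (PB.Fock 0)) : Module.End ℂ (Wtw PE PA PB) :=
  TensorProduct.map x (TensorProduct.map y z)

/-- `J_e(0)`, the zero mode of `j ⊗ vac ⊗ vac`. -/
def opJe : Module.End ℂ (Wtw PE PA PB) := tensorOp PE PA PB PE.zeroJ 1 1

/-- `J(0)`, the zero mode of `2 vac ⊗ j ⊗ vac + vac ⊗ vac ⊗ j`. -/
def opJ : Module.End ℂ (Wtw PE PA PB) :=
  (2 : ℂ) • tensorOp PE PA PB 1 PA.zeroJ 1 + tensorOp PE PA PB 1 1 PB.zeroJ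

/-- `L(0)`, from the tensor product Virasoro element. -/
def opL : Module.End ℂ (Wtw PE PA PB) :=
  tensorOp PE PA PB PE.zeroL 1 1 + tensorOp PE PA PB 1 PA.zeroL 1
    + tensorOp PE PA PB 1 1 PB.zeroL

/-- The action of `(ε, α, β)` in `GL(e⁺) × GL(a⁺) × GL(b⁺)` on `W_tw`. -/
def glAct (ε : LinearMap.GeneralLinearGroup ℂ PE.pos) (α : LinearMap.GeneralLinearGroup ℂ PA.pos)
    (β : LinearMap.GeneralLinearGroup ℂ PB.pos) : Module.End ℂ (Wtw PE PA PB) :=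
  tensorOp PE PA PB (PE.act 0 ε) (PA.act 0 α) (PB.act 0 β)

/-- The simultaneous eigenspace on which `J(0) = k` and `L(0) = n`. -/
def bigraded (k : ℤ) (n : ℕ) : Submodule ℂ (Wtw PE PA PB) :=
  (opJ PE PA PB).eigenspace (k : ℂ) ⊓ (opL PE PA PB).eigenspace (n : ℂ)

/-- The operator `-(g + g⁻¹) J_e(0) (-1)^F`, for `g` acting by `1 ⊗ ρ(g) ⊗ ρ'(g)`, where
`(-1)^F = (-1) ⊗ (-1) ⊗ 1`. -/
def traceOp {G : Type*} [Group G] (ρ : G →* LinearMap.GeneralLinearGroup ℂ PA.pos)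
    (ρ' : G →* LinearMap.GeneralLinearGroup ℂ PB.pos) (g : G) : Module.End ℂ (Wtw PE PA PB) :=
  -((glAct PE PA PB 1 (ρ g) (ρ' g) + glAct PE PA PB 1 (ρ g⁻¹) (ρ' g⁻¹))
    * opJe PE PA PB * glAct PE PA PB (-1) (-1) 1)

end Trace

/-! ### The umbral group of the Niemeier lattice with root system `A₃^8` -/

/-- The glue code: the `ℤ/4`-submodule of `(ℤ/4)^8` generated by the words `(3 | w)` with `w` a
cyclic shift of `2001011`. -/
def glueCode : Submodule (ZMod 4) (Fin 8 → ZMod 4) :=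
  Submodule.span (ZMod 4) (Set.range fun k : Fin 7 =>
    (Fin.cons 3 (fun j : Fin 7 => (![2, 0, 0, 1, 0, 1, 1] : Fin 7 → ZMod 4) (j - k)) :
      Fin 8 → ZMod 4))

/-- The Niemeier lattice with root system `A₃^8`. The `A₃` lattice is the set of vectors of `ℤ^4`
with coordinate sum zero, and the `c`-th coset of it in its dual consists of the vectors with
coordinate sum zero and all coordinates in `c/4 + ℤ`. -/
def niemeier : AddSubgroup (Fin 8 → Fin 4 → ℚ) where
  carrier := {x | (∀ j, ∑ i, x j i = 0) ∧ ∃ c : Fin 8 → ℤ,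
    (fun j => (c j : ZMod 4)) ∈ glueCode ∧ ∀ j i, ∃ m : ℤ, x j i = m + c j / 4}
  zero_mem' := ⟨fun j => by simp, 0, by
    simp only [Pi.zero_apply, Int.cast_zero]; exact glueCode.zero_mem, fun j i => ⟨0, by simp⟩⟩
  add_mem' := by
    rintro x y ⟨hx, c, hc, hxc⟩ ⟨hy, d, hd, hyd⟩
    refine ⟨fun j => by simp [Finset.sum_add_distrib, hx, hy], c + d, ?_, fun j i => ?_⟩
    · simpa [Pi.add_def] using glueCode.add_mem hc hd
    · obtain ⟨m, hm⟩ := hxc j i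
      obtain ⟨n, hn⟩ := hyd j i
      exact ⟨m + n, by simp only [Pi.add_apply, hm, hn]; push_cast; ring⟩
  neg_mem' := by
    rintro x ⟨hx, c, hc, hxc⟩
    refine ⟨fun j => by simp [hx], -c, ?_, fun j i => ?_⟩
    · simpa [Pi.neg_def] using glueCode.neg_mem hc
    · obtain ⟨m, hm⟩ := hxc j i
      exact ⟨-m, by simp only [Pi.neg_apply, hm]; push_cast; ring⟩

/-- The inner product of the lattice. -/
def latticeForm (x y : niemeier) : ℚ := ∑ j, ∑ i, x.1 j i * y.1 j i

/-- The automorphism group of the lattice. -/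
def latticeAut : Subgroup (niemeier ≃ₗ[ℤ] niemeier) where
  carrier := {σ | ∀ x y, latticeForm (σ x) (σ y) = latticeForm x y}
  one_mem' := fun _ _ => rfl
  mul_mem' := fun {σ σ'} hσ hσ' x y => (hσ (σ' x) (σ' y)).trans (hσ' x y)
  inv_mem' := fun {σ} hσ x y => by
    have h := hσ (σ⁻¹ x) (σ⁻¹ y)
    rw [← LinearEquiv.mul_apply, ← LinearEquiv.mul_apply, mul_inv_cancel] at h
    exact h.symm

/-- The reflections `x ↦ x - ⟨x, v⟩ v` in the roots `v`, that is, the vectors with `⟨v, v⟩ = 2`. -/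
def reflections : Set latticeAut :=
  {σ | ∃ v, latticeForm v v = 2 ∧ ∀ x, ∃ m : ℤ, (m : ℚ) = latticeForm x v ∧
    σ.1 x = x - m • v}

/-- The subgroup generated by the reflections in roots. -/
def latticeInn : Subgroup latticeAut := Subgroup.closure reflections

instance latticeInn_normal : latticeInn.Normal := by
  refine ⟨fun σ hσ τ => ?_⟩
  induction hσ using Subgroup.closure_induction with
  | mem σ h =>
    obtain ⟨v, hv, h⟩ := h
    refine Subgroup.subset_closure ⟨τ.1 v, (τ.2 v v).trans hv, fun x => ?_⟩
    obtain ⟨m, hm, h⟩ := h (τ.1⁻¹ x)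
    have hx : τ.1 (τ.1⁻¹ x) = x := by
      rw [← LinearEquiv.mul_apply, mul_inv_cancel]; rfl
    refine ⟨m, ?_, ?_⟩
    · have := τ.2 (τ.1⁻¹ x) v
      rw [hx] at this
      rw [hm, this]
    · change τ.1 (σ.1 (τ.1⁻¹ x)) = _
      rw [h, map_sub, map_zsmul, hx]
  | one => simp
  | mul a b _ _ ha hb =>
    have : τ * (a * b) * τ⁻¹ = τ * a * τ⁻¹ * (τ * b * τ⁻¹) := by group
    rw [this]; exact Subgroup.mul_mem _ ha hb
  | inv a _ ha =>
    have : τ * a⁻¹ * τ⁻¹ = (τ * a * τ⁻¹)⁻¹ := by group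
    rw [this]; exact Subgroup.inv_mem _ ha

/-- The umbral group `Aut(N)/Inn(N)` of the lattice. -/
abbrev UmbralGroup : Type := latticeAut ⧸ latticeInn

/-! ### Characters -/

/-- `b₇ = (-1 + √-7) / 2`. -/
def b7 : ℂ := (-1 + Complex.I * (Real.sqrt 7 : ℂ)) / 2

open Classical in
/-- The character `χ₂` (of degree `3`) of a group isomorphic to `SL₂(7)`, for the labelling of the
classes in which `u` (of order `7`) is in 7A. The classes are determined by the orders of their
elements, apart from 7A, 7B (consisting of the conjugates of `u` and of `u⁻¹`), 14A, 14B (consisting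
of the products of the central involution with the elements of 7A and 7B) and 8A, 8B (on which
`χ₂` and `χ₈` take the same value). If `g` has order `7` or `14` then `g ^ 8` is its part of
order `7`. -/
def chi2 {G : Type*} [Group G] (u g : G) : ℂ :=
  match orderOf g with
  | 1 => 3
  | 2 => 3
  | 4 => -1
  | 3 => 0
  | 6 => 0
  | 8 => 1
  | 7 => if IsConj u (g ^ 8) then b7 else star b7
  | 14 => if IsConj u (g ^ 8) then b7 else star b7
  | _ => 0

open Classical in
/-- The character `χ₈` (faithful, of degree `4`) of a group isomorphic to `SL₂(7)`, for the labelling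
of the classes in which `u` is in 7A. -/
def chi8 {G : Type*} [Group G] (u g : G) : ℂ :=
  match orderOf g with
  | 1 => 4
  | 2 => -4
  | 4 => 0
  | 3 => 1
  | 6 => -1
  | 8 => 0
  | 7 => if IsConj u (g ^ 8) then -star b7 else -b7
  | 14 => if IsConj u (g ^ 8) then star b7 else b7
  | _ => 0

/-! ### The meromorphic Jacobi forms -/

/-- `exp(2 π i x)`. -/
def expTwoPiI (x : ℂ) : ℂ := Complex.exp (2 * Real.pi * Complex.I * x)

/-- The Jacobi theta function
`θ₁(τ, z) = -i q^{1/8} y^{1/2} ∏_{n>0} (1 - y⁻¹ q^{n-1}) (1 - y q^n) (1 - q^n)`. -/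
def theta1 (τ z : ℂ) : ℂ :=
  -Complex.I * expTwoPiI (τ / 8) * expTwoPiI (z / 2) *
    ∏' n : ℕ, ((1 - (expTwoPiI z)⁻¹ * expTwoPiI τ ^ n) *
      (1 - expTwoPiI z * expTwoPiI τ ^ (n + 1)) * (1 - expTwoPiI τ ^ (n + 1)))

/-- The Jacobi theta function
`θ₂(τ, z) = q^{1/8} y^{1/2} ∏_{n>0} (1 + y⁻¹ q^{n-1}) (1 + y q^n) (1 - q^n)`. -/
def theta2 (τ z : ℂ) : ℂ :=
  expTwoPiI (τ / 8) * expTwoPiI (z / 2) *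
    ∏' n : ℕ, ((1 + (expTwoPiI z)⁻¹ * expTwoPiI τ ^ n) *
      (1 + expTwoPiI z * expTwoPiI τ ^ (n + 1)) * (1 - expTwoPiI τ ^ (n + 1)))

open ModularForm (eta)

/-- `ψ_{1A}`. -/
def psi1A (τ z : ℂ) : ℂ :=
  2 * Complex.I * (eta τ ^ 3 * theta1 τ (2 * z) ^ 3 / theta1 τ z ^ 4)

/-- `ψ_{2A}`. -/
def psi2A (τ z : ℂ) : ℂ :=
  2 * Complex.I * (eta τ ^ 3 * theta1 τ (2 * z) ^ 3 / theta2 τ z ^ 4)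

/-- `ψ_{4A}`. -/
def psi4A (τ z : ℂ) : ℂ :=
  -2 * Complex.I * (eta (2 * τ) ^ 2 * theta1 τ (2 * z) * theta2 τ (2 * z) ^ 2 /
    (eta τ * theta2 (2 * τ) (2 * z) ^ 2))

/-- `ψ_{3A}`. -/
def psi3A (τ z : ℂ) : ℂ :=
  2 * Complex.I * (eta τ ^ 3 * theta1 (3 * τ) (6 * z) / (theta1 τ z * theta1 (3 * τ) (3 * z)))

/-- `ψ_{6A}`. -/
def psi6A (τ z : ℂ) : ℂ :=
  -2 * Complex.I * (eta τ ^ 3 * theta1 (3 * τ) (6 * z) / (theta2 τ z * theta2 (3 * τ) (3 * z)))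

/-- `ψ_{8A}`. -/
def psi8A (τ z : ℂ) : ℂ :=
  -2 * Complex.I * (eta τ * eta (4 * τ) * theta1 τ (2 * z) * theta2 (2 * τ) (4 * z) /
    (eta (2 * τ) * theta2 (4 * τ) (4 * z)))

/-- `ψ_{7A} = ψ_{7B}`. -/
def psi7AB (τ z : ℂ) : ℂ :=
  -Complex.I * (eta (7 * τ) / (eta τ ^ 4 * theta1 (7 * τ) (7 * z))) *
    (theta1 τ (2 * z + 1 / 7) * theta1 τ (2 * z + 2 / 7) * theta1 τ (2 * z + 4 / 7) *
        theta1 τ (z - 1 / 7) * theta1 τ (z - 2 / 7) * theta1 τ (z - 4 / 7)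
      + theta1 τ (2 * z - 1 / 7) * theta1 τ (2 * z - 2 / 7) * theta1 τ (2 * z - 4 / 7) *
        theta1 τ (z + 1 / 7) * theta1 τ (z + 2 / 7) * theta1 τ (z + 4 / 7))

/-- `ψ_{14A} = ψ_{14B}`. -/
def psi14AB (τ z : ℂ) : ℂ :=
  Complex.I * (eta (7 * τ) / (eta τ ^ 4 * theta2 (7 * τ) (7 * z))) *
    (theta1 τ (2 * z + 1 / 7) * theta1 τ (2 * z + 2 / 7) * theta1 τ (2 * z + 4 / 7) *
        theta2 τ (z - 1 / 7) * theta2 τ (z - 2 / 7) * theta2 τ (z - 4 / 7)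
      + theta1 τ (2 * z - 1 / 7) * theta1 τ (2 * z - 2 / 7) * theta1 τ (2 * z - 4 / 7) *
        theta2 τ (z + 1 / 7) * theta2 τ (z + 2 / 7) * theta2 τ (z + 4 / 7))

open Classical in
/-- The meromorphic Jacobi form `ψ_g`, for `g` in one of the conjugacy classes 1A, 2A, 4A, 3A, 6A,
8A, 7AB, 14AB of the umbral group (those that meet a subgroup isomorphic to `SL₂(7)`); the value `0`
in the other classes is a dummy. The umbral group has order `2688`. Of its classes of elements of
order `2`, `4`, `6`, the class 2A (the central involution) consists of the fourth powers of order
`2`, the class 4A of the squares of order `4`, and 6A of the elements of order `6` whose cube is in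
2A. Elements of order `3` or `8` form a single class, and those of order `7` or `14` two classes. -/
def psi (g : UmbralGroup) (τ z : ℂ) : ℂ :=
  if orderOf g = 1 then psi1A τ z
  else if orderOf g = 2 ∧ (∃ h, h ^ 4 = g) then psi2A τ z
  else if orderOf g = 4 ∧ (∃ h, h ^ 2 = g) then psi4A τ z
  else if orderOf g = 3 then psi3A τ z
  else if orderOf g = 6 ∧ (∃ h, h ^ 4 = g ^ 3) then psi6A τ z
  else if orderOf g = 8 then psi8A τ z
  else if orderOf g = 7 then psi7AB τ z
  else if orderOf g = 14 then psi14AB τ z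
  else 0

end

end UmbralFour

open UmbralFour

namespace UmbralFour

namespace PolarizedSpace

variable {s : ℂ} {V : Type*} [AddCommGroup V] [Module ℂ V] {ι : Type} [Fintype ι] [DecidableEq ι]

/-! ### Commutation relations -/

/-! The Fock spaces are given by generators and relations, so they must first be shown not to
collapse. The vacuum is nonzero because a Clifford algebra acts on an exterior algebra and a Weyl
algebra on a polynomial ring (`vac_ne_zero`). Products "create after annihilate" are number
operators. They separate the monomials in the creation operators, which therefore form a basis,
indexed by finite sets for fermions and by multisets for bosons (`Frame.basis`). In this basis
`J(0)` and `L(0)` are diagonal with additive eigenvalues; the vacuum contributes `2·3/2 - 4/2 = 1`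
to `J(0)` and `(1 + 3 - 4)/8 = 0` to `L(0)`. This gives the grading, and convergence of the state
sum at a single point already gives finiteness of its pieces (`finite_biDeg_fibre`).

An element `g` of finite order is diagonalizable on `a⁺` and `b⁺`. In dual frames adapted to
eigenbases, with eigenvalues `λ_i` and `μ_j`, it acts diagonally on monomials, and the trace becomes
a sum of products of local weights. With `Θ(x) = ∏ (1 - x⁻¹ q^(n-1)) (1 - x q^n)`, the fermions `a`
give `∏ Θ(λ_i y²)` and the bosons `b` give `∏ Θ(μ_j y)⁻¹`, convergent for `1 < |y| < |q|⁻¹`. In `e`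
the zero mode `a⁻(0)` has weight `-1`, so the plain trace would cancel; the insertion of `J_e(0)`
makes the states with and without this mode combine to `∏ (1 - q^n)²` (`hasSum_finset_statistic`).
Adding the term of `g⁻¹` gives the closed formula of `hasSum_traceOp`.

It remains to compare with the Jacobi forms (`traceValue_eq_psi`). If `7` does not divide the order
of `g`, the power sums of the eigenvalues are integers read off from the characters. Newton's
identities turn them into a characteristic polynomial that is a product of factors `1 ± t^d`, and
theta products factor in the same way (`prod_thetaProd`). For order `7` the trace alone determines
the eigenvalues, `ζ, ζ², ζ⁴` or their inverses, and the symmetry between `g` and `g⁻¹` makes the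
choice immaterial; the denominator at `(7τ, 7z)` is the product of all seven `Θ(ζ^k y)`. Order `14`
differs by a sign in `μ`. About `SL₂(7)` only the possible orders and the existence of certain roots
of elements are needed.

Independently of the trace, the formulas for `J(0)` and `L(0)` follow from the twisted Borcherds
identity with `l = -1` and `l = -2` (`zeroModesAreCoefficients`). -/

theorem gen_add (P : PolarizedSpace s V ι) (c : ℤ) (v w : V) (n : ℤ) :
    P.gen c (v + w) n = P.gen c v n + P.gen c w n := by
  simp [gen]

theorem gen_smul (P : PolarizedSpace s V ι) (c : ℤ) (t : ℂ) (v : V) (n : ℤ) :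
    P.gen c (t • v) n = t • P.gen c v n := by
  rw [gen, ← Finsupp.smul_single, map_smul, gen]

/-- The modes `v[n]` as a linear function of `v`. -/
noncomputable def modeHom (P : PolarizedSpace s V ι) (c n : ℤ) :
    V →ₗ[ℂ] Module.End ℂ (P.Fock c) where
  toFun v := P.mode c v n
  map_add' v w := by simp [mode, gen_add]
  map_smul' t v := by simp [mode, gen_smul]

theorem modeHom_apply (P : PolarizedSpace s V ι) (c n : ℤ) (v : V) :
    P.modeHom c n v = P.mode c v n := rfl

theorem mode_apply (P : PolarizedSpace s V ι) (c : ℤ) (v : V) (n : ℤ) (x : P.Fock c) :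
    P.mode c v n x = P.gen c v n • x := rfl

theorem mode_mode (P : PolarizedSpace s V ι) (c : ℤ) (v w : V) (m n : ℤ) (x : P.Fock c) :
    P.mode c v m (P.mode c w n x) = s • P.mode c w n (P.mode c v m x)
      + (if m + n = c then P.form v w else 0) • x := by
  have h := congrArg (fun a => a • x) (P.gen_mul c v w m n)
  simp only [sub_smul, mul_smul, algebraMap_smul, smul_assoc] at h
  exact eq_add_of_sub_eq' h

theorem mode_vac_of_pos (P : PolarizedSpace s V ι) (c : ℤ) (v : V) (n : ℤ) (hn : 0 < n) :
    P.mode c v n (P.vac c) = 0 := by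
  rw [mode_apply, vac, ← map_smul, smul_eq_mul, mul_one, toFock_eq_zero]
  exact Submodule.subset_span ⟨v, n, rfl, Or.inl hn⟩

theorem mode_zero_vac (P : PolarizedSpace s V ι) (c : ℤ) (v : V) (h : c = 0 → v ∈ P.pos) :
    P.mode c v 0 (P.vac c) = 0 := by
  rw [mode_apply, vac, ← map_smul, smul_eq_mul, mul_one, toFock_eq_zero]
  exact Submodule.subset_span ⟨v, 0, rfl, Or.inr ⟨rfl, h⟩⟩

theorem mode_vac_of_nonneg (P : PolarizedSpace s V ι) (v : V) (n : ℤ) (hn : 0 ≤ n) :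
    P.mode (-1) v n (P.vac (-1)) = 0 := by
  rcases hn.lt_or_eq with h | rfl
  · exact P.mode_vac_of_pos _ _ _ h
  · exact P.mode_zero_vac _ _ (by norm_num)

/-! ### The zero modes as coefficients of twisted vertex operators -/

theorem mode_vac_mem_part (P : PolarizedSpace s V ι) (v : V) :
    P.mode (-1) v (-1) (P.vac (-1)) ∈ P.part (-1) 1 := by
  refine Submodule.subset_span ⟨[(v, -1)], by simp, ?_⟩
  rw [mode_apply, vac, ← map_smul]
  simp

theorem form_pos_neg (P : PolarizedSpace s V ι) (i j : ι) :
    P.form (P.bpos i) (P.bneg j) = if i = j then -s else 0 := by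
  rw [P.form_swap (P.bneg j : V), P.dual]
  by_cases h : i = j
  · simp [h]
  · simp [h, Ne.symm h]

/-- Only `v(1/2)` pairs with `w(-1/2)`, and all `v(k + 1/2)` with `k ≥ 0` kill the vacuum. This
truncates the iterate side of the Borcherds identity to two or three terms. -/
theorem mode_mode_vac (P : PolarizedSpace s V ι) (v w : V) (k : ℕ) :
    P.mode (-1) v k (P.mode (-1) w (-1) (P.vac (-1))) =
      if k = 0 then P.form v w • P.vac (-1) else 0 := by
  rw [mode_mode, mode_vac_of_nonneg _ _ _ (by positivity), map_zero, smul_zero, zero_add]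
  by_cases h : k = 0
  · simp [h]
  · rw [if_neg (by omega), if_neg h, zero_smul]

/-- The coefficients of `(1 - x)⁻¹`; with `choose_neg_two`, for `(1 - x)⁻²`, these are the
coefficients on the product side of the Borcherds identity for `l = -1` and `l = -2`. -/
theorem choose_neg_one (k : ℕ) : (-1 : ℂ) ^ k * Ring.choose (-1 : ℂ) k = 1 := by
  induction k with
  | zero => simp
  | succ k ih =>
    have h := Ring.choose_succ_succ (-1 : ℂ) k
    rw [neg_add_cancel, Ring.choose_zero_succ] at h
    rw [pow_succ]
    linear_combination (-1) ^ k * h + ih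

theorem choose_neg_two (k : ℕ) : (-1 : ℂ) ^ k * Ring.choose (-2 : ℂ) k = k + 1 := by
  induction k with
  | zero => simp
  | succ k ih =>
    have h1 := Ring.choose_succ_succ (-2 : ℂ) k
    have h2 := choose_neg_one (k + 1)
    rw [show (-2 : ℂ) + 1 = -1 by norm_num] at h1
    push_cast
    rw [pow_succ] at h2 ⊢
    linear_combination (-1) ^ k * h1 + h2 + ih

theorem choose_half_two (x : ℂ) : Ring.choose x 2 = x * (x - 1) / 2 := by
  have h := Ring.choose_succ_succ (x - 1) 1
  have h2 := Ring.choose_smul_choose x (n := 2) (k := 1) (by norm_num)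
  norm_num [Ring.choose_one_right] at h2
  linear_combination h2 / 2

/-! ### Twisted vertex operators of quadratic vectors -/

section Twisted

variable {P : PolarizedSpace s V ι} {Y : P.Fock (-1) →ₗ[ℂ] ℤ → Module.End ℂ (P.Fock (-1))}
  {Ytw : P.Fock (-1) →ₗ[ℂ] ℤ → Module.End ℂ (P.Fock 0)}

/-- Generators are odd, so both exponents are odd: `a = 2m + 1` and `b = 2n - 1`. Since exponent `2n
- 1` is the mode `v(n)`, the first exponent belongs to `v(m + 1)`, which is the source of the shift
by one. -/
theorem twisted_borcherds_generators (hY : P.IsVertexStructure Y)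
    (hT : P.IsTwistedStructure Y Ytw) (v w : V) (l m n : ℤ) (x : P.Fock 0) :
    ∑ᶠ k : ℕ, Ring.choose (((2 * m + 1 : ℤ) : ℂ) / 2) k •
        Ytw (P.mode (-1) v (l + k) (P.mode (-1) w (-1) (P.vac (-1)))) (2 * (m + n - k)) x =
      ∑ᶠ k : ℕ, ((-1) ^ k * (Ring.choose l k : ℂ)) •
        (P.mode 0 v (m + 1 + l - k) (P.mode 0 w (n + k) x)
          - ((-1) ^ l * s) • P.mode 0 w (n + l - k) (P.mode 0 v (m + 1 + k) x)) := by
  have h := hT.borcherds 1 1 _ (P.mode_vac_mem_part v) _ (P.mode_vac_mem_part w) x l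
    (2 * m + 1) (2 * n - 1) (by push_cast; rw [show (2 : ZMod 2) = 0 from rfl]; ring)
    (by push_cast; rw [show (2 : ZMod 2) = 0 from rfl]; ring_nf; rfl)
  have e1 : ∀ k : ℕ, 2 * m + 1 + 2 * l - 2 * (k : ℤ) = 2 * (m + 1 + l - k) - 1 := fun k => by ring
  have e2 : ∀ k : ℕ, 2 * n - 1 + 2 * (k : ℤ) = 2 * (n + k) - 1 := fun k => by ring
  have e3 : ∀ k : ℕ, 2 * n - 1 + 2 * l - 2 * (k : ℤ) = 2 * (n + l - k) - 1 := fun k => by ring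
  have e4 : ∀ k : ℕ, 2 * m + 1 + 2 * (k : ℤ) = 2 * (m + 1 + k) - 1 := fun k => by ring
  have e5 : ∀ k : ℕ, 2 * m + 1 + (2 * n - 1) - 2 * (k : ℤ) = 2 * (m + n - k) := fun k => by ring
  simpa only [e1, e2, e3, e4, e5, hT.generators, hY.generators, and_self, if_true] using h

/-- The case `l = -1`, `m = n = 0`. The contraction term carries `binom(1/2, 1) = 1/2`, which is
what symmetrizes the zero-mode product. -/
theorem Ytw_normal_one (hY : P.IsVertexStructure Y)
    (hT : P.IsTwistedStructure Y Ytw) (v w : V) (x : P.Fock 0) (N : ℕ)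
    (hN : ∀ n : ℤ, N ≤ n → ∀ v, P.mode 0 v n x = 0) :
    Ytw (P.mode (-1) v (-1) (P.mode (-1) w (-1) (P.vac (-1)))) 0 x =
      P.mode 0 v 0 (P.mode 0 w 0 x) - (P.form v w / 2) • x +
        ∑ k ∈ Finset.range N, (P.mode 0 v (-(k + 1)) (P.mode 0 w (k + 1) x)
          + s • P.mode 0 w (-(k + 1)) (P.mode 0 v (k + 1) x)) := by
  have h := twisted_borcherds_generators hY hT v w (-1) 0 0 x
  rw [finsum_eq_sum_of_support_subset (s := Finset.range 2) _ (by
      intro k hk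
      by_contra hk'
      simp only [Finset.coe_range, Set.mem_Iio, not_lt] at hk'
      refine hk ?_
      obtain ⟨j, rfl⟩ := Nat.exists_eq_add_of_le hk'
      beta_reduce
      rw [show (-1 + ((2 + j : ℕ) : ℤ)) = ((j + 1 : ℕ) : ℤ) by push_cast; ring, mode_mode_vac,
        if_neg (by omega)]
      simp),
    finsum_eq_sum_of_support_subset (s := Finset.range (N + 1)) _ (by
      intro k hk
      by_contra hk'
      simp only [Finset.coe_range, Set.mem_Iio, not_lt] at hk'
      refine hk ?_
      beta_reduce
      rw [hN _ (by omega), hN _ (by omega)]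
      simp)] at h
  have e1 := P.mode_mode_vac v w 0
  have e2 : ∀ k : ℕ, (-1 : ℂ) ^ k * (Ring.choose (-1 : ℤ) k : ℂ) = 1 := fun k => by
    have h := choose_neg_one k
    push_cast
    exact h
  have e3 : ∑ k ∈ Finset.range (N + 1), P.mode 0 v (-k) (P.mode 0 w k x) =
      P.mode 0 v 0 (P.mode 0 w 0 x) +
        ∑ k ∈ Finset.range N, P.mode 0 v (-(k + 1)) (P.mode 0 w (k + 1) x) := by
    rw [Finset.sum_range_succ', add_comm]
    simp
  -- The two families are offset by one: the `v`-first family starts at the zero mode, the `w`-first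
  -- family at mode one, so in the latter the last term of the range vanishes.
  have e4 : ∑ k ∈ Finset.range (N + 1), P.mode 0 w (-(k + 1)) (P.mode 0 v (k + 1) x) =
      ∑ k ∈ Finset.range N, P.mode 0 w (-(k + 1)) (P.mode 0 v (k + 1) x) := by
    rw [Finset.sum_range_succ, hN _ (by omega), map_zero, add_zero]
  have e5 : ∀ k : ℕ, (0 : ℤ) + -1 - k = -(k + 1) := fun k => by ring
  have e6 : ∀ k : ℕ, (0 : ℤ) + 1 + k = k + 1 := fun k => by ring
  have e7 : ∀ k : ℕ, (0 : ℤ) + 1 + -1 - k = -k := fun k => by ring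
  simp only [e2, e5, e6, e7, one_smul] at h
  simp only [zero_add] at h
  rw [Finset.sum_sub_distrib, e3, ← Finset.smul_sum, e4] at h
  rw [Finset.sum_add_distrib, ← Finset.smul_sum]
  rw [Finset.sum_range_succ, Finset.sum_range_one] at h
  simp only [Nat.cast_zero, if_true, Nat.cast_one, neg_add_cancel] at e1 h
  rw [e1] at h
  norm_num [hT.vacuum, Ring.choose_one_right, map_smul] at h
  simp only [show ∀ k : ℕ, (-1 : ℤ) + -k = -(k + 1) from fun k => by ring] at h
  rw [eq_sub_of_add_eq h]
  module

/-- The case `l = -2`, `m = 1`, `n = 0`. Three terms survive on the iterate side: the operator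
sought, `3/2` times the operator of `Ytw_normal_one`, and the contraction with `binom(3/2, 2) =
3/8`. Solving for the first gives `3/4 - 3/8 = 3/8` for the scalar. -/
theorem Ytw_normal_two (hY : P.IsVertexStructure Y)
    (hT : P.IsTwistedStructure Y Ytw) (v w : V) (x : P.Fock 0) (N : ℕ)
    (hN : ∀ n : ℤ, N ≤ n → ∀ v, P.mode 0 v n x = 0) :
    Ytw (P.mode (-1) v (-2) (P.mode (-1) w (-1) (P.vac (-1)))) 2 x =
      (-1 / 2 : ℂ) • P.mode 0 v 0 (P.mode 0 w 0 x) + (3 * P.form v w / 8) • x +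
        ∑ k ∈ Finset.range N, ((k + 1 / 2 : ℂ) • P.mode 0 v (-(k + 1)) (P.mode 0 w (k + 1) x)
          - (s * (k + 3 / 2 : ℂ)) • P.mode 0 w (-(k + 1)) (P.mode 0 v (k + 1) x)) := by
  have h := twisted_borcherds_generators hY hT v w (-2) 1 0 x
  rw [finsum_eq_sum_of_support_subset (s := Finset.range 3) _ (by
      intro k hk
      by_contra hk'
      simp only [Finset.coe_range, Set.mem_Iio, not_lt] at hk'
      refine hk ?_
      obtain ⟨j, rfl⟩ := Nat.exists_eq_add_of_le hk'
      beta_reduce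
      rw [show (-2 + ((3 + j : ℕ) : ℤ)) = ((j + 1 : ℕ) : ℤ) by push_cast; ring, mode_mode_vac,
        if_neg (by omega)]
      simp),
    finsum_eq_sum_of_support_subset (s := Finset.range (N + 1)) _ (by
      intro k hk
      by_contra hk'
      simp only [Finset.coe_range, Set.mem_Iio, not_lt] at hk'
      refine hk ?_
      beta_reduce
      rw [hN _ (by omega), hN _ (by omega)]
      simp)] at h
  have e1 := P.mode_mode_vac v w 0
  have e2 : ∀ k : ℕ, (-1 : ℂ) ^ k * (Ring.choose (-2 : ℤ) k : ℂ) = k + 1 := fun k => by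
    have h := choose_neg_two k
    push_cast
    exact h
  have e3 : ∑ k ∈ Finset.range (N + 1), (k + 1 : ℂ) • P.mode 0 v (-k) (P.mode 0 w k x) =
      P.mode 0 v 0 (P.mode 0 w 0 x) +
        ∑ k ∈ Finset.range N, (k + 2 : ℂ) • P.mode 0 v (-(k + 1)) (P.mode 0 w (k + 1) x) := by
    rw [Finset.sum_range_succ', add_comm]
    simp [add_assoc, one_add_one_eq_two]
  have e4 : ∑ k ∈ Finset.range (N + 1), (k + 1 : ℂ) • P.mode 0 w (-2 - k) (P.mode 0 v (2 + k) x) =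
      ∑ k ∈ Finset.range N, (k : ℂ) • P.mode 0 w (-(k + 1)) (P.mode 0 v (k + 1) x) := by
    -- Reindexing by one is harmless at both ends: the new bottom term has coefficient `0`, and the
    -- new top terms involve modes that kill `x`.
    have e := Finset.sum_range_succ' (fun k : ℕ =>
      (k : ℂ) • P.mode 0 w (-(k + 1)) (P.mode 0 v (k + 1) x)) (N + 1)
    rw [Finset.sum_range_succ, Finset.sum_range_succ, hN (N + 1) (by omega),
      hN ((N + 1 : ℕ) + 1) (by omega)] at e
    simp only [map_zero, smul_zero, add_zero, Nat.cast_zero, zero_smul] at e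
    rw [e]
    refine Finset.sum_congr rfl fun k _ => ?_
    rw [show (-2 - k : ℤ) = -(((k + 1 : ℕ) : ℤ) + 1) by push_cast; ring,
      show (2 + k : ℤ) = ((k + 1 : ℕ) : ℤ) + 1 by push_cast; ring]
    push_cast
    rfl
  have e5 : ∀ k : ℕ, (0 : ℤ) + -2 - k = -2 - k := fun k => by ring
  have e6 : ∀ k : ℕ, (1 : ℤ) + 1 + k = 2 + k := fun k => by ring
  have e7 : ∀ k : ℕ, (1 : ℤ) + 1 + -2 - k = -k := fun k => by ring
  simp only [e2, e5, e6, e7, smul_sub, smul_smul] at h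
  simp only [zero_add] at h
  simp only [mul_comm _ (((-1 : ℂ) ^ (-2 : ℤ)) * s), mul_smul] at h
  rw [Finset.sum_sub_distrib, e3, ← Finset.smul_sum, ← Finset.smul_sum, e4] at h
  rw [Finset.sum_range_succ, Finset.sum_range_succ, Finset.sum_range_one] at h
  have e8 := Ytw_normal_one hY hT v w x N hN
  norm_num at e1 h
  rw [e1] at h
  norm_num [hT.vacuum, Ring.choose_one_right, choose_half_two] at h
  have e10 : ∀ k : ℕ, (-1 : ℤ) + -k = -(k + 1) := fun k => by ring
  rw [e8] at h
  simp only [e10] at h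
  rw [eq_sub_of_add_eq (eq_sub_of_add_eq h)]
  simp only [add_smul, mul_smul, mul_add, Finset.sum_sub_distrib,
    Finset.sum_add_distrib, ← Finset.smul_sum]
  module

/-- On every vector, a power sum of modes is a finite sum. -/
theorem modeSum_apply (P : PolarizedSpace s V ι) (p : ℕ) (t : ℂ) (x : P.Fock 0) (N : ℕ)
    (hN : ∀ n : ℤ, N ≤ n → ∀ v, P.mode 0 v n x = 0) :
    P.modeSum p t x = ∑ n ∈ Finset.range N, ((n : ℂ) + 1) ^ p • ∑ i,
      (P.mode 0 (P.bpos i) (-(n + 1)) (P.mode 0 (P.bneg i) (n + 1) x)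
        + t • P.mode 0 (P.bneg i) (-(n + 1)) (P.mode 0 (P.bpos i) (n + 1) x)) := by
  refine finsum_eq_sum_of_support_subset _ fun k hk => ?_
  by_contra hk'
  simp only [Finset.coe_range, Set.mem_Iio, not_lt] at hk'
  refine hk ?_
  simp [hN (k + 1) (by omega)]

theorem exists_nat_mode_eq_zero (P : PolarizedSpace s V ι) (x : P.Fock 0) :
    ∃ N : ℕ, ∀ n : ℤ, N ≤ n → ∀ v, P.mode 0 v n x = 0 := by
  obtain ⟨N, hN⟩ := P.exists_mode_eq_zero x
  exact ⟨N.toNat, fun n hn => hN n (by omega)⟩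

/-- For `J(0)`, the half contraction turns `a⁺(0) a⁻(0)` into the symmetrized product. For `L(0)`,
swapping the modes in the second term of `ω` brings both terms to the form of `Ytw_normal_two`. The
zero modes then combine to the scalar `s/2` and the contractions to `-3s/4`; after the factor `1/2`
each pair `a_i^±` contributes `-s/8`. -/
theorem zeroModesAreCoefficients (P : PolarizedSpace s V ι) (hs : s * s = 1) :
    P.ZeroModesAreCoefficients := by
  intro Y Ytw hY hT
  constructor <;> ext x <;> obtain ⟨N, hN⟩ := P.exists_nat_mode_eq_zero x
  · simp only [jVec, map_sum, Finset.sum_apply, LinearMap.sum_apply,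
      Ytw_normal_one hY hT _ _ x N hN]
    simp only [zeroJ, LinearMap.add_apply, LinearMap.smul_apply, LinearMap.sum_apply,
      Module.End.mul_apply, P.modeSum_apply 0 s x N hN, pow_zero, one_smul]
    rw [Finset.sum_add_distrib, Finset.sum_comm, Finset.smul_sum]
    congr 1
    refine Finset.sum_congr rfl fun i _ => ?_
    rw [P.mode_mode 0 (P.bneg i) (P.bpos i), form_pos_neg, P.dual]
    simp only [if_true, add_zero, smul_add, smul_smul, one_smul]
    rw [mul_left_comm, ← mul_assoc, mul_comm s (1 / 2), mul_assoc, hs]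
    module
  · have e : ∀ i, P.mode (-1) (P.bpos i) (-1) (P.mode (-1) (P.bneg i) (-2) (P.vac (-1))) =
        s • P.mode (-1) (P.bneg i) (-2) (P.mode (-1) (P.bpos i) (-1) (P.vac (-1))) := fun i => by
      rw [mode_mode]; norm_num
    simp only [omegaVec, e, map_sum, map_smul, map_sub, Finset.sum_apply, LinearMap.sum_apply,
      Pi.smul_apply, Pi.sub_apply, LinearMap.smul_apply, LinearMap.sub_apply,
      Ytw_normal_two hY hT _ _ x N hN]
    simp only [zeroL, LinearMap.sub_apply, LinearMap.smul_apply, Module.End.one_apply,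
      P.modeSum_apply 1 (-s) x N hN, pow_one]
    simp only [Finset.smul_sum]
    have e2 : (s * Fintype.card ι / 8) • x = ∑ _i : ι, (s / 8) • x := by
      rw [Finset.sum_const, Finset.card_univ, ← Nat.cast_smul_eq_nsmul ℂ, smul_smul]
      congr 1
      ring
    rw [Finset.sum_comm, e2, ← Finset.sum_sub_distrib]
    refine Finset.sum_congr rfl fun i _ => ?_
    rw [P.mode_mode 0 (P.bneg i) (P.bpos i), form_pos_neg, P.dual]
    simp only [if_true, add_zero]
    rcases mul_self_eq_one_iff.1 hs with rfl | rfl <;>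
    · simp only [add_smul, neg_smul, one_smul, smul_neg, one_mul, neg_mul, mul_add, neg_neg,
        Finset.sum_neg_distrib, Finset.sum_sub_distrib, smul_add, smul_sub,
        Finset.sum_add_distrib, ← Finset.smul_sum]
      module

end Twisted

end PolarizedSpace

/-! ### Nonvanishing of the vacuum -/

namespace FreeAlg

variable {U : Type*} [AddCommGroup U] [Module ℂ U]

/-- The homomorphism from the Clifford or Weyl algebra determined by a linear map that satisfies
the relations. -/
noncomputable def lift {s : ℂ} {B : U →ₗ[ℂ] U →ₗ[ℂ] ℂ} {R : Type*} [Ring R] [Algebra ℂ R]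
    (f : U →ₗ[ℂ] R) (hf : ∀ x y, f x * f y - s • (f y * f x) = algebraMap ℂ R (B x y)) :
    FreeAlg s B →ₐ[ℂ] R :=
  RingQuot.liftAlgHom ℂ ⟨TensorAlgebra.lift ℂ f, by
    rintro _ _ ⟨x, y⟩
    simpa using hf x y⟩

theorem lift_ι {s : ℂ} {B : U →ₗ[ℂ] U →ₗ[ℂ] ℂ} {R : Type*} [Ring R] [Algebra ℂ R]
    (f : U →ₗ[ℂ] R) (hf : ∀ x y, f x * f y - s • (f y * f x) = algebraMap ℂ R (B x y)) (x : U) :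
    lift f hf (ι s B x) = f x := by
  simp [lift, ι]

/-- The Fock representation of a Clifford algebra on an exterior algebra. -/
theorem exists_fock_clifford (B : U →ₗ[ℂ] U →ₗ[ℂ] ℂ) (hB : ∀ x y, B y x = B x y)
    (Q : U →ₗ[ℂ] U) (hQ : ∀ x y, B (Q x) (Q y) = 0)
    (hQ' : ∀ x y, B (x - Q x) (y - Q y) = 0) :
    ∃ f : U →ₗ[ℂ] Module.End ℂ (ExteriorAlgebra ℂ U),
      (∀ x y, f x * f y - (-1 : ℂ) • (f y * f x) = algebraMap ℂ _ (B x y)) ∧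
      ∀ x, Q x = x → f x 1 = 0 := by
  let D : Module.Dual ℂ U →ₗ[ℂ] Module.End ℂ (ExteriorAlgebra ℂ U) :=
    CliffordAlgebra.contractLeft
  -- The part `x - Q x` acts by exterior multiplication (creation) and `Q x` by contraction with `B
  -- (Q x)` (annihilation).
  refine ⟨LinearMap.mul ℂ _ ∘ₗ ExteriorAlgebra.ι ℂ ∘ₗ (LinearMap.id - Q) + D ∘ₗ B ∘ₗ Q, ?_, ?_⟩
  · intro x y
    refine LinearMap.ext fun m => ?_
    have h1 : ∀ (d : Module.Dual ℂ U) u (n : ExteriorAlgebra ℂ U), D d (ExteriorAlgebra.ι ℂ u * n)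
        = d u • n - ExteriorAlgebra.ι ℂ u * D d n := fun d u n =>
      CliffordAlgebra.contractLeft_ι_mul d u n
    have h2 : D (B (Q x)) (D (B (Q y)) m) = - D (B (Q y)) (D (B (Q x)) m) :=
      CliffordAlgebra.contractLeft_comm _ _ _
    have h3 := congrArg (fun t : ExteriorAlgebra ℂ U => t * m)
      (ExteriorAlgebra.ι_add_mul_swap (R := ℂ) (x - Q x) (y - Q y))
    -- Both the image of `Q` and that of `1 - Q` are isotropic, so only the mixed pairings remain,
    -- and these are what contraction against multiplication produces.
    have h4 : B x y = B (Q x) (y - Q y) + B (Q y) (x - Q x) := by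
      have e1 := hQ' x y
      have e2 := hQ x y
      simp only [map_sub, LinearMap.sub_apply] at e1 e2 ⊢
      linear_combination e1 + e2 - hB x (Q y) + hB (Q x) (Q y)
    simp only [LinearMap.add_apply, LinearMap.comp_apply, LinearMap.sub_apply, LinearMap.id_apply,
      LinearMap.smul_apply, Module.End.mul_apply, LinearMap.mul_apply', mul_add, map_add, h1, h2,
      Module.algebraMap_end_apply, h4, add_mul, mul_assoc, zero_mul] at h3 ⊢
    rw [eq_neg_of_add_eq_zero_left h3]
    module
  · intro x hx
    have : D (B (Q x)) 1 = 0 := CliffordAlgebra.contractLeft_one _ _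
    rw [hx] at this
    simp [hx, this]

/-- The Fock representation of a Weyl algebra on a polynomial algebra. -/
theorem exists_fock_weyl (B : U →ₗ[ℂ] U →ₗ[ℂ] ℂ) (hB : ∀ x y, B y x = - B x y)
    (Q : U →ₗ[ℂ] U) (hQ : ∀ x y, B (Q x) (Q y) = 0)
    (hQ' : ∀ x y, B (x - Q x) (y - Q y) = 0) :
    ∃ f : U →ₗ[ℂ] Module.End ℂ (MvPolynomial (Module.Basis.ofVectorSpaceIndex ℂ U) ℂ),
      (∀ x y, f x * f y - (1 : ℂ) • (f y * f x) = algebraMap ℂ _ (B x y)) ∧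
      ∀ x, Q x = x → f x 1 = 0 := by
  -- A basis identifies the symmetric algebra of `U` with a polynomial ring. There `x - Q x` acts by
  -- multiplication with a linear form and `Q x` by the derivation that extends `B (Q x)`.
  set b := Module.Basis.ofVectorSpace ℂ U
  let X := b.constr ℂ (fun i => (MvPolynomial.X i : MvPolynomial _ ℂ))
  let D (u : U) : Derivation ℂ (MvPolynomial (Module.Basis.ofVectorSpaceIndex ℂ U) ℂ)
      (MvPolynomial (Module.Basis.ofVectorSpaceIndex ℂ U) ℂ) :=
    MvPolynomial.mkDerivation ℂ (fun i => MvPolynomial.C (B (Q u) (b i)))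
  have hD : ∀ u i, D u (MvPolynomial.X i) = MvPolynomial.C (B (Q u) (b i)) := fun u i =>
    MvPolynomial.mkDerivation_X _ _ _
  have hXb : ∀ i, X (b i) = MvPolynomial.X i := fun i => b.constr_basis _ _ _
  have hDX : ∀ u v, D u (X v) = MvPolynomial.C (B (Q u) v) := by
    intro u
    have : (D u).toLinearMap ∘ₗ X = (Algebra.linearMap ℂ _) ∘ₗ B (Q u) :=
      b.ext fun i => by simp [hXb, hD, MvPolynomial.algebraMap_eq]
    exact fun v => LinearMap.congr_fun this v
  have hadd : ∀ u v, D (u + v) = D u + D v := fun u v =>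
    MvPolynomial.derivation_ext fun i => by simp [hD]
  have hsmul : ∀ (t : ℂ) u, D (t • u) = t • D u := fun t u =>
    MvPolynomial.derivation_ext fun i => by simp [hD, MvPolynomial.smul_eq_C_mul]
  have hcomm : ∀ u v m, D u (D v m) = D v (D u m) := by
    intro u v m
    have : ⁅D u, D v⁆ = 0 := MvPolynomial.derivation_ext fun i => by
      simp [Derivation.commutator_apply, hD]
    have h := congrArg (fun d => d m) this
    simpa [Derivation.commutator_apply, sub_eq_zero] using h
  let D' : U →ₗ[ℂ] Module.End ℂ (MvPolynomial (Module.Basis.ofVectorSpaceIndex ℂ U) ℂ) :=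
    { toFun := fun u => (D u).toLinearMap
      map_add' := fun u v => by rw [hadd]; rfl
      map_smul' := fun t u => by rw [hsmul]; rfl }
  have hD' : ∀ u m, D' u m = D u m := fun _ _ => rfl
  refine ⟨LinearMap.mul ℂ _ ∘ₗ X ∘ₗ (LinearMap.id - Q) + D', ?_, ?_⟩
  · intro x y
    refine LinearMap.ext fun m => ?_
    have h4 : B x y = B (Q x) (y - Q y) - B (Q y) (x - Q x) := by
      have e1 := hQ' x y
      have e2 := hQ x y
      rw [hB (x - Q x)]
      simp only [map_sub, LinearMap.sub_apply] at e1 e2 ⊢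
      linear_combination e1 + e2
    simp only [LinearMap.add_apply, LinearMap.comp_apply, LinearMap.sub_apply, LinearMap.id_apply,
      LinearMap.smul_apply, Module.End.mul_apply, LinearMap.mul_apply', mul_add, hD',
      Module.algebraMap_end_apply, h4, Derivation.leibniz, hDX, hcomm y x, smul_eq_mul,
      MvPolynomial.smul_eq_C_mul, map_sub, MvPolynomial.C_1]
    ring
  · intro x hx
    simp [hx, hD']

end FreeAlg

/-! ### The splitting of the modes into creation and annihilation parts -/

namespace PolarizedSpace

variable {s : ℂ} {V : Type*} [AddCommGroup V] [Module ℂ V] {ι : Type} [Fintype ι] [DecidableEq ι]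

/-- The projection of `⨁ V(n)` onto the span of the modes that annihilate the vacuum. -/
noncomputable def annihilatorPart (P : PolarizedSpace s V ι) : (ℤ →₀ V) →ₗ[ℂ] (ℤ →₀ V) :=
  Finsupp.lsum ℂ fun n : ℤ => if 0 < n then Finsupp.lsingle n else if n = 0 then
    Finsupp.lsingle 0 ∘ₗ P.pos.projection P.neg P.isCompl else 0

theorem annihilatorPart_single (P : PolarizedSpace s V ι) (n : ℤ) (v : V) :
    P.annihilatorPart (Finsupp.single n v) = if 0 < n then Finsupp.single n v else
      if n = 0 then Finsupp.single 0 (P.pos.projection P.neg P.isCompl v) else 0 := by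
  rw [annihilatorPart, Finsupp.lsum_single]
  split_ifs <;> simp

/-- Modes pair only if their degrees add to zero. Among nonnegative degrees this forces both to be
zero modes, and then both vectors lie in the isotropic space `P.pos`. The complement is isotropic by
the mirror argument with `P.neg`. -/
theorem hatForm_annihilatorPart (P : PolarizedSpace s V ι) (x y : ℤ →₀ V) :
    hatForm P.form 0 (P.annihilatorPart x) (P.annihilatorPart y) = 0 := by
  induction x using Finsupp.induction_linear with
  | zero => simp
  | add x x' h h' => simp only [map_add, LinearMap.add_apply, h, h', add_zero]
  | single m v =>
    induction y using Finsupp.induction_linear with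
    | zero => simp
    | add y y' h h' => simp only [map_add, h, h', add_zero]
    | single n w =>
      have h : ∀ z, P.pos.projection P.neg P.isCompl z ∈ P.pos := fun z => Subtype.coe_prop _
      rw [annihilatorPart_single, annihilatorPart_single]
      split_ifs <;> simp only [hatForm_single, map_zero, LinearMap.zero_apply] <;>
        first
        | rw [if_neg (by omega)]
        | rw [P.pos_isotropic _ (h _) _ (h _), ite_self]

theorem hatForm_sub_annihilatorPart (P : PolarizedSpace s V ι) (x y : ℤ →₀ V) :
    hatForm P.form 0 (x - P.annihilatorPart x) (y - P.annihilatorPart y) = 0 := by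
  induction x using Finsupp.induction_linear with
  | zero => simp
  | add x x' h h' =>
    rw [map_add, add_sub_add_comm, map_add, LinearMap.add_apply, h, h', add_zero]
  | single m v =>
    induction y using Finsupp.induction_linear with
    | zero => simp
    | add y y' h h' => rw [map_add, add_sub_add_comm, map_add, h, h', add_zero]
    | single n w =>
      have h : ∀ z, z - P.pos.projection P.neg P.isCompl z ∈ P.neg := fun z => by
        rw [← Submodule.projectionOnto_apply_eq_zero_iff P.isCompl, map_sub,
          Submodule.projectionOnto_projection, sub_self]
      have h' : ∀ (n : ℤ) (v : V), Finsupp.single n v - P.annihilatorPart (Finsupp.single n v) =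
          if 0 < n then 0 else if n = 0 then
            Finsupp.single 0 (v - P.pos.projection P.neg P.isCompl v) else Finsupp.single n v := by
        intro n v
        rw [annihilatorPart_single]
        split_ifs with h1 h2
        · rw [sub_self]
        · rw [h2, Finsupp.single_sub]
        · rw [sub_zero]
      rw [h', h']
      split_ifs <;> simp only [hatForm_single, map_zero, LinearMap.zero_apply] <;>
        first
        | rw [if_neg (by omega)]
        | rw [P.neg_isotropic _ (h _) _ (h _), ite_self]

theorem hatForm_swap (P : PolarizedSpace s V ι) (c : ℤ) (x y : ℤ →₀ V) :
    hatForm P.form c y x = -s * hatForm P.form c x y := by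
  induction x using Finsupp.induction_linear with
  | zero => simp
  | add x x' h h' => simp only [map_add, LinearMap.add_apply, h, h', mul_add]
  | single m v =>
    induction y using Finsupp.induction_linear with
    | zero => simp
    | add y y' h h' => simp only [map_add, LinearMap.add_apply, h, h', mul_add]
    | single n w => simp [hatForm_single, add_comm n m, P.form_swap v w]

/-- The universal property of the induced module: the elements of the mode algebra that kill `e`
form a left ideal containing the annihilators, hence containing `vacIdeal`. If the vacuum vanished,
`1` would kill `e`. -/
theorem vac_ne_zero_of_rep (P : PolarizedSpace s V ι) {M : Type*} [AddCommGroup M] [Module ℂ M]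
    (f : (ℤ →₀ V) →ₗ[ℂ] Module.End ℂ M)
    (hf : ∀ x y, f x * f y - s • (f y * f x) = algebraMap ℂ _ (hatForm P.form 0 x y))
    (e : M) (he : e ≠ 0) (h : ∀ x, P.annihilatorPart x = x → f x e = 0) : P.vac 0 ≠ 0 := by
  intro h0
  rw [vac, toFock_eq_zero] at h0
  have key : ∀ x ∈ P.vacIdeal 0, FreeAlg.lift f hf x e = 0 := by
    intro x hx
    induction hx using Submodule.span_induction with
    | mem x hx =>
      obtain ⟨v, n, rfl, hn⟩ := hx
      rw [gen, FreeAlg.lift_ι]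
      refine h _ ?_
      rw [annihilatorPart_single]
      rcases hn with hn | ⟨rfl, hn⟩
      · rw [if_pos hn]
      · simp [Submodule.projection_apply, Submodule.projectionOnto_apply_of_mem_left P.isCompl (hn rfl),
          -Submodule.coe_projectionOnto_apply]
    | zero => simp
    | add x y _ _ hx hy => rw [map_add, LinearMap.add_apply, hx, hy, add_zero]
    | smul a x _ hx => rw [smul_eq_mul, map_mul, Module.End.mul_apply, hx, map_zero]
  have := key 1 h0
  rw [map_one] at this
  exact he this

theorem vac_ne_zero (P : PolarizedSpace s V ι) (hs : s * s = 1) : P.vac 0 ≠ 0 := by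
  rcases mul_self_eq_one_iff.1 hs with rfl | rfl
  · obtain ⟨f, hf, h⟩ := FreeAlg.exists_fock_weyl (hatForm P.form 0)
      (fun x y => by rw [P.hatForm_swap, neg_mul, one_mul]) P.annihilatorPart
      P.hatForm_annihilatorPart P.hatForm_sub_annihilatorPart
    exact P.vac_ne_zero_of_rep f hf 1 one_ne_zero h
  · obtain ⟨f, hf, h⟩ := FreeAlg.exists_fock_clifford (hatForm P.form 0)
      (fun x y => by rw [P.hatForm_swap, neg_neg, one_mul]) P.annihilatorPart
      P.hatForm_annihilatorPart P.hatForm_sub_annihilatorPart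
    exact P.vac_ne_zero_of_rep f hf 1 one_ne_zero h

end PolarizedSpace

namespace PolarizedSpace

variable {s : ℂ} {V : Type*} [AddCommGroup V] [Module ℂ V] {ι : Type} [Fintype ι] [DecidableEq ι]

/-! ### Dual frames -/

/-- A pair of dual bases of the two summands of the polarization. -/
structure Frame (P : PolarizedSpace s V ι) where
  /-- the basis of `P.pos` -/
  pos : ι → V
  /-- the dual basis of `P.neg` -/
  neg : ι → V
  pos_mem : ∀ i, pos i ∈ P.pos
  neg_mem : ∀ i, neg i ∈ P.neg
  dual : ∀ i j, P.form (neg i) (pos j) = if i = j then 1 else 0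
  expand : ∀ v, v = ∑ i, P.form (neg i) v • pos i + ∑ i, P.form v (pos i) • neg i

theorem sum_form_bneg_smul (P : PolarizedSpace s V ι) {x : V} (hx : x ∈ P.pos) :
    ∑ i, P.form (P.bneg i) x • (P.bpos i : V) = x := by
  have e : x = ∑ j, P.bpos.repr ⟨x, hx⟩ j • (P.bpos j : V) := by
    have h := congrArg P.pos.subtype (P.bpos.sum_repr ⟨x, hx⟩)
    simp only [map_sum, map_smul, Submodule.subtype_apply] at h
    exact h.symm
  conv_rhs => rw [e]
  refine Finset.sum_congr rfl fun i _ => ?_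
  congr 1
  conv_lhs => rw [e]
  simp [P.dual]

theorem sum_form_smul_bneg (P : PolarizedSpace s V ι) {y : V} (hy : y ∈ P.neg) :
    ∑ i, P.form y (P.bpos i) • (P.bneg i : V) = y := by
  have e : y = ∑ j, P.bneg.repr ⟨y, hy⟩ j • (P.bneg j : V) := by
    have h := congrArg P.neg.subtype (P.bneg.sum_repr ⟨y, hy⟩)
    simp only [map_sum, map_smul, Submodule.subtype_apply] at h
    exact h.symm
  conv_rhs => rw [e]
  refine Finset.sum_congr rfl fun i _ => ?_
  congr 1
  conv_lhs => rw [e]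
  simp [P.dual]

/-- Every basis of `P.pos` is part of a frame. -/
noncomputable def frame (P : PolarizedSpace s V ι) (b : Module.Basis ι ℂ P.pos) : P.Frame where
  pos i := b i
  -- A change of basis in `P.pos` acts on the dual basis by the inverse transpose; the matrix used
  -- here expresses the old basis in the new one.
  neg i := ∑ j, b.repr (P.bpos j) i • (P.bneg j : V)
  pos_mem i := (b i).2
  neg_mem i := Submodule.sum_mem _ fun j _ => Submodule.smul_mem _ _ (P.bneg j).2
  dual i j := by
    have h : b j = ∑ k, P.form (P.bneg k) (b j) • P.bpos k := by
      ext
      simpa using (P.sum_form_bneg_smul (b j).2).symm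
    have h' := congrArg (fun x => b.repr x i) h
    simp only [map_sum, map_smul, Finsupp.coe_finsetSum, Finset.sum_apply, Finsupp.smul_apply,
      smul_eq_mul, Module.Basis.repr_self, Finsupp.single_apply] at h'
    simp only [map_sum, map_smul, LinearMap.sum_apply, LinearMap.smul_apply, smul_eq_mul]
    rw [show (if i = j then (1 : ℂ) else 0) = if j = i then 1 else 0 by simp [eq_comm], h']
    exact Finset.sum_congr rfl fun k _ => mul_comm _ _
  expand v := by
    have hb : ∀ k, (P.bpos k : V) = ∑ i, b.repr (P.bpos k) i • (b i : V) := fun k => by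
      have h := congrArg P.pos.subtype (b.sum_repr (P.bpos k))
      simp only [map_sum, map_smul, Submodule.subtype_apply] at h
      exact h.symm
    have hb' : ∀ k, (b k : V) = ∑ i, P.bpos.repr (b k) i • (P.bpos i : V) := fun k => by
      have h := congrArg P.pos.subtype (P.bpos.sum_repr (b k))
      simp only [map_sum, map_smul, Submodule.subtype_apply] at h
      exact h.symm
    obtain ⟨x, hx, y, hy, rfl⟩ := Submodule.mem_sup.1
      (P.isCompl.sup_eq_top ▸ Submodule.mem_top : v ∈ P.pos ⊔ P.neg)
    have h1 : ∀ i, P.form (P.bneg i) y = 0 := fun i => P.neg_isotropic _ (P.bneg i).2 _ hy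
    have h2 : ∀ i, P.form x (b i) = 0 := fun i => P.pos_isotropic _ hx _ (b i).2
    congr 1
    · conv_lhs => rw [← P.sum_form_bneg_smul hx]
      simp only [map_add, h1, map_sum, map_smul, LinearMap.sum_apply, LinearMap.smul_apply,
        smul_eq_mul, mul_zero, Finset.sum_const_zero, add_zero, Finset.sum_smul]
      rw [Finset.sum_comm]
      refine Finset.sum_congr rfl fun k _ => ?_
      conv_lhs => rw [hb k, Finset.smul_sum]
      exact Finset.sum_congr rfl fun i _ => by rw [smul_smul, mul_comm]
    · conv_lhs => rw [← P.sum_form_smul_bneg hy]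
      simp only [map_add, LinearMap.add_apply, h2, zero_add, Finset.smul_sum]
      rw [Finset.sum_comm]
      refine Finset.sum_congr rfl fun k _ => ?_
      conv_lhs => rw [hb k]
      simp only [map_sum, map_smul, Finset.sum_smul, smul_smul, smul_eq_mul]
      exact Finset.sum_congr rfl fun i _ => by rw [mul_comm]

/-- The index set of the creation operators: `inl (i, n)` stands for `a_i^+(-n-1)` and `inr (i, n)`
for `a_i^-(-n)`. -/
abbrev Creators (ι : Type) : Type := (ι × ℕ) ⊕ (ι × ℕ)

/-! ### Creation and annihilation operators, and the monomials in them -/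

namespace Frame

variable {P : PolarizedSpace s V ι} (F : P.Frame)

/-- The vector of a creation operator. -/
def vec : Creators ι → V
  | .inl p => F.pos p.1
  | .inr p => F.neg p.1

/-- The dual vector of a creation operator. -/
def dualVec : Creators ι → V
  | .inl p => F.neg p.1
  | .inr p => -s • F.pos p.1

/-- The eigenvalue of `L(0)` added by a creation operator. -/
def _root_.UmbralFour.PolarizedSpace.level : Creators ι → ℕ
  | .inl p => p.2 + 1
  | .inr p => p.2

/-- The creation operators. -/
noncomputable def create (x : Creators ι) : Module.End ℂ (P.Fock 0) :=
  P.mode 0 (F.vec x) (-(level x : ℤ))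

/-- The annihilation operators. -/
noncomputable def annih (x : Creators ι) : Module.End ℂ (P.Fock 0) :=
  P.mode 0 (F.dualVec x) (level x)

theorem form_pos_neg (i j : ι) : P.form (F.pos i) (F.neg j) = if i = j then -s else 0 := by
  rw [P.form_swap (F.neg j), F.dual]
  by_cases h : i = j
  · simp [h]
  · simp [h, Ne.symm h]

/-- The canonical (anti)commutation relations. Since `⟨a⁺, a⁻⟩ = -s`, the factor `-s` in `dualVec`
normalizes the pairing to `(-s)² = 1`, so that all oscillators look alike regardless of type. -/
theorem annih_create (hs : s * s = 1) (x y : Creators ι) (w : P.Fock 0) :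
    F.annih x (F.create y w) = s • F.create y (F.annih x w) + (if x = y then (1 : ℂ) else 0) • w := by
  rw [annih, create, mode_mode]
  congr 2
  rcases x with ⟨i, m⟩ | ⟨i, m⟩ <;> rcases y with ⟨j, n⟩ | ⟨j, n⟩ <;>
    simp only [level, vec, dualVec, Sum.inl.injEq, Sum.inr.injEq, Prod.mk.injEq, reduceCtorEq,
      if_false]
  · rw [F.dual]
    by_cases h : i = j <;> by_cases h' : m = n <;> simp [h, h']
    omega
  · simp [P.neg_isotropic _ (F.neg_mem i) _ (F.neg_mem j)]
  · simp [P.pos_isotropic _ (F.pos_mem i) _ (F.pos_mem j)]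
  · rw [map_smul, LinearMap.smul_apply, F.form_pos_neg]
    by_cases h : i = j <;> by_cases h' : m = n <;> simp [h, h', hs]
    omega

/-- Levels are nonnegative, so two creators could pair only if both are zero modes; these are both
of negative type, and `P.neg` is isotropic. -/
theorem create_create (x y : Creators ι) (w : P.Fock 0) :
    F.create x (F.create y w) = s • F.create y (F.create x w) := by
  rw [create, create, mode_mode, add_eq_left]
  convert zero_smul ℂ w
  rw [ite_eq_right_iff]
  intro h
  rcases x with ⟨i, m⟩ | ⟨i, m⟩ <;> rcases y with ⟨j, n⟩ | ⟨j, n⟩ <;> simp only [level] at h <;>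
    try omega
  exact P.neg_isotropic _ (F.neg_mem i) _ (F.neg_mem j)

theorem annih_vac (x : Creators ι) : F.annih x (P.vac 0) = 0 := by
  rcases x with ⟨i, m⟩ | ⟨i, m⟩
  · exact P.mode_vac_of_pos _ _ _ (by simp only [level]; omega)
  · rcases m.eq_zero_or_pos with rfl | h
    · exact P.mode_zero_vac _ _ fun _ => Submodule.smul_mem _ _ (F.pos_mem i)
    · exact P.mode_vac_of_pos _ _ _ (by simp only [level]; omega)

/-- The vector obtained by applying a list of creation operators to the vacuum. -/
noncomputable def word (l : List (Creators ι)) : P.Fock 0 :=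
  l.foldr (fun x w => F.create x w) (P.vac 0)

theorem word_nil : F.word [] = P.vac 0 := rfl

theorem word_cons (x : Creators ι) (l : List (Creators ι)) :
    F.word (x :: l) = F.create x (F.word l) := rfl

/-- The number operator: passing it across another creator costs `s · s = 1`, and each occurrence of
`x` adds one. The formula is the same for both statistics; for fermions it is vacuous on words with
repetitions, which are zero. -/
theorem create_annih_word (hs : s * s = 1) (x : Creators ι) (l : List (Creators ι)) :
    F.create x (F.annih x (F.word l)) = (Multiset.count x (l : Multiset (Creators ι)) : ℂ) • F.word l := by
  induction l with
  | nil => simp [word_nil, annih_vac]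
  | cons y l ih =>
    rw [word_cons, annih_create _ hs, map_add, map_smul, create_create, ih, smul_smul, hs, one_smul,
      map_smul, map_smul, ← Multiset.cons_coe, Multiset.count_cons]
    by_cases h : x = y
    · subst h
      simp only [if_true]
      push_cast
      module
    · simp [h]

theorem annih_word_cons (hs : s * s = 1) (x : Creators ι) (l : List (Creators ι)) :
    F.annih x (F.word (x :: l)) = (s * Multiset.count x (l : Multiset (Creators ι)) + 1) • F.word l := by
  rw [word_cons, annih_create _ hs, create_annih_word _ hs, if_pos rfl]
  module

/-- Annihilating the first letter returns the shorter word up to the factor `s · count + 1`. This is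
a positive integer for bosons, and `1` for fermions without repetition, so nonvanishing descends
from the vacuum. -/
theorem word_ne_zero (hs : s * s = 1) {l : List (Creators ι)} (h : s = 1 ∨ l.Nodup) :
    F.word l ≠ 0 := by
  induction l with
  | nil => exact P.vac_ne_zero hs
  | cons x l ih =>
    intro h0
    have h1 := F.annih_word_cons hs x l
    rw [h0, map_zero, eq_comm, smul_eq_zero] at h1
    rcases h1 with h1 | h1
    · rcases h with rfl | h
      · rw [one_mul] at h1
        norm_cast at h1
      · simp [Multiset.count_eq_zero_of_notMem (show x ∉ (l : Multiset _) from (List.nodup_cons.1 h).1)]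
          at h1
    · exact ih (h.imp_right fun h => (List.nodup_cons.1 h).2) h1

theorem word_perm {l l' : List (Creators ι)} (h : l.Perm l') :
    ∃ ε : ℂ, F.word l = ε • F.word l' := by
  induction h with
  | nil => exact ⟨1, (one_smul _ _).symm⟩
  | cons x _ ih =>
    obtain ⟨ε, h⟩ := ih
    exact ⟨ε, by rw [word_cons, word_cons, h, map_smul]⟩
  | swap x y l => exact ⟨s, by simp only [word_cons]; rw [create_create]⟩
  | trans _ _ h h' =>
    obtain ⟨ε, h⟩ := h
    obtain ⟨ε', h'⟩ := h'
    exact ⟨ε * ε', by rw [h, h', smul_smul]⟩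

/-- Up to a scalar the repeated letters can be moved to the front, and a fermionic creator squares
to zero because it anticommutes with itself. -/
theorem word_eq_zero (hs : s = -1) {l : List (Creators ι)} (h : ¬ l.Nodup) : F.word l = 0 := by
  subst hs
  obtain ⟨x, h⟩ := List.exists_duplicate_iff_not_nodup.2 h
  rw [List.duplicate_iff_sublist] at h
  obtain ⟨l', h⟩ := h.exists_perm_append
  obtain ⟨ε, h⟩ := F.word_perm h
  rw [h]
  have : F.create x (F.create x (F.word l')) = 0 := by
    have h2 := F.create_create x x (F.word l')
    rw [neg_one_smul, eq_neg_iff_add_eq_zero, ← two_smul ℂ, smul_eq_zero] at h2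
    exact h2.resolve_left two_ne_zero
  simp [word_cons, this]

theorem annih_word_mem (hs : s * s = 1) (x : Creators ι) (l : List (Creators ι)) :
    F.annih x (F.word l) ∈ Submodule.span ℂ (Set.range F.word) := by
  induction l with
  | nil => rw [word_nil, annih_vac]; exact Submodule.zero_mem _
  | cons y l ih =>
    rw [word_cons, annih_create _ hs]
    refine Submodule.add_mem _ (Submodule.smul_mem _ _ ?_)
      (Submodule.smul_mem _ _ (Submodule.subset_span ⟨l, rfl⟩))
    have : Submodule.span ℂ (Set.range F.word) ≤
        (Submodule.span ℂ (Set.range F.word)).comap (F.create y) := by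
      rw [Submodule.span_le]
      rintro _ ⟨l, rfl⟩
      exact Submodule.subset_span ⟨y :: l, rfl⟩
    exact this ih

/-- Expanding `v` in the frame makes every mode a combination of creators and annihilators. Creators
lengthen words, and annihilators are moved through to the vacuum. Hence the span of the words is a
submodule containing the vacuum. -/
theorem mode_word_mem (hs : s * s = 1) (v : V) (n : ℤ) (l : List (Creators ι)) :
    P.mode 0 v n (F.word l) ∈ Submodule.span ℂ (Set.range F.word) := by
  have hpos : ∀ i, P.mode 0 (F.pos i) n (F.word l) ∈ Submodule.span ℂ (Set.range F.word) := by
    intro i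
    rcases lt_or_ge n 0 with h | h
    -- `inl (i, m)` encodes the mode `-(m + 1)`, since `a_i^+(0)` is not a creator; `inr (i, m)`
    -- below encodes the mode `-m`.
    · refine Submodule.subset_span ⟨.inl (i, (-n - 1).toNat) :: l, ?_⟩
      rw [word_cons, create, vec, level]
      congr 2
      simp only
      omega
    · have := F.annih_word_mem hs (.inr (i, n.toNat)) l
      simp only [annih, dualVec, level, Int.toNat_of_nonneg h, ← modeHom_apply, map_smul,
        LinearMap.smul_apply] at this
      have h2 := Submodule.smul_mem _ (-s) this
      rwa [smul_smul, neg_mul_neg, hs, one_smul] at h2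
  have hneg : ∀ i, P.mode 0 (F.neg i) n (F.word l) ∈ Submodule.span ℂ (Set.range F.word) := by
    intro i
    rcases le_or_gt n 0 with h | h
    · refine Submodule.subset_span ⟨.inr (i, (-n).toNat) :: l, ?_⟩
      rw [word_cons, create, vec, level]
      congr 2
      simp only
      omega
    · have := F.annih_word_mem hs (.inl (i, (n - 1).toNat)) l
      simp only [annih, dualVec, level] at this
      rwa [show (((n - 1).toNat + 1 : ℕ) : ℤ) = n by omega] at this
  rw [F.expand v, ← modeHom_apply]
  simp only [map_add, map_sum, map_smul, LinearMap.add_apply, LinearMap.sum_apply,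
    LinearMap.smul_apply, modeHom_apply]
  exact Submodule.add_mem _ (Submodule.sum_mem _ fun i _ => Submodule.smul_mem _ _ (hpos i))
    (Submodule.sum_mem _ fun i _ => Submodule.smul_mem _ _ (hneg i))

theorem span_word (hs : s * s = 1) : Submodule.span ℂ (Set.range F.word) = ⊤ := by
  rw [eq_top_iff]
  rintro x -
  have key : ∀ (t : TensorAlgebra ℂ (ℤ →₀ V)) (x : P.Fock 0),
      x ∈ Submodule.span ℂ (Set.range F.word) →
      (RingQuot.mkAlgHom ℂ (FreeRel s (hatForm P.form 0)) t • x : P.Fock 0) ∈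
        Submodule.span ℂ (Set.range F.word) := by
    intro t
    induction t using TensorAlgebra.induction with
    | algebraMap r =>
      intro x hx
      rw [AlgHom.commutes, algebraMap_smul]
      exact Submodule.smul_mem _ _ hx
    | ι u =>
      intro x hx
      induction u using Finsupp.induction_linear with
      | zero => simp
      | add a b ha hb => rw [map_add, map_add, add_smul]; exact Submodule.add_mem _ ha hb
      | single m v =>
        have : Submodule.span ℂ (Set.range F.word) ≤
            (Submodule.span ℂ (Set.range F.word)).comap (P.mode 0 v m) := by
          rw [Submodule.span_le]
          rintro _ ⟨l, rfl⟩
          exact F.mode_word_mem hs v m l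
        exact this hx
    | mul a b ha hb => intro x hx; rw [map_mul, mul_smul]; exact ha _ (hb x hx)
    | add a b ha hb => intro x hx; rw [map_add, add_smul]; exact Submodule.add_mem _ (ha x hx) (hb x hx)
  obtain ⟨a, rfl⟩ := P.toFock_surjective 0 x
  obtain ⟨t, rfl⟩ := RingQuot.mkAlgHom_surjective ℂ (FreeRel s (hatForm P.form 0)) a
  have := key t (P.vac 0) (Submodule.subset_span ⟨[], rfl⟩)
  rwa [vac, ← map_smul, smul_eq_mul, mul_one] at this

end Frame

end PolarizedSpace

/-- Nonzero joint eigenvectors with pairwise distinct systems of eigenvalues are linearly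
independent. -/
theorem linearIndependent_of_joint_eigenvectors {K M I X : Type*} [Field K] [AddCommGroup M]
    [Module K M] (e : I → M) (T : X → Module.End K M) (χ : X → I → K)
    (hT : ∀ x i, T x (e i) = χ x i • e i) (he : ∀ i, e i ≠ 0)
    (hχ : ∀ i j, (∀ x, χ x i = χ x j) → i = j) : LinearIndependent K e := by
  classical
  rw [linearIndependent_iff']
  intro S
  induction S using Finset.strongInduction with
  | H S ih =>
    intro a ha i hi
    by_cases h : ∃ j ∈ S, j ≠ i
    · obtain ⟨j, hj, hji⟩ := h
      obtain ⟨x, hx⟩ : ∃ x, χ x i ≠ χ x j := by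
        by_contra! hcon
        exact hji (hχ i j hcon).symm
      -- Applying `T x - χ x j` removes `e j` from the relation and multiplies the coefficient of `e
      -- i` by a nonzero number.
      have h1 : ∑ k ∈ S.erase j, (a k * (χ x k - χ x j)) • e k = 0 := by
        have h2 := congrArg (T x - χ x j • (1 : Module.End K M)) ha
        simp only [map_sum, map_smul, LinearMap.sub_apply, hT, LinearMap.smul_apply,
          Module.End.one_apply, map_zero] at h2
        rw [← Finset.add_sum_erase S _ hj, sub_self, smul_zero, zero_add] at h2
        rw [← h2]
        exact Finset.sum_congr rfl fun k _ => by module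
      have h2 := ih _ (Finset.erase_ssubset hj) _ h1 i (Finset.mem_erase.2 ⟨hji.symm, hi⟩)
      exact (mul_eq_zero.1 h2).resolve_right (sub_ne_zero.2 hx)
    · push Not at h
      rw [Finset.sum_eq_single_of_mem i hi fun j hj hji => absurd (h j hj) hji] at ha
      exact (smul_eq_zero.1 ha).resolve_right (he i)

/-! ### The occupation number basis -/

namespace PolarizedSpace

variable {s : ℂ} {V : Type*} [AddCommGroup V] [Module ℂ V] {ι : Type} [Fintype ι] [DecidableEq ι]

namespace Frame

variable {P : PolarizedSpace s V ι} (F : P.Frame)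

/-- The vector of the Fock space with given occupation numbers. -/
noncomputable def state (m : Multiset (Creators ι)) : P.Fock 0 := F.word m.toList

/-- The occupation numbers are thus joint eigenvalues that distinguish all states, which is the
source of linear independence in `basis`. -/
theorem create_annih_state (hs : s * s = 1) (x : Creators ι) (m : Multiset (Creators ι)) :
    F.create x (F.annih x (F.state m)) = (m.count x : ℂ) • F.state m := by
  rw [state, create_annih_word _ hs, Multiset.coe_toList]

/-- The basis of the Fock space consisting of the products of creation operators. -/
noncomputable def basis (hs : s * s = 1) {I : Type*} (e : I → Multiset (Creators ι))
    (he : Function.Injective e) (he' : ∀ m, (∃ i, e i = m) ↔ s = 1 ∨ m.Nodup) :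
    Module.Basis I ℂ (P.Fock 0) :=
  Module.Basis.mk (v := fun i => F.state (e i))
    (linearIndependent_of_joint_eigenvectors _ (fun x => F.create x * F.annih x)
      (fun x i => ((e i).count x : ℂ)) (fun x i => F.create_annih_state hs x _)
      (fun i => F.word_ne_zero hs (((he' _).1 ⟨i, rfl⟩).imp_right fun h => by
        rwa [← Multiset.coe_nodup, Multiset.coe_toList]))
      (fun i j h => he (Multiset.ext.2 fun x => by exact_mod_cast h x)))
    (by
      rw [← F.span_word hs, Submodule.span_le]
      rintro _ ⟨l, rfl⟩
      by_cases h : s = 1 ∨ (l : Multiset (Creators ι)).Nodup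
      · obtain ⟨i, hi⟩ := (he' _).2 h
        obtain ⟨ε, h⟩ := F.word_perm (l := l) (l' := (e i).toList)
          (Multiset.coe_eq_coe.1 (by rw [Multiset.coe_toList, hi]))
        rw [SetLike.mem_coe, h]
        exact Submodule.smul_mem _ _ (Submodule.subset_span ⟨i, rfl⟩)
      · push Not at h
        rw [SetLike.mem_coe, F.word_eq_zero ((mul_self_eq_one_iff.1 hs).resolve_left h.1) h.2]
        exact Submodule.zero_mem _)

theorem basis_apply (hs : s * s = 1) {I : Type*} (e : I → Multiset (Creators ι))
    (he : Function.Injective e) (he' : ∀ m, (∃ i, e i = m) ↔ s = 1 ∨ m.Nodup) (i : I) :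
    F.basis hs e he he' i = F.state (e i) := by
  simp [basis]

end Frame

/-! ### The operators `J(0)`, `L(0)` and `GL(pos)` on products of creation operators -/

/-- Only the summand of mode number `k` sees `v(-k)`. Its annihilating half contracts with `v`, its
creating half is of negative degree and does not, and moving past both costs `s · s = 1`. The
hypotheses on `α` and `γ` say how the contraction returns `v`. -/
theorem modeSum_mode (P : PolarizedSpace s V ι) (hs : s * s = 1) (p : ℕ) (t α γ : ℂ) (v : V)
    (hα : ∑ i, P.form (P.bneg i) v • (P.bpos i : V) = α • v)
    (hγ : ∑ i, P.form (P.bpos i) v • (P.bneg i : V) = γ • v) (k : ℕ) (w : P.Fock 0) :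
    P.modeSum p t (P.mode 0 v (-(k : ℤ)) w) = P.mode 0 v (-(k : ℤ)) (P.modeSum p t w) +
      (if k = 0 then 0 else (k : ℂ) ^ p * (α + t * γ)) • P.mode 0 v (-(k : ℤ)) w := by
  obtain ⟨N₁, h₁⟩ := P.exists_nat_mode_eq_zero w
  obtain ⟨N₂, h₂⟩ := P.exists_nat_mode_eq_zero (P.mode 0 v (-(k : ℤ)) w)
  set N := max (max N₁ N₂) k with hN
  rw [P.modeSum_apply p t _ N fun n hn => h₂ n (by omega),
    P.modeSum_apply p t _ N fun n hn => h₁ n (by omega)]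
  have key : ∀ (x y : V) (n : ℕ), P.mode 0 x (-(n + 1)) (P.mode 0 y (n + 1) (P.mode 0 v (-k) w)) =
      P.mode 0 v (-k) (P.mode 0 x (-(n + 1)) (P.mode 0 y (n + 1) w)) +
        (if n + 1 = k then (1 : ℂ) else 0) • P.form y v • P.mode 0 x (-k) w := by
    intro x y n
    rw [P.mode_mode 0 y v, map_add, map_smul, map_smul, P.mode_mode 0 x v,
      if_neg (show ¬ (-((n : ℤ) + 1) + -k = 0) by omega), zero_smul, add_zero, smul_smul, hs,
      one_smul]
    congr 1
    by_cases h : n + 1 = k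
    · subst h
      simp
    · rw [if_neg (by omega), if_neg h, zero_smul, zero_smul]
  have key2 : ∀ n : ℕ, ∑ i,
      (P.mode 0 (P.bpos i) (-(n + 1)) (P.mode 0 (P.bneg i) (n + 1) (P.mode 0 v (-k) w)) + t •
        P.mode 0 (P.bneg i) (-(n + 1)) (P.mode 0 (P.bpos i) (n + 1) (P.mode 0 v (-k) w))) =
      P.mode 0 v (-k) (∑ i, (P.mode 0 (P.bpos i) (-(n + 1)) (P.mode 0 (P.bneg i) (n + 1) w) + t •
        P.mode 0 (P.bneg i) (-(n + 1)) (P.mode 0 (P.bpos i) (n + 1) w))) +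
      (if n + 1 = k then (α + t * γ) else 0) • P.mode 0 v (-k) w := by
    intro n
    have e1 : ∑ i, P.form (P.bneg i) v • P.mode 0 (P.bpos i) (-k) w = α • P.mode 0 v (-k) w := by
      have h := congrArg (fun u => P.modeHom 0 (-k) u w) hα
      simpa only [map_sum, map_smul, LinearMap.sum_apply, LinearMap.smul_apply, modeHom_apply]
        using h
    have e2 : ∑ i, P.form (P.bpos i) v • P.mode 0 (P.bneg i) (-k) w = γ • P.mode 0 v (-k) w := by
      have h := congrArg (fun u => P.modeHom 0 (-k) u w) hγ
      simpa only [map_sum, map_smul, LinearMap.sum_apply, LinearMap.smul_apply, modeHom_apply]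
        using h
    simp only [key, map_sum, map_add, map_smul, smul_add, Finset.sum_add_distrib,
      ← Finset.smul_sum, e1, e2]
    split_ifs <;> module
  simp only [key2, smul_add (_ ^ p)]
  rw [Finset.sum_add_distrib, map_sum]
  simp only [map_smul (P.mode 0 v (-(k : ℤ)))]
  congr 1
  rcases k with _ | k
  · simp
  · rw [Finset.sum_eq_single_of_mem k (Finset.mem_range.2 (by omega))]
    · rw [if_pos rfl, if_neg (by omega), smul_smul]
      push_cast
      rfl
    · intro n _ hn
      rw [if_neg (by omega), zero_smul, smul_zero]

/-- For `k > 0` the shift comes from `modeSum`, for `k = 0` from the zero modes. There both factors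
of each product contract, and the prefactor `1/2` compensates for the two orderings, so the two
cases agree. -/
theorem zeroJ_mode (P : PolarizedSpace s V ι) (hs : s * s = 1) (α γ : ℂ) (v : V)
    (hα : ∑ i, P.form (P.bneg i) v • (P.bpos i : V) = α • v)
    (hγ : ∑ i, P.form (P.bpos i) v • (P.bneg i : V) = γ • v) (k : ℕ) (w : P.Fock 0) :
    P.zeroJ (P.mode 0 v (-(k : ℤ)) w) = P.mode 0 v (-(k : ℤ)) (P.zeroJ w) +
      (α + s * γ) • P.mode 0 v (-(k : ℤ)) w := by
  have key : ∀ (x y : V), P.mode 0 x 0 (P.mode 0 y 0 (P.mode 0 v (-k) w)) =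
      P.mode 0 v (-k) (P.mode 0 x 0 (P.mode 0 y 0 w)) + (if k = 0 then (1 : ℂ) else 0) •
        (P.form y v • P.mode 0 x (-k) w + s • P.form x v • P.mode 0 y (-k) w) := by
    intro x y
    rw [P.mode_mode 0 y v, map_add, map_smul, map_smul, P.mode_mode 0 x v, smul_add, smul_smul, hs,
      one_smul, zero_add]
    by_cases h : k = 0
    · subst h
      simp only [Nat.cast_zero, neg_zero, if_true, one_smul]
      module
    · simp [h]
  have e1 : ∑ i, P.form (P.bneg i) v • P.mode 0 (P.bpos i) (-k) w = α • P.mode 0 v (-k) w := by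
    have h := congrArg (fun u => P.modeHom 0 (-k) u w) hα
    simpa only [map_sum, map_smul, LinearMap.sum_apply, LinearMap.smul_apply, modeHom_apply]
      using h
  have e2 : ∑ i, P.form (P.bpos i) v • P.mode 0 (P.bneg i) (-k) w = γ • P.mode 0 v (-k) w := by
    have h := congrArg (fun u => P.modeHom 0 (-k) u w) hγ
    simpa only [map_sum, map_smul, LinearMap.sum_apply, LinearMap.smul_apply, modeHom_apply]
      using h
  simp only [zeroJ, LinearMap.add_apply, LinearMap.smul_apply, LinearMap.sum_apply,
    Module.End.mul_apply, P.modeSum_mode hs 0 s α γ v hα hγ, key, map_sum, map_add, map_smul,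
    smul_add, Finset.sum_add_distrib, ← Finset.smul_sum, e1, e2]
  rcases mul_self_eq_one_iff.1 hs with rfl | rfl <;> split_ifs <;>
    (try simp only [pow_zero, one_mul]) <;> module

theorem modeSum_vac (P : PolarizedSpace s V ι) (p : ℕ) (t : ℂ) : P.modeSum p t (P.vac 0) = 0 := by
  rw [P.modeSum_apply p t _ 1 fun n hn v => P.mode_vac_of_pos _ _ _ (by omega)]
  simp [P.mode_vac_of_pos 0 _ 1]

/-- `a⁺(0)` kills the vacuum, so only `a⁺(0) a⁻(0)` contributes, with the contraction `-s`. The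
resulting charges are `1/2`, `3/2` and `-2` for the three factors of the twisted module. -/
theorem zeroJ_vac (P : PolarizedSpace s V ι) :
    P.zeroJ (P.vac 0) = (-s * Fintype.card ι / 2) • P.vac 0 := by
  have h1 : ∀ i, P.mode 0 (P.bpos i) 0 (P.vac 0) = 0 := fun i =>
    P.mode_zero_vac _ _ fun _ => (P.bpos i).2
  have h2 : ∀ i, P.mode 0 (P.bpos i) 0 (P.mode 0 (P.bneg i) 0 (P.vac 0)) = -s • P.vac 0 := by
    intro i
    rw [mode_mode, h1, form_pos_neg]
    simp
  simp only [zeroJ, LinearMap.add_apply, LinearMap.smul_apply, LinearMap.sum_apply,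
    Module.End.mul_apply, modeSum_vac, h1, h2, map_zero, smul_zero, add_zero, Finset.sum_const,
    Finset.card_univ]
  module

/-- The charge, that is, the eigenvalue of `J(0)`, of a creation operator. -/
def charge : Creators ι → ℤ
  | .inl _ => 1
  | .inr _ => -1

namespace Frame

variable {P : PolarizedSpace s V ι} (F : P.Frame)

/-- Here `(α, γ)` is `(1, 0)` on the positive and `(0, -s)` on the negative summand. The combination
`α + sγ` enters `J(0)` and distinguishes the two; `α - sγ` enters `L(0)` and does not. -/
theorem vec_components (x : Creators ι) : ∃ α γ : ℂ,
    (∑ i, P.form (P.bneg i) (F.vec x) • (P.bpos i : V) = α • F.vec x) ∧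
    (∑ i, P.form (P.bpos i) (F.vec x) • (P.bneg i : V) = γ • F.vec x) ∧
    (s * s = 1 → α + s * γ = charge x ∧ α - s * γ = 1) := by
  rcases x with ⟨i, n⟩ | ⟨i, n⟩ <;> simp only [vec, charge]
  · refine ⟨1, 0, by rw [one_smul]; exact P.sum_form_bneg_smul (F.pos_mem i), ?_, by simp⟩
    rw [zero_smul]
    exact Finset.sum_eq_zero fun j _ => by
      rw [P.pos_isotropic _ (P.bpos j).2 _ (F.pos_mem i), zero_smul]
  · refine ⟨0, -s, ?_, ?_, fun hs => ⟨by push_cast; linear_combination -hs, by linear_combination hs⟩⟩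
    · rw [zero_smul]
      exact Finset.sum_eq_zero fun j _ => by
        rw [P.neg_isotropic _ (P.bneg j).2 _ (F.neg_mem i), zero_smul]
    · conv_rhs => rw [← P.sum_form_smul_bneg (F.neg_mem i), Finset.smul_sum]
      refine Finset.sum_congr rfl fun j _ => ?_
      rw [P.form_swap (F.neg i), smul_smul]

theorem zeroJ_word (hs : s * s = 1) (l : List (Creators ι)) :
    P.zeroJ (F.word l) = (-s * Fintype.card ι / 2 + ((l.map charge).sum : ℤ)) • F.word l := by
  induction l with
  | nil => simp [word_nil, zeroJ_vac]
  | cons x l ih =>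
    obtain ⟨α, γ, hα, hγ, h⟩ := F.vec_components x
    rw [word_cons, create, P.zeroJ_mode hs α γ _ hα hγ, ih, (h hs).1, map_smul, List.map_cons,
      List.sum_cons]
    push_cast
    module

theorem zeroL_word (hs : s * s = 1) (l : List (Creators ι)) :
    P.zeroL (F.word l) = (-s * Fintype.card ι / 8 + ((l.map level).sum : ℕ)) • F.word l := by
  have : P.modeSum 1 (-s) (F.word l) = ((l.map level).sum : ℂ) • F.word l := by
    induction l with
    | nil => simp [word_nil, modeSum_vac]
    | cons x l ih =>
      obtain ⟨α, γ, hα, hγ, h⟩ := F.vec_components x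
      rw [word_cons, create, P.modeSum_mode hs 1 (-s) α γ _ hα hγ, ih, neg_mul, ← sub_eq_add_neg,
        (h hs).2, map_smul, List.map_cons, List.sum_cons]
      push_cast
      split_ifs with h0
      · rw [h0]; module
      · module
  rw [zeroL, LinearMap.sub_apply, this, LinearMap.smul_apply, Module.End.one_apply]
  module

theorem extend_pos (g : LinearMap.GeneralLinearGroup ℂ P.pos) (a : ι → ℂ)
    (h : ∀ i, ((g : Module.End ℂ P.pos) ⟨F.pos i, F.pos_mem i⟩ : V) = a i • F.pos i) (i : ι) :
    P.extend g (F.pos i) = a i • F.pos i := by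
  rw [← h i]
  exact P.extend_of_pos g ⟨F.pos i, F.pos_mem i⟩

/-- Invariance of the form forces the dual vector of an eigenvector to scale by the inverse
eigenvalue. -/
theorem extend_neg (g : LinearMap.GeneralLinearGroup ℂ P.pos) (a : ι → ℂ) (ha : ∀ i, a i ≠ 0)
    (h : ∀ i, ((g : Module.End ℂ P.pos) ⟨F.pos i, F.pos_mem i⟩ : V) = a i • F.pos i) (i : ι) :
    P.extend g (F.neg i) = (a i)⁻¹ • F.neg i := by
  have h1 : ∀ j, P.form (P.extend g (F.neg i)) (F.pos j) = if i = j then (a i)⁻¹ else 0 := by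
    intro j
    have h2 := P.form_extend g (F.neg i) (F.pos j)
    rw [F.extend_pos g a h, map_smul, F.dual, smul_eq_mul] at h2
    rw [(eq_inv_mul_iff_mul_eq₀ (ha j)).2 h2]
    by_cases hij : i = j <;> simp [hij]
  have h2 := F.expand (P.extend g (F.neg i))
  simp only [h1, ite_smul, zero_smul, Finset.sum_ite_eq, Finset.mem_univ, if_true] at h2
  rw [h2, add_eq_right]
  exact Finset.sum_eq_zero fun j _ => by
    rw [P.neg_isotropic _ (F.neg_mem j) _ (P.extend_mem_neg g ⟨F.neg i, F.neg_mem i⟩), zero_smul]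

/-- The eigenvalue of a diagonal element of `GL(pos)` on a creation operator. -/
noncomputable def _root_.UmbralFour.PolarizedSpace.weight (a : ι → ℂ) : Creators ι → ℂ
  | .inl p => a p.1
  | .inr p => (a p.1)⁻¹

theorem act_word (g : LinearMap.GeneralLinearGroup ℂ P.pos) (a : ι → ℂ) (ha : ∀ i, a i ≠ 0)
    (h : ∀ i, ((g : Module.End ℂ P.pos) ⟨F.pos i, F.pos_mem i⟩ : V) = a i • F.pos i)
    (l : List (Creators ι)) :
    P.act 0 g (F.word l) = (l.map (weight a)).prod • F.word l := by
  induction l with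
  | nil => rw [word_nil, vac, act_toFock, map_one]; simp
  | cons x l ih =>
    obtain ⟨y, hy⟩ := P.toFock_surjective 0 (F.word l)
    have h1 : P.extend g (F.vec x) = weight a x • F.vec x := by
      rcases x with ⟨i, n⟩ | ⟨i, n⟩
      · exact F.extend_pos g a h i
      · exact F.extend_neg g a ha h i
    rw [word_cons, List.map_cons, List.prod_cons, create, mode_apply]
    rw [← hy, act_toFock] at ih
    rw [← hy, ← map_smul, act_toFock, smul_eq_mul, map_mul, modesMap_gen, h1, ← smul_eq_mul,
      map_smul, ih, gen_smul, smul_assoc, smul_comm (P.gen 0 _ _), smul_smul]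
    exact congrArg _ ((P.toFock 0).map_smul _ _).symm

end Frame

end PolarizedSpace

/-! ### Simultaneously diagonal operators -/

section Diagonal

variable {W I κ : Type*} [AddCommGroup W] [Module ℂ W] (b : Module.Basis I ℂ W)

theorem repr_of_diagonal {T : Module.End ℂ W} {t : I → ℂ} (hT : ∀ i, T (b i) = t i • b i) (w : W)
    (i : I) : b.repr (T w) i = t i * b.repr w i := by
  have : b.coord i ∘ₗ T = t i • b.coord i := b.ext fun j => by
    by_cases h : j = i
    · subst h; simp [hT]
    · simp [hT, h]
  exact LinearMap.congr_fun this w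

theorem mem_eigenspace_of_diagonal {T : Module.End ℂ W} {t : I → ℂ}
    (hT : ∀ i, T (b i) = t i • b i) (w : W) (μ : ℂ) :
    w ∈ T.eigenspace μ ↔ ∀ i, b.repr w i ≠ 0 → t i = μ := by
  rw [Module.End.mem_eigenspace_iff, ← b.repr.injective.eq_iff, Finsupp.ext_iff]
  refine forall_congr' fun i => ?_
  rw [repr_of_diagonal b hT, map_smul, Finsupp.smul_apply, smul_eq_mul, mul_eq_mul_right_iff,
    or_iff_not_imp_right]

/-- The span of the basis vectors in the fibre of `d` over `p`. -/
noncomputable def fibre (d : I → κ) (p : κ) : Submodule ℂ W :=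
  (Finsupp.supported ℂ ℂ (d ⁻¹' {p})).comap (b.repr : W →ₗ[ℂ] I →₀ ℂ)

theorem mem_fibre (d : I → κ) (p : κ) (w : W) :
    w ∈ fibre b d p ↔ ∀ i, b.repr w i ≠ 0 → d i = p := by
  rw [fibre, Submodule.mem_comap, Finsupp.mem_supported]
  exact forall_congr' fun i => by simp

theorem isInternal_fibre [DecidableEq κ] (d : I → κ) : DirectSum.IsInternal (fibre b d) := by
  refine DirectSum.isInternal_submodule_of_iSupIndep_of_iSup_eq_top ?_ ?_
  · intro p
    rw [Submodule.disjoint_def]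
    intro w hw hw'
    have h : ⨆ (j) (_ : j ≠ p), fibre b d j ≤
        (Finsupp.supported ℂ ℂ (d ⁻¹' {p})ᶜ).comap (b.repr : W →ₗ[ℂ] I →₀ ℂ) := by
      refine iSup₂_le fun j hj w hw => ?_
      rw [mem_fibre] at hw
      rw [Submodule.mem_comap, Finsupp.mem_supported]
      intro i hi hi'
      exact hj ((hw i (Finsupp.mem_support_iff.1 hi)).symm.trans hi')
    rw [← b.repr.map_eq_zero_iff]
    exact Submodule.disjoint_def.1
      (Finsupp.disjoint_supported_supported (R := ℂ) (M := ℂ) (disjoint_compl_right (a := d ⁻¹' {p}))) _ hw (h hw')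
  · rw [eq_top_iff, ← b.span_eq, Submodule.span_le]
    rintro _ ⟨i, rfl⟩
    refine Submodule.mem_iSup_of_mem (d i) ?_
    rw [mem_fibre]
    intro j hj
    rw [b.repr_self, Finsupp.single_apply_ne_zero] at hj
    rw [hj.1]

/-- The basis of a fibre. -/
noncomputable def fibreBasis (d : I → κ) (p : κ) :
    Module.Basis (d ⁻¹' {p}) ℂ (fibre b d p) :=
  ⟨(b.repr.ofSubmodule' _).trans (Finsupp.supportedEquivFinsupp _)⟩

theorem fibreBasis_repr (d : I → κ) (p : κ) (w : fibre b d p) (i : d ⁻¹' {p}) :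
    (fibreBasis b d p).repr w i = b.repr w i := rfl

theorem coe_fibreBasis (d : I → κ) (p : κ) (i : d ⁻¹' {p}) :
    (fibreBasis b d p i : W) = b i := by
  have hi : b i ∈ fibre b d p := (mem_fibre b d p _).2 fun j hj => by
    rw [b.repr_self, Finsupp.single_apply_ne_zero] at hj
    rw [hj.1]; exact i.2
  have : fibreBasis b d p i = ⟨b i, hi⟩ := by
    rw [← (fibreBasis b d p).repr.injective.eq_iff]
    ext j
    rw [(fibreBasis b d p).repr_self, fibreBasis_repr]
    rw [b.repr_self]
    exact (Finsupp.single_apply_left Subtype.val_injective _ _ _).symm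
  rw [this]

theorem diagonal_mem_fibre {T : Module.End ℂ W} {t : I → ℂ} (hT : ∀ i, T (b i) = t i • b i)
    (d : I → κ) (p : κ) (w : W) (hw : w ∈ fibre b d p) : T w ∈ fibre b d p := by
  rw [mem_fibre] at hw ⊢
  intro i hi
  rw [repr_of_diagonal b hT] at hi
  exact hw i (right_ne_zero_of_mul hi)

theorem trace_restrict_fibre {T : Module.End ℂ W} {t : I → ℂ} (hT : ∀ i, T (b i) = t i • b i)
    (d : I → κ) (p : κ) [Fintype (d ⁻¹' {p})] (h : ∀ w ∈ fibre b d p, T w ∈ fibre b d p) :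
    LinearMap.trace ℂ (fibre b d p) (T.restrict h) = ∑ i : d ⁻¹' {p}, t i := by
  classical
  rw [LinearMap.trace_eq_matrix_trace ℂ (fibreBasis b d p), Matrix.trace]
  refine Finset.sum_congr rfl fun i _ => ?_
  rw [Matrix.diag_apply, LinearMap.toMatrix_apply, fibreBasis_repr, LinearMap.coe_restrict_apply,
    coe_fibreBasis, hT]
  simp

/-- The trace function of a diagonal operator is the sum over the basis. -/
theorem hasSum_trace_fibre {T : Module.End ℂ W} {t : I → ℂ} (hT : ∀ i, T (b i) = t i • b i)
    (d : I → κ) (hfin : ∀ p, (d ⁻¹' {p}).Finite)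
    (h : ∀ p, ∀ w ∈ fibre b d p, T w ∈ fibre b d p) (c : κ → ℂ) (a : ℂ)
    (hsum : HasSum (fun i => t i * c (d i)) a) :
    HasSum (fun p => LinearMap.trace ℂ (fibre b d p) (T.restrict (h p)) * c p) a := by
  -- Absolute convergence over the whole basis permits grouping by degree; each finite group is the
  -- trace on one graded piece.
  rw [← (Equiv.sigmaFiberEquiv d).hasSum_iff] at hsum
  refine hsum.sigma fun p => ?_
  have : Fintype (d ⁻¹' {p}) := (hfin p).fintype
  have : Fintype {i // d i = p} := (hfin p).fintype
  rw [trace_restrict_fibre b hT, Finset.sum_mul]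
  convert hasSum_fintype _ using 1
  refine Finset.sum_congr rfl fun i _ => ?_
  rw [Function.comp_apply, Equiv.sigmaFiberEquiv_apply]
  rw [i.2]

end Diagonal

/-! ### Generating functions of finite sets and multisets -/

section Multisets

variable {X : Type*} [DecidableEq X]

/-- A multiset supported on `insert a S` is a multiplicity of `a` and a multiset supported on
`S`. -/
def multisetInsertEquiv {a : X} {S : Finset X} (ha : a ∉ S) :
    ℕ × {m : Multiset X // ∀ x ∈ m, x ∈ S} ≃ {m : Multiset X // ∀ x ∈ m, x ∈ insert a S} where
  toFun p := ⟨Multiset.replicate p.1 a + p.2.1, fun x hx => by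
    rcases Multiset.mem_add.1 hx with h | h
    · rw [Multiset.eq_of_mem_replicate h]; exact Finset.mem_insert_self _ _
    · exact Finset.mem_insert_of_mem (p.2.2 x h)⟩
  invFun m := (m.1.count a, ⟨m.1.filter (· ≠ a), fun x hx => by
    rw [Multiset.mem_filter] at hx
    exact Finset.mem_of_mem_insert_of_ne (m.2 x hx.1) hx.2⟩)
  left_inv := by
    rintro ⟨k, m, hm⟩
    have h0 : a ∉ m := fun h => ha (hm a h)
    refine Prod.ext ?_ (Subtype.ext ?_)
    · simp [Multiset.count_eq_zero_of_notMem h0]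
    · simp only [Multiset.filter_add]
      rw [Multiset.filter_eq_nil.2, zero_add, Multiset.filter_eq_self]
      · rintro x hx rfl; exact h0 hx
      · intro x hx; simp [Multiset.eq_of_mem_replicate hx]
  right_inv := by
    rintro ⟨m, hm⟩
    refine Subtype.ext ?_
    simp only
    rw [← Multiset.filter_eq' m a]
    exact Multiset.filter_add_not _ _

/-- Each additional point contributes an independent geometric series. The field is general because
the formula is needed over `ℝ`, for the norms, as well as over `ℂ`. -/
theorem hasSum_multiset_finset {K : Type*} [NormedField K] [CompleteSpace K] (g : X → K) (hg : ∀ x, ‖g x‖ < 1) (S : Finset X) :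
    Summable (fun m : {m : Multiset X // ∀ x ∈ m, x ∈ S} => ‖(m.1.map g).prod‖) ∧
      HasSum (fun m : {m : Multiset X // ∀ x ∈ m, x ∈ S} => (m.1.map g).prod)
        (∏ x ∈ S, (1 - g x)⁻¹) := by
  induction S using Finset.induction_on with
  | empty =>
    have : Subsingleton {m : Multiset X // ∀ x ∈ m, x ∈ (∅ : Finset X)} :=
      ⟨fun m m' => Subtype.ext (by
        rw [Multiset.eq_zero_of_forall_notMem fun x hx => Finset.notMem_empty _ (m.2 x hx),
          Multiset.eq_zero_of_forall_notMem fun x hx => Finset.notMem_empty _ (m'.2 x hx)])⟩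
    refine ⟨Summable.of_finite, ?_⟩
    have h := hasSum_single (f := fun m : {m : Multiset X // ∀ x ∈ m, x ∈ (∅ : Finset X)} =>
      (m.1.map g).prod) ⟨0, by simp⟩ fun m hm => absurd (Subsingleton.elim _ _) hm
    simpa using h
  | insert a S ha ih =>
    have h1 : Summable fun k : ℕ => ‖g a ^ k‖ := summable_norm_geometric_of_norm_lt_one (hg a)
    have h2 : Summable fun p : ℕ × {m : Multiset X // ∀ x ∈ m, x ∈ S} =>
        ‖g a ^ p.1 * (p.2.1.map g).prod‖ :=
      Summable.mul_norm (f := fun k : ℕ => g a ^ k)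
        (g := fun m : {m : Multiset X // ∀ x ∈ m, x ∈ S} => (m.1.map g).prod) h1 ih.1
    have h3 : HasSum (fun p : ℕ × {m : Multiset X // ∀ x ∈ m, x ∈ S} =>
        g a ^ p.1 * (p.2.1.map g).prod) ((1 - g a)⁻¹ * ∏ x ∈ S, (1 - g x)⁻¹) :=
      HasSum.mul (f := fun k : ℕ => g a ^ k)
        (g := fun m : {m : Multiset X // ∀ x ∈ m, x ∈ S} => (m.1.map g).prod)
        (hasSum_geometric_of_norm_lt_one (hg a)) ih.2 h2.of_norm
    rw [← (multisetInsertEquiv ha).summable_iff, ← (multisetInsertEquiv ha).hasSum_iff,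
      Finset.prod_insert ha]
    have e : ∀ p : ℕ × {m : Multiset X // ∀ x ∈ m, x ∈ S},
        ((multisetInsertEquiv ha p).1.map g).prod = g a ^ p.1 * (p.2.1.map g).prod := by
      intro p
      simp [multisetInsertEquiv, Multiset.map_replicate]
    simp only [Function.comp_def, e]
    exact ⟨h2, h3⟩

/-- A finite family of multisets lives on a finite set `S`, so its sum is at most `∏ (1 - ‖g x‖)⁻¹`
over `S`, which is bounded independently of `S` by an exponential. -/
theorem summable_norm_multiset (g : X → ℂ) (hg : ∀ x, ‖g x‖ < 1) (hs : Summable fun x => ‖g x‖) :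
    Summable (fun m : Multiset X => ‖(m.map g).prod‖) := by
  -- Chosen so that `(1 - ‖g x‖)⁻¹ = 1 + h x`; it is summable because `‖g x‖ < 1/2`, and hence `h x
  -- ≤ 2 ‖g x‖`, outside a finite set.
  set h : X → ℝ := fun x => ‖g x‖ / (1 - ‖g x‖) with hh
  have h0 : ∀ x, 0 ≤ h x := fun x => div_nonneg (norm_nonneg _) (by linarith [hg x])
  have hsum : Summable h := by
    refine Summable.of_norm_bounded_eventually (hs.mul_left 2) ?_
    have := (hs.tendsto_cofinite_zero).eventually (gt_mem_nhds (show (0 : ℝ) < 1 / 2 by norm_num))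
    filter_upwards [this] with x hx
    rw [Real.norm_of_nonneg (h0 x), hh, div_le_iff₀ (by linarith)]
    nlinarith [norm_nonneg (g x)]
  refine summable_of_sum_le (c := Real.exp (∑' x, h x)) (fun _ => norm_nonneg _) fun F => ?_
  set S : Finset X := F.biUnion Multiset.toFinset
  have e : ∀ m : Multiset X, ‖(m.map g).prod‖ = (m.map fun x => ‖g x‖).prod := fun m => by
    induction m using Multiset.induction_on <;> simp_all
  have h1 := (hasSum_multiset_finset (fun x => ‖g x‖) (by simpa using hg) S).2
  have h2 : ∏ x ∈ S, (1 - ‖g x‖)⁻¹ ≤ Real.exp (∑' x, h x) := by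
    calc ∏ x ∈ S, (1 - ‖g x‖)⁻¹ = ∏ x ∈ S, (1 + h x) := by
          refine Finset.prod_congr rfl fun x _ => ?_
          have : 1 - ‖g x‖ ≠ 0 := by linarith [hg x]
          rw [hh]
          field_simp
          ring
      _ ≤ Real.exp (∑ x ∈ S, h x) := Real.prod_one_add_le_exp_sum S fun x => h0 x
      _ ≤ _ := Real.exp_le_exp.2 (hsum.sum_le_tsum S fun x _ => h0 x)
  refine le_trans ?_ h2
  simp only [e]
  rw [← Finset.sum_attach]
  let i : F → {m : Multiset X // ∀ x ∈ m, x ∈ S} := fun m => ⟨m.1, fun x hx =>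
    Finset.mem_biUnion.2 ⟨m.1, m.2, Multiset.mem_toFinset.2 hx⟩⟩
  have hi : Function.Injective i := fun a b hab => Subtype.ext (congrArg (fun t => t.1) hab)
  have := sum_le_hasSum (F.attach.map ⟨i, hi⟩) (fun m _ => by
    rw [← e]; exact norm_nonneg _) h1
  rwa [Finset.sum_map] at this

/-- The finite products over `S` have two limits as `S` grows: the inverse infinite product, and, by
dominated convergence, the sum over all multisets. -/
theorem hasSum_multiset (g : X → ℂ) (hg : ∀ x, ‖g x‖ < 1) (hs : Summable fun x => ‖g x‖) :
    HasSum (fun m : Multiset X => (m.map g).prod) (∏' x, (1 - g x))⁻¹ := by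
  have h1 := summable_norm_multiset g hg hs
  have h2 : HasProd (fun x => 1 - g x) (∏' x, (1 - g x)) := by
    have := multipliable_one_add_of_summable (f := fun x => - g x) (by simpa using hs)
    simpa [sub_eq_add_neg] using this.hasProd
  have h3 : ∏' x, (1 - g x) ≠ 0 := by
    have := tprod_one_add_ne_zero_of_summable (f := fun x => - g x) (fun x h => by
      have h' : g x = 1 := by linear_combination -h
      have := hg x
      rw [h', norm_one] at this
      exact lt_irrefl _ this) (by simpa using hs)
    simpa [sub_eq_add_neg] using this
  have h4 : Filter.Tendsto (fun S : Finset X => ∏ x ∈ S, (1 - g x)⁻¹) Filter.atTop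
      (nhds (∏' x, (1 - g x))⁻¹) := by
    simp only [Finset.prod_inv_distrib]
    exact Filter.Tendsto.inv₀ h2 h3
  have h5 : Filter.Tendsto (fun S : Finset X => ∏ x ∈ S, (1 - g x)⁻¹) Filter.atTop
      (nhds (∑' m : Multiset X, (m.map g).prod)) := by
    have e : ∀ S : Finset X, ∏ x ∈ S, (1 - g x)⁻¹ =
        ∑' m : Multiset X, Set.indicator {m | ∀ x ∈ m, x ∈ S} (fun m => (m.map g).prod) m :=
      fun S => ((hasSum_subtype_iff_indicator (f := fun m : Multiset X => (m.map g).prod)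
        (s := {m : Multiset X | ∀ x ∈ m, x ∈ S})).1
        (hasSum_multiset_finset g hg S).2).tsum_eq.symm
    simp only [e]
    refine tendsto_tsum_of_dominated_convergence h1 (fun m => ?_)
      (Filter.Eventually.of_forall fun S m => norm_indicator_le_norm_self _ _)
    refine tendsto_const_nhds.congr' ?_
    filter_upwards [Filter.eventually_ge_atTop m.toFinset] with S hS
    rw [Set.indicator_of_mem]
    exact fun x hx => hS (Multiset.mem_toFinset.2 hx)
  rw [tendsto_nhds_unique h4 h5]
  exact h1.of_norm.hasSum

/-- The generating function of finite sets with an additive statistic that is lowered by one by a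
point `a` of weight `-1`. -/
theorem hasSum_finset_statistic (f : X → ℂ) (c : X → ℤ) (hs : Summable fun x => ‖f x‖)
    (a : X) (hfa : f a = -1) (hca : c a = -1) (hc : ∀ x, |c x| ≤ 1) :
    (Summable fun S : Finset X => ‖(1 / 2 + ((∑ x ∈ S, c x : ℤ) : ℂ)) * ∏ x ∈ S, f x‖) ∧
    HasSum (fun S : Finset X => (1 / 2 + ((∑ x ∈ S, c x : ℤ) : ℂ)) * ∏ x ∈ S, f x)
      (∏' x, (1 + Function.update f a 0 x)) := by
  set h : Finset X → ℂ := fun S => (1 / 2 + ((∑ x ∈ S, c x : ℤ) : ℂ)) * ∏ x ∈ S, f x with hh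
  set w : Finset X → ℂ := fun S => ∏ x ∈ S, Function.update f a 0 x with hw
  have hsum : Summable fun S => ‖h S‖ := by
    -- The statistic is at most `1/2 + |S| ≤ 2^|S|` in norm, so it can be absorbed by doubling each
    -- factor.
    have h1 : Summable fun S : Finset X => ∏ x ∈ S, (2 * ‖f x‖) :=
      summable_finsetProd_of_summable_nonneg (fun x => by positivity) (hs.mul_left 2)
    refine Summable.of_nonneg_of_le (fun _ => norm_nonneg _) (fun S => ?_) h1
    rw [hh, norm_mul, norm_prod, Finset.prod_mul_distrib]
    refine mul_le_mul_of_nonneg_right ?_ (Finset.prod_nonneg fun x _ => norm_nonneg _)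
    have h2 : ‖((∑ x ∈ S, c x : ℤ) : ℂ)‖ ≤ S.card := by
      push_cast
      refine (norm_sum_le _ _).trans ?_
      rw [Finset.card_eq_sum_ones]
      push_cast
      refine Finset.sum_le_sum fun x _ => ?_
      rw [Complex.norm_intCast]
      exact_mod_cast hc x
    have h3 : (S.card : ℝ) + 1 ≤ 2 ^ S.card := by exact_mod_cast Nat.lt_two_pow_self
    rw [Finset.prod_const]
    refine (norm_add_le _ _).trans ?_
    have : ‖(1 / 2 : ℂ)‖ = 1 / 2 := by norm_num
    linarith
  refine ⟨hsum, ?_⟩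
  have hfs : Summable fun x => ‖Function.update f a 0 x‖ := by
    refine Summable.of_nonneg_of_le (fun _ => norm_nonneg _) (fun x => ?_) hs
    by_cases hx : x = a
    · subst hx; simp
    · simp [hx]
  have hw1 : Summable w := summable_finsetProd_of_summable_norm hfs
  have hw2 : ∏' x, (1 + Function.update f a 0 x) = ∑' S, w S := tprod_one_add hw1
  -- The involution that adds or removes `a`; summing over its orbits avoids splitting the index
  -- set.
  let σ : Finset X ≃ Finset X := (Function.Involutive.toPerm (fun S => symmDiff S {a})
    (fun S => symmDiff_symmDiff_cancel_right _ _))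
  have hσ : ∀ S x, x ∈ σ S ↔ x ∈ S ∧ x ∉ ({a} : Finset X) ∨ x ∈ ({a} : Finset X) ∧ x ∉ S :=
    fun S x => Finset.mem_symmDiff
  have hσ1 : ∀ S, a ∉ S → σ S = insert a S := fun S hS => by
    ext x
    simp only [hσ, Finset.mem_singleton, Finset.mem_insert]
    constructor
    · tauto
    · rintro (rfl | h)
      · exact Or.inr ⟨rfl, hS⟩
      · exact Or.inl ⟨h, fun h' => hS (h' ▸ h)⟩
  have hσ2 : ∀ S, σ (σ S) = S := fun S => symmDiff_symmDiff_cancel_right _ _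
  -- With `c` the statistic and `p` the product of `S`, the pair gives `(1/2 + c) p - (1/2 + c - 1)
  -- p = p`: the statistic drops out, and what remains is the sum with `a` given weight zero.
  have key1 : ∀ S, a ∉ S → h S + h (insert a S) = w S + w (insert a S) := by
    intro S hS
    have e1 : w (insert a S) = 0 :=
      Finset.prod_eq_zero (Finset.mem_insert_self a S) (by simp)
    have e2 : w S = ∏ x ∈ S, f x := Finset.prod_congr rfl fun x hx => by
      rw [Function.update_of_ne]; rintro rfl; exact hS hx
    rw [e1, e2, hh]
    simp only
    rw [Finset.sum_insert hS, Finset.prod_insert hS, hca, hfa]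
    push_cast
    ring
  have key : ∀ S, h S + h (σ S) = w S + w (σ S) := by
    intro S
    by_cases hS : a ∈ S
    · have h1 : a ∉ σ S := by simp [hσ, hS]
      have h2 := key1 _ h1
      rw [← hσ1 _ h1, hσ2] at h2
      linear_combination h2
    · rw [hσ1 S hS]; exact key1 S hS
  have h1 := hsum.of_norm.hasSum
  have h2 := (σ.hasSum_iff (f := h)).2 h1
  have h3 := hw1.hasSum
  have h4 := (σ.hasSum_iff (f := w)).2 h3
  have h5 := (h1.add h2).unique (by simpa only [Function.comp_apply, key] using h3.add h4)
  rw [hw2, show ∑' S, w S = ∑' S, h S by linear_combination -h5 / 2]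
  exact h1

end Multisets

open _root_.UmbralFour.PolarizedSpace (Creators level charge weight)

/-! ### Theta products -/

/-- The Euler product `∏_{n > 0} (1 - q^n)`. -/
noncomputable def eulerProd (q : ℂ) : ℂ := ∏' n : ℕ, (1 - q ^ (n + 1))

/-- The product `∏_{n > 0} (1 - x⁻¹ q^{n-1}) (1 - x q^n)`. -/
noncomputable def thetaProd (x q : ℂ) : ℂ := ∏' n : ℕ, ((1 - x⁻¹ * q ^ n) * (1 - x * q ^ (n + 1)))

section Products

variable {q : ℂ}

theorem summable_norm_mul_pow (hq : ‖q‖ < 1) (x : ℂ) : Summable fun n : ℕ => ‖x * q ^ n‖ := by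
  simp only [norm_mul]
  exact (summable_norm_geometric_of_norm_lt_one hq).mul_left _

theorem summable_norm_mul_pow_succ (hq : ‖q‖ < 1) (x : ℂ) :
    Summable fun n : ℕ => ‖x * q ^ (n + 1)‖ :=
  (summable_nat_add_iff 1).2 (summable_norm_mul_pow hq x)

theorem multipliable_one_sub {X : Type*} {f : X → ℂ} (hf : Summable fun x => ‖f x‖) :
    Multipliable fun x => 1 - f x := by
  simpa [sub_eq_add_neg] using multipliable_one_add_of_summable (f := fun x => - f x)
    (by simpa using hf)

theorem tprod_one_sub_ne_zero {X : Type*} {f : X → ℂ} (hf : Summable fun x => ‖f x‖)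
    (h : ∀ x, f x ≠ 1) : ∏' x, (1 - f x) ≠ 0 := by
  have := tprod_one_add_ne_zero_of_summable (f := fun x => - f x) (fun x h' => h x (by
      linear_combination -h')) (by simpa using hf)
  simpa [sub_eq_add_neg] using this

theorem multipliable_thetaProd (hq : ‖q‖ < 1) (x : ℂ) :
    Multipliable fun n : ℕ => (1 - x⁻¹ * q ^ n) * (1 - x * q ^ (n + 1)) :=
  (multipliable_one_sub (summable_norm_mul_pow hq _)).mul
    (multipliable_one_sub (summable_norm_mul_pow_succ hq _))

theorem thetaProd_eq (hq : ‖q‖ < 1) (x : ℂ) :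
    thetaProd x q = (∏' n : ℕ, (1 - x * q ^ (n + 1))) * ∏' n : ℕ, (1 - x⁻¹ * q ^ n) := by
  rw [thetaProd, (multipliable_one_sub (summable_norm_mul_pow hq _)).tprod_mul
    (multipliable_one_sub (summable_norm_mul_pow_succ hq _)), mul_comm]

theorem multipliable_eulerProd (hq : ‖q‖ < 1) : Multipliable fun n : ℕ => 1 - q ^ (n + 1) := by
  simpa using multipliable_one_sub (summable_norm_mul_pow_succ hq 1)

theorem norm_mul_pow_lt_one (hq : ‖q‖ < 1) {x : ℂ} (hx : ‖x‖ < 1) (n : ℕ) : ‖x * q ^ n‖ < 1 := by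
  rw [norm_mul, norm_pow]
  exact mul_lt_one_of_nonneg_of_lt_one_left (norm_nonneg _) hx
    (pow_le_one₀ (norm_nonneg _) hq.le)

theorem ne_one_of_norm_lt_one {x : ℂ} (hx : ‖x‖ < 1) : x ≠ 1 := by
  rintro rfl
  simp at hx

theorem eulerProd_ne_zero (hq : ‖q‖ < 1) : eulerProd q ≠ 0 := by
  have := tprod_one_sub_ne_zero (summable_norm_mul_pow_succ hq 1) fun n =>
    ne_one_of_norm_lt_one (by simpa [pow_succ'] using norm_mul_pow_lt_one hq hq n)
  simpa [eulerProd] using this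

/-- The zeros lie at integer powers of `q`, outside the open annulus `1 < |x| < |q|⁻¹`. -/
theorem thetaProd_ne_zero (hq : ‖q‖ < 1) {x : ℂ} (hx : ‖x⁻¹‖ < 1) (hx' : ‖x * q‖ < 1) :
    thetaProd x q ≠ 0 := by
  rw [thetaProd_eq hq]
  refine mul_ne_zero (tprod_one_sub_ne_zero (summable_norm_mul_pow_succ hq _) fun n => ?_)
    (tprod_one_sub_ne_zero (summable_norm_mul_pow hq _) fun n => ?_)
  · refine ne_one_of_norm_lt_one ?_
    rw [pow_succ', ← mul_assoc]
    exact norm_mul_pow_lt_one hq hx' n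
  · exact ne_one_of_norm_lt_one (norm_mul_pow_lt_one hq hx n)

/-- A factorization of a polynomial induces a factorization of theta products. -/
theorem prod_thetaProd {κ κ' : Type*} [Fintype κ] [Fintype κ'] (hq : ‖q‖ < 1) (a : κ → ℂ)
    (b : κ' → ℂ) (d : κ' → ℕ) (hd : ∀ j, d j ≠ 0)
    (h : ∀ t, ∏ i, (1 - a i * t) = ∏ j, (1 - b j * t ^ d j))
    (h' : ∀ t, ∏ i, (1 - (a i)⁻¹ * t) = ∏ j, (1 - (b j)⁻¹ * t ^ d j)) (x : ℂ) :
    ∏ i, thetaProd (a i * x) q = ∏ j, thetaProd (b j * x ^ d j) (q ^ d j) := by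
  have hqd : ∀ j, ‖q ^ d j‖ < 1 := fun j => by
    rw [norm_pow]; exact pow_lt_one₀ (norm_nonneg _) hq (hd j)
  simp only [thetaProd]
  rw [← Multipliable.tprod_finsetProd fun i _ => multipliable_thetaProd hq _,
    ← Multipliable.tprod_finsetProd fun i _ => multipliable_thetaProd (hqd i) _]
  refine tprod_congr fun n => ?_
  rw [Finset.prod_mul_distrib, Finset.prod_mul_distrib]
  -- The factorizations are applied factor by factor: one for the eigenvalues at `x q^(n+1)`, one
  -- for their inverses at `x⁻¹ q^n`.
  have h1 := h (x * q ^ (n + 1))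
  have h2 := h' (x⁻¹ * q ^ n)
  simp only [← mul_assoc, mul_pow] at h1 h2
  simp only [mul_inv]
  rw [h1, h2]
  congr 1 <;> refine Finset.prod_congr rfl fun j _ => ?_ <;> congr 2
  all_goals first | rw [inv_pow] | rw [← pow_mul, ← pow_mul, mul_comm]

/-- The contributions `z_i q^n` and `z_i⁻¹ q^n` of the creation operators. -/
noncomputable def modeWeight {ι : Type} (z : ι → ℂ) (q : ℂ) : Creators ι → ℂ
  | .inl p => z p.1 * q ^ (p.2 + 1)
  | .inr p => (z p.1)⁻¹ * q ^ p.2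

@[simp]
theorem modeWeight_inl {ι : Type} (z : ι → ℂ) (q : ℂ) (p : ι × ℕ) :
    modeWeight z q (.inl p) = z p.1 * q ^ (p.2 + 1) := by
  rw [modeWeight]

@[simp]
theorem modeWeight_inr {ι : Type} (z : ι → ℂ) (q : ℂ) (p : ι × ℕ) :
    modeWeight z q (.inr p) = (z p.1)⁻¹ * q ^ p.2 := by
  rw [modeWeight]

theorem summable_norm_modeWeight {ι : Type} [Fintype ι] (hq : ‖q‖ < 1) (z : ι → ℂ) :
    Summable fun x => ‖modeWeight z q x‖ := by
  refine Summable.sum _ ?_ ?_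
  · simp only [Function.comp_def, modeWeight_inl]
    refine (summable_prod_of_nonneg fun _ => norm_nonneg _).2 ⟨fun i => ?_, Summable.of_finite⟩
    exact summable_norm_mul_pow_succ hq (z i)
  · simp only [Function.comp_def, modeWeight_inr]
    refine (summable_prod_of_nonneg fun _ => norm_nonneg _).2 ⟨fun i => ?_, Summable.of_finite⟩
    exact summable_norm_mul_pow hq (z i)⁻¹

theorem tprod_modeWeight {ι : Type} [Fintype ι] (hq : ‖q‖ < 1) (z : ι → ℂ) :
    ∏' x, (1 - modeWeight z q x) = ∏ i, thetaProd (z i) q := by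
  have h := summable_norm_modeWeight hq z
  have h1 := multipliable_one_sub (f := fun p => modeWeight z q (.inl p))
    (h.comp_injective Sum.inl_injective)
  have h2 := multipliable_one_sub (f := fun p => modeWeight z q (.inr p))
    (h.comp_injective Sum.inr_injective)
  have e := Multipliable.tprod_sum (f := fun x => 1 - modeWeight z q x) h1 h2
  simp only [modeWeight_inl, modeWeight_inr] at h1 h2 e
  have e1 := h1.tprod_prod' fun i => multipliable_one_sub (summable_norm_mul_pow_succ hq (z i))
  have e2 := h2.tprod_prod' fun i => multipliable_one_sub (summable_norm_mul_pow hq (z i)⁻¹)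
  replace e1 := e1.trans (tprod_fintype _)
  replace e2 := e2.trans (tprod_fintype _)
  rw [e, e1, e2, ← Finset.prod_mul_distrib]
  exact Finset.prod_congr rfl fun i _ => (thetaProd_eq hq (z i)).symm

/-- Splits a local weight into group eigenvalue, charge and level. The exponent `d` is the
coefficient of the current in `J(0)`: `2` for `a`, `1` for `b`, `0` for `e`. -/
theorem modeWeight_mul_zpow {ι : Type} (a : ι → ℂ) (y q : ℂ) (d : ℕ) (x : Creators ι) :
    modeWeight (fun i => a i * y ^ d) q x
      = weight a x * y ^ (d * charge x : ℤ) * q ^ level x := by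
  rcases x with p | p
  · simp [ weight, charge, level]
  · simp [ weight, charge, level, mul_comm]

theorem modeWeight_neg {ι : Type} (a : ι → ℂ) (q : ℂ) (x : Creators ι) :
    modeWeight (fun i => - a i) q x = - modeWeight a q x := by
  rcases x with p | p <;> simp [ inv_neg]

theorem norm_modeWeight_lt_one {ι : Type} (hq : ‖q‖ < 1) {z : ι → ℂ} (hz : ∀ i, ‖(z i)⁻¹‖ < 1)
    (hz' : ∀ i, ‖z i * q‖ < 1) (x : Creators ι) : ‖modeWeight z q x‖ < 1 := by
  rcases x with p | p
  · rw [modeWeight_inl, pow_succ', ← mul_assoc]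
    exact norm_mul_pow_lt_one hq (hz' _) _
  · rw [modeWeight_inr]
    exact norm_mul_pow_lt_one hq (hz _) _

/-- Without the zero mode, the creators of `e` have levels `1, 2, …` twice over, all with sign `-1`;
each tower gives one Euler product. -/
theorem tprod_fermion_statistic (hq : ‖q‖ < 1) :
    ∏' x : Creators (Fin 1), (1 + Function.update (modeWeight (fun _ => -1) q) (.inr (0, 0)) 0 x)
      = eulerProd q ^ 2 := by
  set f : Creators (Fin 1) → ℂ := fun x =>
    1 + Function.update (modeWeight (fun _ => -1) q) (.inr (0, 0)) 0 x with hf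
  have f1 : ∀ n, f (.inl (0, n)) = 1 - q ^ (n + 1) := fun n => by simp [hf, ← sub_eq_add_neg]
  have f2 : f (.inr (0, 0)) = 1 := by simp [hf]
  have f3 : ∀ n, f (.inr (0, n + 1)) = 1 - q ^ (n + 1) := fun n => by
    simp [hf, Function.update_apply, inv_neg, ← sub_eq_add_neg]
  clear_value f
  have h : HasProd (fun n : ℕ => 1 - q ^ (n + 1)) (eulerProd q) :=
    (multipliable_eulerProd hq).hasProd
  have h1 : HasProd (f ∘ Sum.inl) (eulerProd q) := by
    refine (Equiv.uniqueProd ℕ (Fin 1)).symm.hasProd_iff.1 ?_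
    simpa [Function.comp_def, f1] using h
  have h2 : HasProd (f ∘ Sum.inr) (eulerProd q) := by
    refine (Equiv.uniqueProd ℕ (Fin 1)).symm.hasProd_iff.1 ?_
    have := HasProd.zero_mul (f := fun n => f (.inr (0, n))) (m := eulerProd q) (by
      simpa [f3] using h)
    simpa [Function.comp_def, f2] using this
  rw [sq]
  exact (HasProd.sum h1 h2).tprod_eq

theorem hasSum_mul_mul {X Y Z : Type*} {f : X → ℂ} {g : Y → ℂ} {h : Z → ℂ} {a b c : ℂ}
    (hf : Summable fun x => ‖f x‖) (hfa : HasSum f a) (hg : Summable fun x => ‖g x‖)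
    (hgb : HasSum g b) (hh : Summable fun x => ‖h x‖) (hhc : HasSum h c) :
    (Summable fun i : X × Y × Z => ‖f i.1 * (g i.2.1 * h i.2.2)‖) ∧
      HasSum (fun i : X × Y × Z => f i.1 * (g i.2.1 * h i.2.2)) (a * (b * c)) := by
  have gh := hg.mul_norm hh
  have e1 := hf.mul_norm (g := fun p : Y × Z => g p.1 * h p.2) gh
  have e2 := hgb.mul hhc (summable_mul_of_summable_norm hg hh)
  have e3 := summable_mul_of_summable_norm (g := fun p : Y × Z => g p.1 * h p.2) hf gh
  exact ⟨e1, HasSum.mul (g := fun p : Y × Z => g p.1 * h p.2) hfa e2 e3⟩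

/-- The sum over the states of the three Fock spaces. -/
theorem hasSum_states (hq : ‖q‖ < 1) (lam : Fin 3 → ℂ) (mu : Fin 4 → ℂ)
    (hmu : ∀ j, ‖(mu j)⁻¹‖ < 1) (hmu' : ∀ j, ‖mu j * q‖ < 1) :
    (Summable fun i : Finset (Creators (Fin 1)) × Finset (Creators (Fin 3)) ×
        Multiset (Creators (Fin 4)) =>
      ‖((1 / 2 + ((∑ x ∈ i.1, charge x : ℤ) : ℂ)) * ∏ x ∈ i.1, modeWeight (fun _ => -1) q x) *
        ((∏ x ∈ i.2.1, modeWeight (fun i => - lam i) q x) *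
          (i.2.2.map (modeWeight mu q)).prod)‖) ∧
    HasSum (fun i : Finset (Creators (Fin 1)) × Finset (Creators (Fin 3)) ×
        Multiset (Creators (Fin 4)) =>
      ((1 / 2 + ((∑ x ∈ i.1, charge x : ℤ) : ℂ)) * ∏ x ∈ i.1, modeWeight (fun _ => -1) q x) *
        ((∏ x ∈ i.2.1, modeWeight (fun i => - lam i) q x) * (i.2.2.map (modeWeight mu q)).prod))
      (eulerProd q ^ 2 * ((∏ i, thetaProd (lam i) q) * (∏ j, thetaProd (mu j) q)⁻¹)) := by
  -- `.inr (0, 0)` is the zero mode `a⁻(0)` of `e`, of charge `-1`, level `0` and sign `-1`.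
  obtain ⟨e1, e2⟩ := hasSum_finset_statistic (modeWeight (fun _ : Fin 1 => -1) q) charge
    (summable_norm_modeWeight hq _) (.inr (0, 0)) (by simp [ inv_neg]) rfl
    (by rintro (p | p) <;> simp [charge])
  rw [tprod_fermion_statistic hq] at e2
  have a0 := summable_norm_modeWeight hq fun i => - lam i
  have a1 : Summable fun S : Finset (Creators (Fin 3)) =>
      ‖∏ x ∈ S, modeWeight (fun i => - lam i) q x‖ := by
    simp only [norm_prod]
    exact summable_finsetProd_of_summable_nonneg
      (f := fun x => ‖modeWeight (fun i => - lam i) q x‖) (fun _ => norm_nonneg _) a0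
  have a2 : HasSum (fun S : Finset (Creators (Fin 3)) =>
      ∏ x ∈ S, modeWeight (fun i => - lam i) q x) (∏ i, thetaProd (lam i) q) := by
    rw [← tprod_modeWeight hq]
    simp only [sub_eq_add_neg, ← modeWeight_neg]
    rw [tprod_one_add (f := modeWeight (fun i => - lam i) q) a1.of_norm]
    exact a1.of_norm.hasSum
  have b0 := norm_modeWeight_lt_one hq hmu hmu'
  have b1 := summable_norm_multiset _ b0 (summable_norm_modeWeight hq _)
  have b2 := hasSum_multiset _ b0 (summable_norm_modeWeight hq _)
  rw [tprod_modeWeight hq] at b2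
  have key := hasSum_mul_mul e1 e2 a1 a2 b1 b2
  exact ⟨key.1, key.2⟩

end Products

/-! ### The trace function on the twisted module -/

namespace PolarizedSpace.Frame

variable {s : ℂ} {V : Type*} [AddCommGroup V] [Module ℂ V] {ι : Type} [Fintype ι] [DecidableEq ι]
  {P : PolarizedSpace s V ι} (F : P.Frame)

theorem zeroJ_state (hs : s * s = 1) (m : Multiset (Creators ι)) :
    P.zeroJ (F.state m) = (-s * Fintype.card ι / 2 + ((m.map charge).sum : ℤ)) • F.state m := by
  rw [state, F.zeroJ_word hs, ← Multiset.sum_coe, ← Multiset.map_coe, Multiset.coe_toList]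

theorem zeroL_state (hs : s * s = 1) (m : Multiset (Creators ι)) :
    P.zeroL (F.state m) = (-s * Fintype.card ι / 8 + ((m.map level).sum : ℕ)) • F.state m := by
  rw [state, F.zeroL_word hs, ← Multiset.sum_coe, ← Multiset.map_coe, Multiset.coe_toList]

theorem act_state (g : LinearMap.GeneralLinearGroup ℂ P.pos) (a : ι → ℂ) (ha : ∀ i, a i ≠ 0)
    (h : ∀ i, ((g : Module.End ℂ P.pos) ⟨F.pos i, F.pos_mem i⟩ : V) = a i • F.pos i)
    (m : Multiset (Creators ι)) : P.act 0 g (F.state m) = (m.map (weight a)).prod • F.state m := by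
  rw [state, F.act_word g a ha h, ← Multiset.prod_coe, ← Multiset.map_coe, Multiset.coe_toList]

/-- The fermionic basis. -/
noncomputable def finsetBasis {P : PolarizedSpace (-1) V ι} (F : P.Frame) :
    Module.Basis (Finset (Creators ι)) ℂ (P.Fock 0) :=
  F.basis (by norm_num) Finset.val Finset.val_injective fun m =>
    ⟨fun ⟨S, hS⟩ => .inr (hS ▸ S.nodup), fun h => ⟨⟨m, h.resolve_left (by norm_num)⟩, rfl⟩⟩

/-- The bosonic basis. -/
noncomputable def multisetBasis {P : PolarizedSpace 1 V ι} (F : P.Frame) :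
    Module.Basis (Multiset (Creators ι)) ℂ (P.Fock 0) :=
  F.basis (by norm_num) id Function.injective_id fun m => ⟨fun _ => .inl rfl, fun _ => ⟨m, rfl⟩⟩

theorem finsetBasis_apply {P : PolarizedSpace (-1) V ι} (F : P.Frame) (S : Finset (Creators ι)) :
    F.finsetBasis S = F.state S.val := F.basis_apply ..

theorem multisetBasis_apply {P : PolarizedSpace 1 V ι} (F : P.Frame) (m : Multiset (Creators ι)) :
    F.multisetBasis m = F.state m := F.basis_apply ..

end PolarizedSpace.Frame

/-- The index set of a basis of the twisted module. -/
abbrev States : Type :=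
  Finset (Creators (Fin 1)) × Finset (Creators (Fin 3)) × Multiset (Creators (Fin 4))

/-- The eigenvalue of `J(0)`. -/
def jDeg (i : States) : ℤ := 1 + 2 * ∑ x ∈ i.2.1, charge x + (i.2.2.map charge).sum

/-- The eigenvalue of `L(0)`. -/
def lDeg (i : States) : ℕ :=
  ∑ x ∈ i.1, level x + ∑ x ∈ i.2.1, level x + (i.2.2.map level).sum

/-- The eigenvalues of `J(0)` and `L(0)`. -/
def biDeg (i : States) : ℤ × ℕ := (jDeg i, lDeg i)

/-- The creators of charge `1` start at level `1`, so charge never exceeds level. This bounds the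
powers of `y` from above for each power of `q`. -/
theorem jDeg_le (i : States) : jDeg i ≤ 1 + 2 * lDeg i := by
  have h : ∀ {n : ℕ} (x : Creators (Fin n)), charge x ≤ level x := by
    rintro n (⟨a, b⟩ | ⟨a, b⟩) <;> simp [charge, level]
  have h1 : ∀ m : Multiset (Creators (Fin 3)), (m.map charge).sum ≤ ((m.map level).sum : ℕ) ∧
      ∀ m : Multiset (Creators (Fin 4)), (m.map charge).sum ≤ ((m.map level).sum : ℕ) := by
    refine fun m => ⟨?_, fun m => ?_⟩ <;>
    induction m using Multiset.induction_on with
    | empty => simp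
    | cons a m ih =>
      simp only [Multiset.map_cons, Multiset.sum_cons, Nat.cast_add]
      linarith [h a]
  have h2 := (h1 i.2.1.val).1
  have h3 := (h1 0).2 i.2.2
  change 1 + 2 * (i.2.1.val.map charge).sum + (i.2.2.map charge).sum ≤
    1 + 2 * (((i.1.val.map level).sum + (i.2.1.val.map level).sum + (i.2.2.map level).sum : ℕ) : ℤ)
  simp only [Nat.cast_add]
  linarith [Int.natCast_nonneg (i.1.val.map level).sum, Int.natCast_nonneg (i.2.2.map level).sum]

/-- The contribution of a state to the trace function without the prefactor `y`. -/
noncomputable def stateTerm (lam : Fin 3 → ℂ) (mu : Fin 4 → ℂ) (q : ℂ) (i : States) : ℂ :=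
  ((1 / 2 + ((∑ x ∈ i.1, charge x : ℤ) : ℂ)) * ∏ x ∈ i.1, modeWeight (fun _ => -1) q x) *
    ((∏ x ∈ i.2.1, modeWeight (fun i => - lam i) q x) * (i.2.2.map (modeWeight mu q)).prod)

/-- The eigenvalue of `(1 ⊗ α ⊗ β) J_e(0) (-1)^F` for diagonal `α`, `β` with eigenvalues `lam`
and `mu`. -/
noncomputable def stateWeight (lam : Fin 3 → ℂ) (mu : Fin 4 → ℂ) (i : States) : ℂ :=
  ((1 / 2 + ((∑ x ∈ i.1, charge x : ℤ) : ℂ)) * ∏ x ∈ i.1, weight (fun _ => -1) x) *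
    ((∏ x ∈ i.2.1, weight (fun i => - lam i) x) * (i.2.2.map (weight mu)).prod)

/-- The prefactor `y` accounts for the `J(0)`-eigenvalue `1` of the vacuum; all other exponents are
sums over the creators. -/
theorem mul_stateTerm (lam : Fin 3 → ℂ) (mu : Fin 4 → ℂ) {y : ℂ} (hy : y ≠ 0) (q : ℂ) (i : States) :
    y * stateTerm (fun i => lam i * y ^ 2) (fun j => mu j * y) q i
      = stateWeight lam mu i * y ^ jDeg i * q ^ lDeg i := by
  have hE : ∀ x : Creators (Fin 1), modeWeight (fun _ => -1) q x
      = weight (fun _ => -1) x * q ^ level x := fun x => by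
    have := modeWeight_mul_zpow (fun _ => -1) y q 0 x
    simpa using this
  have hA : ∀ x : Creators (Fin 3), modeWeight (fun i => - (lam i * y ^ 2)) q x
      = weight (fun i => - lam i) x * (y ^ (2 : ℤ)) ^ charge x * q ^ level x := fun x => by
    have := modeWeight_mul_zpow (fun i => - lam i) y q 2 x
    rw [← zpow_mul]
    simpa only [neg_mul, Nat.cast_ofNat] using this
  have hB : ∀ x : Creators (Fin 4), modeWeight (fun i => mu i * y) q x
      = weight mu x * y ^ charge x * q ^ level x := fun x => by
    have := modeWeight_mul_zpow mu y q 1 x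
    simpa using this
  have hm : ∀ m : Multiset (Creators (Fin 4)), (m.map (modeWeight (fun i => mu i * y) q)).prod
      = (m.map (weight mu)).prod * y ^ (m.map charge).sum * q ^ (m.map level).sum := fun m => by
    induction m using Multiset.induction_on with
    | empty => simp
    | cons a m ih =>
      simp only [Multiset.map_cons, Multiset.prod_cons, Multiset.sum_cons, zpow_add₀ hy, pow_add]
      rw [ih, hB]
      ring
  have hz : ∀ S : Finset (Creators (Fin 3)), ∏ x ∈ S, (y ^ (2 : ℤ)) ^ charge x
      = y ^ (2 * ∑ x ∈ S, charge x) := fun S => by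
    rw [zpow_mul]
    induction S using Finset.induction_on with
    | empty => simp
    | insert a S ha ih =>
      rw [Finset.prod_insert ha, Finset.sum_insert ha, ih, zpow_add₀ (zpow_ne_zero _ hy)]
  simp only [stateTerm, stateWeight, hE, hA, hm, Finset.prod_mul_distrib, hz, Finset.prod_pow_eq_pow_sum,
    jDeg, lDeg, zpow_add₀ hy, pow_add, zpow_one]
  ring

theorem norm_half_add_intCast (c : ℤ) : (1 / 2 : ℝ) ≤ ‖(1 / 2 + (c : ℂ))‖ := by
  have : (1 / 2 + (c : ℂ)) = ((1 / 2 + c : ℝ) : ℂ) := by push_cast; rfl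
  rw [this, Complex.norm_real, Real.norm_eq_abs]
  rcases le_or_gt 0 c with h | h
  · have : (0 : ℝ) ≤ c := by exact_mod_cast h
    rw [abs_of_nonneg (by linarith)]; linarith
  · have : (c : ℝ) ≤ -1 := by exact_mod_cast Int.le_sub_one_of_lt h
    rw [abs_of_neg (by linarith)]; linarith

theorem norm_weight {ι : Type} {a : ι → ℂ} (ha : ∀ i, ‖a i‖ = 1) (x : Creators ι) :
    ‖weight a x‖ = 1 := by
  rcases x with p | p <;> simp [weight, ha]

/-- Instead of counting states, the convergence of the state sum at `y = 2`, `q = 1/4` is used. All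
states of bidegree `p` contribute terms bounded below by one positive constant, since the
half-integral eigenvalue of `J_e(0)` has absolute value at least `1/2`. -/
theorem finite_biDeg_fibre (p : ℤ × ℕ) : (biDeg ⁻¹' {p}).Finite := by
  have h := (hasSum_states (q := 1 / 4) (by norm_num) (fun _ => 1 * 2 ^ 2) (fun _ => 1 * 2)
    (by norm_num) (by norm_num)).1
  -- One factor `1/2` is the lower bound for the eigenvalue of `J_e(0)`, the other comes from
  -- dividing by the prefactor `y = 2`.
  set ε : ℝ := 2 ^ p.1 * (1 / 4) ^ p.2 / 4 with hε
  have hp : (0 : ℝ) < 2 ^ p.1 * (1 / 4) ^ p.2 := by positivity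
  have h1 := (h.tendsto_cofinite_zero).eventually (gt_mem_nhds (show 0 < ε by positivity))
  rw [Filter.eventually_cofinite] at h1
  refine h1.subset fun i hi => ?_
  have e := congrArg norm (mul_stateTerm (fun _ => 1) (fun _ => 1) (y := 2) two_ne_zero (1 / 4) i)
  have hi' : biDeg i = p := hi
  have e2 : ‖(2 : ℂ)‖ = 2 := by simp
  have e4 : ‖(1 / 4 : ℂ)‖ = 1 / 4 := by simp
  have hj : jDeg i = p.1 := congrArg Prod.fst hi'
  have hl : lDeg i = p.2 := congrArg Prod.snd hi'
  rw [norm_mul, norm_mul, norm_mul, norm_zpow, norm_pow, e2, e4, hj, hl, mul_assoc] at e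
  have hw : 1 / 2 ≤ ‖stateWeight (fun _ => 1) (fun _ => 1) i‖ := by
    have n3 : ‖(i.2.2.map (weight fun _ => (1 : ℂ))).prod‖ = 1 := by
      induction i.2.2 using Multiset.induction_on with
      | empty => simp
      | cons a m ih =>
        rw [Multiset.map_cons, Multiset.prod_cons, norm_mul, ih, norm_weight (by simp), one_mul]
    rw [stateWeight, norm_mul, norm_mul, norm_mul, n3, norm_prod, norm_prod,
      Finset.prod_eq_one fun x _ => norm_weight (by simp) x,
      Finset.prod_eq_one fun x _ => norm_weight (by simp) x, mul_one, mul_one, mul_one]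
    exact norm_half_add_intCast _
  change ¬ ‖stateTerm (fun _ => 1 * 2 ^ 2) (fun _ => 1 * 2) (1 / 4) i‖ < ε
  rw [not_lt, hε]
  nlinarith

/-! ### The operators on the twisted module in the occupation number basis -/

section Basis

variable {E A B : Type*} [AddCommGroup E] [Module ℂ E] [AddCommGroup A] [Module ℂ A]
  [AddCommGroup B] [Module ℂ B] {PE : PolarizedSpace (-1) E (Fin 1)}
  {PA : PolarizedSpace (-1) A (Fin 3)} {PB : PolarizedSpace 1 B (Fin 4)}
  (FE : PE.Frame) (FA : PA.Frame) (FB : PB.Frame)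

/-- The basis of the twisted module consisting of products of creation operators. -/
noncomputable def wBasis : Module.Basis States ℂ (Wtw PE PA PB) :=
  FE.finsetBasis.tensorProduct (FA.finsetBasis.tensorProduct FB.multisetBasis)

theorem wBasis_apply (i : States) : wBasis FE FA FB i
    = FE.state i.1.val ⊗ₜ (FA.state i.2.1.val ⊗ₜ FB.state i.2.2) := by
  rw [wBasis, Module.Basis.tensorProduct_apply', Module.Basis.tensorProduct_apply',
    PolarizedSpace.Frame.finsetBasis_apply, PolarizedSpace.Frame.finsetBasis_apply,
    PolarizedSpace.Frame.multisetBasis_apply]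

theorem tensorOp_wBasis {x : Module.End ℂ (PE.Fock 0)} {y : Module.End ℂ (PA.Fock 0)}
    {z : Module.End ℂ (PB.Fock 0)} {i : States} {a b c : ℂ}
    (hx : x (FE.state i.1.val) = a • FE.state i.1.val)
    (hy : y (FA.state i.2.1.val) = b • FA.state i.2.1.val)
    (hz : z (FB.state i.2.2) = c • FB.state i.2.2) :
    tensorOp PE PA PB x y z (wBasis FE FA FB i) = (a * (b * c)) • wBasis FE FA FB i := by
  rw [wBasis_apply, tensorOp, TensorProduct.map_tmul, TensorProduct.map_tmul, hx, hy, hz,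
    TensorProduct.smul_tmul_smul, TensorProduct.smul_tmul_smul]

theorem opJ_wBasis (i : States) :
    opJ PE PA PB (wBasis FE FA FB i) = (jDeg i : ℂ) • wBasis FE FA FB i := by
  rw [opJ, LinearMap.add_apply, LinearMap.smul_apply,
    tensorOp_wBasis FE FA FB (one_smul ℂ _).symm (FA.zeroJ_state (by norm_num) _)
      (one_smul ℂ _).symm,
    tensorOp_wBasis FE FA FB (one_smul ℂ _).symm (one_smul ℂ _).symm
      (FB.zeroJ_state (by norm_num) _), smul_smul, ← add_smul]
  congr 1
  change _ = ((1 + 2 * (i.2.1.val.map charge).sum + (i.2.2.map charge).sum : ℤ) : ℂ)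
  push_cast
  simp only [Fintype.card_fin]
  push_cast
  ring

theorem opL_wBasis (i : States) :
    opL PE PA PB (wBasis FE FA FB i) = (lDeg i : ℂ) • wBasis FE FA FB i := by
  rw [opL, LinearMap.add_apply, LinearMap.add_apply,
    tensorOp_wBasis FE FA FB (FE.zeroL_state (by norm_num) _) (one_smul ℂ _).symm
      (one_smul ℂ _).symm,
    tensorOp_wBasis FE FA FB (one_smul ℂ _).symm (FA.zeroL_state (by norm_num) _)
      (one_smul ℂ _).symm,
    tensorOp_wBasis FE FA FB (one_smul ℂ _).symm (one_smul ℂ _).symm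
      (FB.zeroL_state (by norm_num) _), ← add_smul, ← add_smul]
  congr 1
  change _ = (((i.1.val.map level).sum + (i.2.1.val.map level).sum + (i.2.2.map level).sum : ℕ) : ℂ)
  push_cast
  simp only [Fintype.card_fin]
  push_cast
  ring

theorem opJe_wBasis (i : States) : opJe PE PA PB (wBasis FE FA FB i)
    = (1 / 2 + ((∑ x ∈ i.1, charge x : ℤ) : ℂ)) • wBasis FE FA FB i := by
  rw [opJe, tensorOp_wBasis FE FA FB (FE.zeroJ_state (by norm_num) _) (one_smul ℂ _).symm
      (one_smul ℂ _).symm]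
  congr 1
  change _ = 1 / 2 + (((i.1.val.map charge).sum : ℤ) : ℂ)
  simp

/-- Valid for all frames, whereas the left side depends on none; the trace of `g` may therefore be
computed in frames adapted to `g`. -/
theorem bigraded_eq (k : ℤ) (n : ℕ) :
    bigraded PE PA PB k n = fibre (wBasis FE FA FB) biDeg (k, n) := by
  ext w
  rw [bigraded, Submodule.mem_inf, mem_eigenspace_of_diagonal _ (opJ_wBasis FE FA FB),
    mem_eigenspace_of_diagonal _ (opL_wBasis FE FA FB), mem_fibre]
  simp only [← forall_and, biDeg, Prod.mk.injEq, Int.cast_inj, Nat.cast_inj]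

theorem prod_map_weight_one {ι : Type} (m : Multiset (Creators ι)) :
    (m.map (weight fun _ => (1 : ℂ))).prod = 1 := by
  refine Multiset.prod_eq_one fun x hx => ?_
  obtain ⟨x, _, rfl⟩ := Multiset.mem_map.1 hx
  rcases x with p | p <;> simp [weight]

/-- On `a` the sign of `(-1)^F` merges with the eigenvalues into `-lam`; on `e` only the sign is
left, and on `b` only `mu`. -/
theorem glAct_wBasis (α : LinearMap.GeneralLinearGroup ℂ PA.pos)
    (β : LinearMap.GeneralLinearGroup ℂ PB.pos) (lam : Fin 3 → ℂ) (mu : Fin 4 → ℂ)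
    (hlam : ∀ i, lam i ≠ 0) (hmu : ∀ i, mu i ≠ 0)
    (hα : ∀ i, ((α : Module.End ℂ PA.pos) ⟨FA.pos i, FA.pos_mem i⟩ : A) = lam i • FA.pos i)
    (hβ : ∀ i, ((β : Module.End ℂ PB.pos) ⟨FB.pos i, FB.pos_mem i⟩ : B) = mu i • FB.pos i)
    (i : States) :
    (glAct PE PA PB 1 α β * opJe PE PA PB * glAct PE PA PB (-1) (-1) 1) (wBasis FE FA FB i)
      = stateWeight lam mu i • wBasis FE FA FB i := by
  have h1 : glAct PE PA PB 1 α β (wBasis FE FA FB i)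
      = ((i.2.1.val.map (weight lam)).prod * (i.2.2.map (weight mu)).prod) •
        wBasis FE FA FB i := by
    rw [glAct, tensorOp_wBasis FE FA FB
      (FE.act_state 1 (fun _ => 1) (fun _ => one_ne_zero) (fun i => by simp) _)
      (FA.act_state α lam hlam hα _) (FB.act_state β mu hmu hβ _), prod_map_weight_one, one_mul]
  have h2 : glAct PE PA PB (-1) (-1) 1 (wBasis FE FA FB i)
      = ((∏ x ∈ i.1, weight (fun _ => -1) x) * ∏ x ∈ i.2.1, weight (fun _ => -1) x) •
        wBasis FE FA FB i := by
    rw [glAct, tensorOp_wBasis FE FA FB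
      (FE.act_state (-1) (fun _ => -1) (fun _ => by norm_num) (fun i => by simp) _)
      (FA.act_state (-1) (fun _ => -1) (fun _ => by norm_num) (fun i => by simp) _)
      (FB.act_state 1 (fun _ => 1) (fun _ => one_ne_zero) (fun i => by simp) _),
      prod_map_weight_one, mul_one]
    rfl
  rw [Module.End.mul_apply, Module.End.mul_apply, h2, map_smul, opJe_wBasis, map_smul, map_smul, h1,
    smul_smul, smul_smul]
  congr 1
  have h3 : ∀ x, weight (fun i => - lam i) x = weight (fun _ => -1) x * weight lam x := by
    rintro (p | p) <;> simp [weight, inv_neg]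
  rw [stateWeight, Finset.prod_congr rfl fun x _ => h3 x, Finset.prod_mul_distrib]
  change _ * ((∏ x ∈ i.2.1, weight lam x) * _) = _
  ring

theorem inv_apply_eq_smul {V : Type*} [AddCommGroup V] [Module ℂ V]
    (f : LinearMap.GeneralLinearGroup ℂ V) {c : ℂ} {v : V} (hc : c ≠ 0)
    (h : (f : Module.End ℂ V) v = c • v) :
    ((f⁻¹ : LinearMap.GeneralLinearGroup ℂ V) : Module.End ℂ V) v = c⁻¹ • v := by
  have : ((f⁻¹ : LinearMap.GeneralLinearGroup ℂ V) : Module.End ℂ V) ((f : Module.End ℂ V) v)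
      = v := LinearMap.congr_fun (f.inv_mul) v
  rw [h, map_smul] at this
  rw [← this, smul_smul, inv_mul_cancel₀ hc, one_smul, this]

/-- The same frames diagonalize `g` and `g⁻¹`, with inverse eigenvalues, so the trace is a sum of
two state sums. Eigenvalues of norm one on `b` keep the bosonic series convergent in the annulus of
`y`. -/
theorem hasSum_traceOp {G : Type*} [Group G] (ρ : G →* LinearMap.GeneralLinearGroup ℂ PA.pos)
    (ρ' : G →* LinearMap.GeneralLinearGroup ℂ PB.pos) (g : G)
    (bA : Module.Basis (Fin 3) ℂ PA.pos) (bB : Module.Basis (Fin 4) ℂ PB.pos)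
    (lam : Fin 3 → ℂ) (mu : Fin 4 → ℂ) (hlam : ∀ i, lam i ≠ 0) (hmu : ∀ i, ‖mu i‖ = 1)
    (hA : ∀ i, (ρ g : Module.End ℂ PA.pos) (bA i) = lam i • bA i)
    (hB : ∀ i, (ρ' g : Module.End ℂ PB.pos) (bB i) = mu i • bB i) :
    ∃ hinv : ∀ k n, ∀ w ∈ bigraded PE PA PB k n,
        traceOp PE PA PB ρ ρ' g w ∈ bigraded PE PA PB k n,
      ∀ y q : ℂ, y ≠ 0 → ‖y⁻¹‖ < 1 → ‖y * q‖ < 1 → HasSum (fun p : ℤ × ℕ =>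
          LinearMap.trace ℂ (bigraded PE PA PB p.1 p.2)
            ((traceOp PE PA PB ρ ρ' g).restrict (hinv p.1 p.2)) * y ^ p.1 * q ^ p.2)
        (-(y * (eulerProd q ^ 2 * ((∏ i, thetaProd (lam i * y ^ 2) q) *
            (∏ j, thetaProd (mu j * y) q)⁻¹))
          + y * (eulerProd q ^ 2 * ((∏ i, thetaProd ((lam i)⁻¹ * y ^ 2) q) *
            (∏ j, thetaProd ((mu j)⁻¹ * y) q)⁻¹)))) := by
  have hmu0 : ∀ i, mu i ≠ 0 := fun i h => by simpa [h] using hmu i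
  have hA' : ∀ i, (ρ g⁻¹ : Module.End ℂ PA.pos) (bA i) = (lam i)⁻¹ • bA i := fun i => by
    rw [map_inv ρ]; exact inv_apply_eq_smul _ (hlam i) (hA i)
  have hB' : ∀ i, (ρ' g⁻¹ : Module.End ℂ PB.pos) (bB i) = (mu i)⁻¹ • bB i := fun i => by
    rw [map_inv ρ']; exact inv_apply_eq_smul _ (hmu0 i) (hB i)
  set FE := PE.frame PE.bpos
  set FA := PA.frame bA
  set FB := PB.frame bB
  set b := wBasis FE FA FB
  have hT : ∀ i, traceOp PE PA PB ρ ρ' g (b i)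
      = (-(stateWeight lam mu i + stateWeight (fun i => (lam i)⁻¹) (fun i => (mu i)⁻¹) i)) •
        b i := fun i => by
    have h1 := glAct_wBasis FE FA FB (ρ g) (ρ' g) lam mu hlam hmu0
      (fun i => congrArg Subtype.val (hA i)) (fun i => congrArg Subtype.val (hB i)) i
    have h2 := glAct_wBasis FE FA FB (ρ g⁻¹) (ρ' g⁻¹) (fun i => (lam i)⁻¹) (fun i => (mu i)⁻¹)
      (fun i => inv_ne_zero (hlam i)) (fun i => inv_ne_zero (hmu0 i))
      (fun i => congrArg Subtype.val (hA' i)) (fun i => congrArg Subtype.val (hB' i)) i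
    rw [traceOp, LinearMap.neg_apply, add_mul, add_mul, LinearMap.add_apply, h1, h2, ← add_smul,
      neg_smul]
  have hfib : (fun p : ℤ × ℕ => bigraded PE PA PB p.1 p.2) = fibre b biDeg :=
    funext fun p => bigraded_eq FE FA FB p.1 p.2
  have hinv : ∀ p, ∀ w ∈ fibre b biDeg p, traceOp PE PA PB ρ ρ' g w ∈ fibre b biDeg p :=
    diagonal_mem_fibre b hT biDeg
  -- The subspaces occur in the type of the restricted operator; the statement is generalized over
  -- `F` so that the equality can be eliminated rather than rewritten.
  have key : ∀ F : ℤ × ℕ → Submodule ℂ (Wtw PE PA PB), F = fibre b biDeg →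
      ∃ hinv : ∀ p, ∀ w ∈ F p, traceOp PE PA PB ρ ρ' g w ∈ F p, ∀ (c : ℤ × ℕ → ℂ) (a : ℂ),
        HasSum (fun i => (-(stateWeight lam mu i +
          stateWeight (fun i => (lam i)⁻¹) (fun i => (mu i)⁻¹) i)) * c (biDeg i)) a →
        HasSum (fun p => LinearMap.trace ℂ (F p)
          ((traceOp PE PA PB ρ ρ' g).restrict (hinv p)) * c p) a := by
    rintro _ rfl
    exact ⟨hinv, fun c a h => hasSum_trace_fibre b hT biDeg finite_biDeg_fibre hinv c a h⟩
  obtain ⟨hinv', h⟩ := key _ hfib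
  refine ⟨fun k n => hinv' (k, n), fun y q hy0 hy hyq => ?_⟩
  have hq : ‖q‖ < 1 := by
    rw [show q = y⁻¹ * (y * q) by rw [inv_mul_cancel_left₀ hy0], norm_mul]
    exact mul_lt_one_of_nonneg_of_lt_one_left (norm_nonneg _) hy hyq.le
  simp only [mul_assoc]
  refine h (fun p => y ^ p.1 * q ^ p.2) _ ?_
  have s1 := (hasSum_states hq (fun i => lam i * y ^ 2) (fun j => mu j * y)
    (fun j => by simpa [hmu] using hy) (fun j => by simpa [hmu] using hyq)).2.mul_left y
  have s2 := (hasSum_states hq (fun i => (lam i)⁻¹ * y ^ 2) (fun j => (mu j)⁻¹ * y)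
    (fun j => by simpa [hmu] using hy) (fun j => by simpa [hmu] using hyq)).2.mul_left y
  refine HasSum.congr_fun ((s1.add s2).neg) fun i => ?_
  have e1 := mul_stateTerm lam mu hy0 q i
  have e2 := mul_stateTerm (fun i => (lam i)⁻¹) (fun i => (mu i)⁻¹) hy0 q i
  rw [stateTerm] at e1 e2
  simp only [biDeg, e1, e2]
  ring

end Basis

/-! ### Elements of `SL₂(7)` -/

section SpecialLinear

open Matrix

/-- One step of the recursion for the coefficients of `M ^ n` as combination of `M` and `1`. -/
def powStep (t : ZMod 7) (c : ZMod 7 × ZMod 7) : ZMod 7 × ZMod 7 := (c.1 * t + c.2, -c.1)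

/-- Cayley–Hamilton with determinant one. Consequently the powers of `M` are governed by a recursion
that depends on the trace alone. -/
theorem mul_self_eq (M : SpecialLinearGroup (Fin 2) (ZMod 7)) :
    M.1 * M.1 = M.1.trace • M.1 - 1 := by
  have h := M.2
  rw [Matrix.det_fin_two] at h
  ext i j
  fin_cases i <;> fin_cases j <;>
    simp [Matrix.mul_apply, Fin.sum_univ_two, Matrix.trace_fin_two] <;> first | linear_combination -h | ring

theorem pow_eq_powStep (M : SpecialLinearGroup (Fin 2) (ZMod 7)) (n : ℕ) :
    M.1 ^ n = ((powStep M.1.trace)^[n] (0, 1)).1 • M.1 +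
      ((powStep M.1.trace)^[n] (0, 1)).2 • (1 : Matrix (Fin 2) (Fin 2) (ZMod 7)) := by
  induction n with
  | zero => simp
  | succ n ih =>
    rw [pow_succ, ih, Function.iterate_succ_apply', powStep, add_mul, smul_mul_assoc,
      smul_mul_assoc, one_mul, mul_self_eq]
    module

theorem pow_eq_one_of_powStep {M : SpecialLinearGroup (Fin 2) (ZMod 7)} {n : ℕ}
    (h : (powStep M.1.trace)^[n] (0, 1) = (0, 1)) : M ^ n = 1 := by
  refine Subtype.ext ?_
  have := pow_eq_powStep M n
  rw [h] at this
  simpa using this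

/-- Only seven traces need checking. The three cases reflect the unipotent elements up to sign, the
non-split torus of order `8` and the split torus of order `6`. -/
theorem orderOf_specialLinear (M : SpecialLinearGroup (Fin 2) (ZMod 7)) :
    orderOf M ∣ 14 ∨ orderOf M ∣ 8 ∨ orderOf M ∣ 6 := by
  have : ∀ t : ZMod 7, (powStep t)^[14] (0, 1) = (0, 1) ∨ (powStep t)^[8] (0, 1) = (0, 1) ∨
      (powStep t)^[6] (0, 1) = (0, 1) := by decide
  exact (this M.1.trace).imp (fun h => orderOf_dvd_of_pow_eq_one (pow_eq_one_of_powStep h))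
    (Or.imp (fun h => orderOf_dvd_of_pow_eq_one (pow_eq_one_of_powStep h))
      fun h => orderOf_dvd_of_pow_eq_one (pow_eq_one_of_powStep h))

/-- Combined with Cayley–Hamilton, `M² = 1` says that `t M` is scalar with `t ≠ 0`, so `M` itself is
scalar, and of determinant one. -/
theorem coe_eq_neg_one_of_orderOf_eq_two {M : SpecialLinearGroup (Fin 2) (ZMod 7)}
    (hM : orderOf M = 2) : M.1 = -1 := by
  have h2 : (0 - 1 : ZMod 7) ≠ 1 := by decide
  have : Fact (Nat.Prime 7) := ⟨by norm_num⟩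
  have h1 : M.1 * M.1 = 1 := by
    rw [← sq]
    exact congrArg Subtype.val (hM ▸ pow_orderOf_eq_one M)
  have hd := M.2
  rw [Matrix.det_fin_two] at hd
  rw [mul_self_eq] at h1
  set t := M.1.trace
  have h00 := congrFun (congrFun h1 0) 0
  have h01 := congrFun (congrFun h1 0) 1
  have h10 := congrFun (congrFun h1 1) 0
  have h11 := congrFun (congrFun h1 1) 1
  simp only [Matrix.sub_apply, Matrix.smul_apply, smul_eq_mul, Matrix.one_apply_eq] at h00 h11
  simp [Matrix.sub_apply] at h01 h10
  have ht : t ≠ 0 := by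
    intro ht
    rw [ht, zero_mul] at h00
    exact h2 h00
  replace h01 := h01.resolve_left ht
  replace h10 := h10.resolve_left ht
  have h : M.1 1 1 = M.1 0 0 := mul_left_cancel₀ ht (by linear_combination h11 - h00)
  rw [h01, zero_mul, sub_zero, h] at hd
  rcases mul_self_eq_one_iff.1 hd with h' | h'
  · exfalso
    have : M = 1 := by
      ext i j
      fin_cases i <;> fin_cases j <;> simp [h, h', h01, h10]
    rw [this, orderOf_one] at hM
    norm_num at hM
  · ext i j
    fin_cases i <;> fin_cases j <;> simp [h, h', h01, h10]

theorem exists_pow_four_eq_specialLinear {M : SpecialLinearGroup (Fin 2) (ZMod 7)}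
    (hM : orderOf M = 2) : ∃ N : SpecialLinearGroup (Fin 2) (ZMod 7), N ^ 4 = M := by
  -- The companion matrix of `x² - 3x + 1`; modulo `7` this polynomial divides `x⁴ + 1`.
  refine ⟨⟨!![0, -1; 1, 3], by simp [Matrix.det_fin_two]⟩, Subtype.ext ?_⟩
  rw [coe_eq_neg_one_of_orderOf_eq_two hM]
  change !![0, -1; 1, 3] ^ 4 = (-1 : Matrix (Fin 2) (Fin 2) (ZMod 7))
  decide

/-- Here `M² = -1`, so `(1 + M)² = 2M`, and `5² = 4` is the inverse of `2` modulo `7`. The root `5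
(1 + M)` has determinant one because `M` has trace zero. -/
theorem exists_sq_eq_specialLinear {M : SpecialLinearGroup (Fin 2) (ZMod 7)}
    (hM : orderOf M = 4) : ∃ N : SpecialLinearGroup (Fin 2) (ZMod 7), N ^ 2 = M := by
  have h7 : (7 : ZMod 7) = 0 := by decide
  have h4 : (5 * 5 : ZMod 7) = 4 := by decide
  have h8 : (4 * 2 : ZMod 7) = 1 := by decide
  have : Fact (Nat.Prime 7) := ⟨by norm_num⟩
  have h1 : (M ^ 2).1 = -1 := coe_eq_neg_one_of_orderOf_eq_two (by
    rw [orderOf_pow, hM]; rfl)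
  have h2 : M.1 * M.1 = -1 := by rw [← h1, sq]; rfl
  have hd := M.2
  have h3 := mul_self_eq M
  have ht : M.1.trace • M.1 = 0 := by
    rw [h2] at h3
    have h5 := congrArg (· + 1) h3
    simpa only [neg_add_cancel, sub_add_cancel] using h5.symm
  have ht0 : M.1.trace = 0 := by
    by_contra h
    rw [smul_eq_zero_iff_right h] at ht
    rw [ht] at hd
    simp at hd
  rw [Matrix.det_fin_two] at hd
  rw [Matrix.trace_fin_two] at ht0
  refine ⟨⟨(5 : ZMod 7) • (M.1 + 1), ?_⟩, Subtype.ext ?_⟩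
  · rw [Matrix.det_fin_two]
    simp
    linear_combination 25 * hd + 25 * ht0 + 7 * h7
  · change ((5 : ZMod 7) • (M.1 + 1)) ^ 2 = M.1
    rw [sq, smul_mul_smul_comm, add_mul, mul_add, mul_add, h2, one_mul, mul_one, mul_one]
    rw [h4]
    have : (4 : ZMod 7) • (-1 + M.1 + (M.1 + 1)) = (4 * 2 : ZMod 7) • M.1 := by module
    rw [this, h8, one_smul]

end SpecialLinear

section Group

variable {G : Type*} [Group G] (e : G ≃* Matrix.SpecialLinearGroup (Fin 2) (ZMod 7))

include e

theorem orderOf_cases (g : G) : orderOf g = 1 ∨ orderOf g = 2 ∨ orderOf g = 4 ∨ orderOf g = 3 ∨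
    orderOf g = 6 ∨ orderOf g = 8 ∨ orderOf g = 7 ∨ orderOf g = 14 := by
  rw [← e.orderOf_eq]
  rcases orderOf_specialLinear (e g) with h | h | h
  · have : orderOf (e g) ∈ Nat.divisors 14 := Nat.mem_divisors.2 ⟨h, by norm_num⟩
    rw [show Nat.divisors 14 = {1, 2, 7, 14} by decide] at this
    simp only [Finset.mem_insert, Finset.mem_singleton] at this; omega
  · have : orderOf (e g) ∈ Nat.divisors 8 := Nat.mem_divisors.2 ⟨h, by norm_num⟩
    rw [show Nat.divisors 8 = {1, 2, 4, 8} by decide] at this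
    simp only [Finset.mem_insert, Finset.mem_singleton] at this; omega
  · have : orderOf (e g) ∈ Nat.divisors 6 := Nat.mem_divisors.2 ⟨h, by norm_num⟩
    rw [show Nat.divisors 6 = {1, 2, 3, 6} by decide] at this
    simp only [Finset.mem_insert, Finset.mem_singleton] at this; omega

theorem exists_pow_four_eq {g : G} (hg : orderOf g = 2) : ∃ h : G, h ^ 4 = g := by
  rw [← e.orderOf_eq] at hg
  obtain ⟨N, hN⟩ := exists_pow_four_eq_specialLinear hg
  exact ⟨e.symm N, by rw [← map_pow, hN, e.symm_apply_apply]⟩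

theorem exists_sq_eq {g : G} (hg : orderOf g = 4) : ∃ h : G, h ^ 2 = g := by
  rw [← e.orderOf_eq] at hg
  obtain ⟨N, hN⟩ := exists_sq_eq_specialLinear hg
  exact ⟨e.symm N, by rw [← map_pow, hN, e.symm_apply_apply]⟩

end Group

/-! ### Eigenbases of elements of finite order -/

/-- `X^N - 1` is separable, so an operator of finite order is semisimple; bases of its eigenspaces
are collected and reindexed by the given index set. -/
theorem exists_eigenbasis {V : Type*} [AddCommGroup V] [Module ℂ V] {r : ℕ}
    (b₀ : Module.Basis (Fin r) ℂ V) {f : Module.End ℂ V} {N : ℕ} (hN : N ≠ 0) (hf : f ^ N = 1) :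
    ∃ (b : Module.Basis (Fin r) ℂ V) (a : Fin r → ℂ), ∀ i, f (b i) = a i • b i := by
  have : FiniteDimensional ℂ V := b₀.finiteDimensional_of_finite
  have hs : f.IsSemisimple := by
    refine Module.End.isSemisimple_of_squarefree_aeval_eq_zero
      (p := Polynomial.X ^ N - 1) ?_ (by simp [hf])
    exact (Polynomial.separable_X_pow_sub_C (1 : ℂ) (by exact_mod_cast hN) one_ne_zero).squarefree
  have hi : DirectSum.IsInternal f.eigenspace :=
    DirectSum.isInternal_submodule_of_iSupIndep_of_iSup_eq_top f.eigenspaces_iSupIndep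
      hs.iSup_eigenspace_eq_top
  set b := hi.collectedBasis fun μ => Module.finBasis ℂ (f.eigenspace μ)
  refine ⟨b.reindex (b.indexEquiv b₀), fun i => ((b.indexEquiv b₀).symm i).1, fun i => ?_⟩
  rw [b.reindex_apply]
  exact Module.End.mem_eigenspace_iff.1 (hi.collectedBasis_mem _ _)

theorem trace_of_eigenbasis {V I : Type*} [AddCommGroup V] [Module ℂ V] [Fintype I]
    (b : Module.Basis I ℂ V) {f : Module.End ℂ V} {a : I → ℂ} (h : ∀ i, f (b i) = a i • b i) :
    LinearMap.trace ℂ V f = ∑ i, a i := by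
  classical
  rw [LinearMap.trace_eq_matrix_trace ℂ b, Matrix.trace]
  refine Finset.sum_congr rfl fun i _ => ?_
  rw [Matrix.diag_apply, LinearMap.toMatrix_apply, h]
  simp

/-- An eigenbasis of an element of finite order in a representation with a given character. -/
theorem exists_eigenvalues {G V : Type*} [Group G] [AddCommGroup V] [Module ℂ V] {r : ℕ}
    (b₀ : Module.Basis (Fin r) ℂ V) (ρ : G →* LinearMap.GeneralLinearGroup ℂ V) (χ : G → ℂ)
    (hχ : ∀ g, LinearMap.trace ℂ V (ρ g) = χ g) (g : G) {N : ℕ} (hg : orderOf g = N) (hN : N ≠ 0) :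
    ∃ (b : Module.Basis (Fin r) ℂ V) (a : Fin r → ℂ),
      (∀ i, (ρ g : Module.End ℂ V) (b i) = a i • b i) ∧ (∀ i, a i ^ N = 1) ∧ (∀ i, ‖a i‖ = 1) ∧
      (∀ k : ℕ, ∑ i, a i ^ k = χ (g ^ k)) := by
  have hp : ∀ k : ℕ, ((ρ (g ^ k) : LinearMap.GeneralLinearGroup ℂ V) : Module.End ℂ V)
      = (ρ g : Module.End ℂ V) ^ k := fun k => by rw [map_pow]; rfl
  have h1 : (ρ g : Module.End ℂ V) ^ N = 1 := by
    rw [← hp, ← hg, pow_orderOf_eq_one, map_one]; rfl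
  obtain ⟨b, a, h⟩ := exists_eigenbasis b₀ hN h1
  have hk : ∀ (k : ℕ) i, ((ρ g : Module.End ℂ V) ^ k) (b i) = a i ^ k • b i := fun k i => by
    induction k with
    | zero => simp
    | succ k ih => rw [pow_succ', Module.End.mul_apply, ih, map_smul, h, smul_smul, ← pow_succ]
  have ha : ∀ i, a i ^ N = 1 := fun i => by
    have := hk N i
    rw [h1, Module.End.one_apply] at this
    have h2 : (a i ^ N - 1) • b i = 0 := by rw [sub_smul, ← this, one_smul, sub_self]
    exact sub_eq_zero.1 ((smul_eq_zero.1 h2).resolve_right (b.ne_zero i))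
  refine ⟨b, a, h, ha, fun i => Complex.norm_eq_one_of_pow_eq_one (ha i) hN, fun k => ?_⟩
  rw [← hχ, hp, trace_of_eigenbasis b (hk k)]

/-! ### Product expansions of the Jacobi forms -/

theorem expTwoPiI_add (x y : ℂ) : expTwoPiI (x + y) = expTwoPiI x * expTwoPiI y := by
  rw [expTwoPiI, expTwoPiI, expTwoPiI, ← Complex.exp_add, mul_add]

theorem expTwoPiI_natCast_mul (n : ℕ) (x : ℂ) : expTwoPiI (n * x) = expTwoPiI x ^ n := by
  rw [expTwoPiI, expTwoPiI, ← Complex.exp_nat_mul]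
  ring_nf

theorem expTwoPiI_neg (x : ℂ) : expTwoPiI (-x) = (expTwoPiI x)⁻¹ := by
  rw [expTwoPiI, expTwoPiI, ← Complex.exp_neg, mul_neg]

theorem expTwoPiI_ne_zero (x : ℂ) : expTwoPiI x ≠ 0 := Complex.exp_ne_zero _

theorem norm_expTwoPiI (x : ℂ) : ‖expTwoPiI x‖ = Real.exp (-(2 * Real.pi * x.im)) := by
  rw [expTwoPiI, Complex.norm_exp]
  simp

section Expansion

variable {τ z s r x q : ℂ}

/-- Taking a `24`-th root of `q` and a square root of `y` as variables makes all fractional powers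
integral, so that prefactors can be cancelled by pure field arithmetic. -/
theorem theta1_eq_thetaProd (hs : expTwoPiI (τ / 24) = s) (hr : expTwoPiI (z / 2) = r)
    (hx : r ^ 2 = x) (hq : s ^ 24 = q) (h : ‖q‖ < 1) :
    theta1 τ z = -Complex.I * s ^ 3 * r * (thetaProd x q * eulerProd q) := by
  have e1 : expTwoPiI τ = q := by
    rw [← hq, ← hs, ← expTwoPiI_natCast_mul]; congr 1; push_cast; ring
  have e2 : expTwoPiI z = x := by
    rw [← hx, ← hr, ← expTwoPiI_natCast_mul]; congr 1; push_cast; ring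
  have e3 : expTwoPiI (τ / 8) = s ^ 3 := by
    rw [← hs, ← expTwoPiI_natCast_mul]; congr 1; push_cast; ring
  rw [theta1, e1, e2, e3, hr, thetaProd, eulerProd,
    ← (multipliable_thetaProd h x).tprod_mul (multipliable_eulerProd h)]

theorem theta2_eq_thetaProd (hs : expTwoPiI (τ / 24) = s) (hr : expTwoPiI (z / 2) = r)
    (hx : r ^ 2 = x) (hq : s ^ 24 = q) (h : ‖q‖ < 1) :
    theta2 τ z = s ^ 3 * r * (thetaProd (-x) q * eulerProd q) := by
  have e1 : expTwoPiI τ = q := by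
    rw [← hq, ← hs, ← expTwoPiI_natCast_mul]; congr 1; push_cast; ring
  have e2 : expTwoPiI z = x := by
    rw [← hx, ← hr, ← expTwoPiI_natCast_mul]; congr 1; push_cast; ring
  have e3 : expTwoPiI (τ / 8) = s ^ 3 := by
    rw [← hs, ← expTwoPiI_natCast_mul]; congr 1; push_cast; ring
  rw [theta2, e1, e2, e3, hr, thetaProd, eulerProd,
    ← (multipliable_thetaProd h (-x)).tprod_mul (multipliable_eulerProd h)]
  simp only [inv_neg, neg_mul, sub_neg_eq_add]

theorem eta_eq_eulerProd (hs : expTwoPiI (τ / 24) = s) (hq : s ^ 24 = q) :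
    ModularForm.eta τ = s * eulerProd q := by
  have e1 : expTwoPiI τ = q := by
    rw [← hq, ← hs, ← expTwoPiI_natCast_mul]; congr 1; push_cast; ring
  rw [ModularForm.eta, eulerProd, ← e1, ← hs]
  congr 1
  · rw [Function.Periodic.qParam, expTwoPiI]
    congr 1
    push_cast
    ring
  · exact tprod_congr fun n => by rw [ModularForm.eta_q_eq_pow, expTwoPiI]

end Expansion

/-! ### Product formulas for the individual Jacobi forms -/

section Values

variable {τ z a c y q : ℂ} (ha : expTwoPiI (τ / 24) = a) (hc : expTwoPiI (z / 2) = c)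
  (hy : c ^ 2 = y) (hq : a ^ 24 = q)

include ha in
theorem expTwoPiI_mul_div (d : ℕ) : expTwoPiI (d * τ / 24) = a ^ d := by
  rw [mul_div_assoc, expTwoPiI_natCast_mul, ha]

theorem norm_pow_lt_one_of_norm_lt_one {x : ℂ} (hx : ‖x‖ < 1) {d : ℕ} (hd : d ≠ 0) : ‖x ^ d‖ < 1 := by
  rw [norm_pow]
  exact pow_lt_one₀ (norm_nonneg _) hx hd

include ha hc hy hq in
theorem theta1_mul_mul (h : ‖q‖ < 1) (d m : ℕ) (hd : d ≠ 0) : theta1 (d * τ) (m * z)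
    = -Complex.I * (a ^ d) ^ 3 * c ^ m * (thetaProd (y ^ m) (q ^ d) * eulerProd (q ^ d)) :=
  theta1_eq_thetaProd (expTwoPiI_mul_div ha d) (by rw [mul_div_assoc, expTwoPiI_natCast_mul, hc])
    (by rw [← hy]; ring) (by rw [← hq]; ring) (norm_pow_lt_one_of_norm_lt_one h hd)

include ha hc hy hq in
theorem theta2_mul_mul (h : ‖q‖ < 1) (d m : ℕ) (hd : d ≠ 0) : theta2 (d * τ) (m * z)
    = (a ^ d) ^ 3 * c ^ m * (thetaProd (-(y ^ m)) (q ^ d) * eulerProd (q ^ d)) :=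
  theta2_eq_thetaProd (expTwoPiI_mul_div ha d) (by rw [mul_div_assoc, expTwoPiI_natCast_mul, hc])
    (by rw [← hy]; ring) (by rw [← hq]; ring) (norm_pow_lt_one_of_norm_lt_one h hd)

include ha hq in
theorem eta_mul (d : ℕ) : ModularForm.eta (d * τ) = a ^ d * eulerProd (q ^ d) :=
  eta_eq_eulerProd (expTwoPiI_mul_div ha d) (by rw [← hq]; ring)

theorem thetaProd_pow_ne_zero {y : ℂ} (h1 : ‖y⁻¹‖ < 1) (h2 : ‖y * q‖ < 1) (h : ‖q‖ < 1) {d : ℕ}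
    (hd : d ≠ 0) : thetaProd (y ^ d) (q ^ d) ≠ 0 :=
  thetaProd_ne_zero (norm_pow_lt_one_of_norm_lt_one h hd) (by rw [← inv_pow]; exact norm_pow_lt_one_of_norm_lt_one h1 hd)
    (by rw [← mul_pow]; exact norm_pow_lt_one_of_norm_lt_one h2 hd)

theorem thetaProd_neg_pow_ne_zero {y : ℂ} (h1 : ‖y⁻¹‖ < 1) (h2 : ‖y * q‖ < 1) (h : ‖q‖ < 1) {d : ℕ}
    (hd : d ≠ 0) : thetaProd (-y ^ d) (q ^ d) ≠ 0 :=
  thetaProd_ne_zero (norm_pow_lt_one_of_norm_lt_one h hd)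
    (by rw [inv_neg, norm_neg, ← inv_pow]; exact norm_pow_lt_one_of_norm_lt_one h1 hd)
    (by rw [neg_mul, norm_neg, ← mul_pow]; exact norm_pow_lt_one_of_norm_lt_one h2 hd)

variable (h : ‖q‖ < 1) (h1 : ‖y⁻¹‖ < 1) (h2 : ‖y * q‖ < 1)

include ha hc hy hq h h1 h2

/-- In this and the analogous formulas the powers of `a` cancel and those of `c` leave `c² = y`; two
Euler products survive. The annulus hypotheses are needed only for the nonvanishing of the
denominators. -/
theorem psi1A_eq : psi1A τ z = -2 * (y * (eulerProd q ^ 2 *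
    (thetaProd (y ^ 2) q ^ 3 * (thetaProd y q ^ 4)⁻¹))) := by
  have t1 := theta1_mul_mul ha hc hy hq h 1 1 (by norm_num)
  have t2 := theta1_mul_mul ha hc hy hq h 1 2 (by norm_num)
  have t3 := eta_mul ha hq 1
  have n4 := thetaProd_pow_ne_zero h1 h2 h (d := 1) (by norm_num)
  have t5 := eulerProd_ne_zero (norm_pow_lt_one_of_norm_lt_one h (d := 1) (by norm_num))
  simp only [Nat.cast_one, one_mul, pow_one, Nat.cast_ofNat] at t1 t2 t3 n4 t5
  have a0 : a ≠ 0 := ha ▸ expTwoPiI_ne_zero _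
  have c0 : c ≠ 0 := hc ▸ expTwoPiI_ne_zero _
  subst hy
  rw [psi1A, t1, t2, t3]
  field_simp

theorem psi2A_eq : psi2A τ z = -2 * (y * (eulerProd q ^ 2 *
    (thetaProd (y ^ 2) q ^ 3 * (thetaProd (-y) q ^ 4)⁻¹))) := by
  have t1 := theta2_mul_mul ha hc hy hq h 1 1 (by norm_num)
  have t2 := theta1_mul_mul ha hc hy hq h 1 2 (by norm_num)
  have t3 := eta_mul ha hq 1
  have n4 := thetaProd_neg_pow_ne_zero h1 h2 h (d := 1) (by norm_num)
  have t5 := eulerProd_ne_zero (norm_pow_lt_one_of_norm_lt_one h (d := 1) (by norm_num))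
  simp only [Nat.cast_one, one_mul, pow_one, Nat.cast_ofNat] at t1 t2 t3 n4 t5
  have a0 : a ≠ 0 := ha ▸ expTwoPiI_ne_zero _
  have c0 : c ≠ 0 := hc ▸ expTwoPiI_ne_zero _
  subst hy
  rw [psi2A, t1, t2, t3]
  field_simp
  rw [Complex.I_pow_four, one_mul]

theorem psi4A_eq : psi4A τ z = -2 * (y * (eulerProd q ^ 2 *
    (thetaProd (y ^ 2) q * thetaProd (-y ^ 2) q ^ 2 * (thetaProd (-y ^ 2) (q ^ 2) ^ 2)⁻¹))) := by
  have t1 := theta1_mul_mul ha hc hy hq h 1 2 (by norm_num)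
  have t2 := theta2_mul_mul ha hc hy hq h 1 2 (by norm_num)
  have t3 := theta2_mul_mul ha hc hy hq h 2 2 (by norm_num)
  have t4 := eta_mul ha hq 1
  have t5 := eta_mul ha hq 2
  have n6 := thetaProd_neg_pow_ne_zero h1 h2 h (d := 2) (by norm_num)
  have t7 := eulerProd_ne_zero (norm_pow_lt_one_of_norm_lt_one h (d := 1) (by norm_num))
  have t8 := eulerProd_ne_zero (norm_pow_lt_one_of_norm_lt_one h (d := 2) (by norm_num))
  simp only [Nat.cast_one, one_mul, pow_one, Nat.cast_ofNat] at t1 t2 t3 t4 t5 n6 t7 t8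
  have a0 : a ≠ 0 := ha ▸ expTwoPiI_ne_zero _
  have c0 : c ≠ 0 := hc ▸ expTwoPiI_ne_zero _
  subst hy
  rw [psi4A, t1, t2, t3, t4, t5]
  field_simp
  rw [Complex.I_sq]
  ring

theorem psi3A_eq : psi3A τ z = -2 * (y * (eulerProd q ^ 2 *
    (thetaProd (y ^ 6) (q ^ 3) * (thetaProd y q * thetaProd (y ^ 3) (q ^ 3))⁻¹))) := by
  have t1 := theta1_mul_mul ha hc hy hq h 1 1 (by norm_num)
  have t2 := theta1_mul_mul ha hc hy hq h 3 6 (by norm_num)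
  have t3 := theta1_mul_mul ha hc hy hq h 3 3 (by norm_num)
  have t4 := eta_mul ha hq 1
  have n5 := thetaProd_pow_ne_zero h1 h2 h (d := 1) (by norm_num)
  have n6 := thetaProd_pow_ne_zero h1 h2 h (d := 3) (by norm_num)
  have t7 := eulerProd_ne_zero (norm_pow_lt_one_of_norm_lt_one h (d := 1) (by norm_num))
  have t8 := eulerProd_ne_zero (norm_pow_lt_one_of_norm_lt_one h (d := 3) (by norm_num))
  simp only [Nat.cast_one, one_mul, pow_one, Nat.cast_ofNat] at t1 t2 t3 t4 n5 n6 t7 t8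
  have a0 : a ≠ 0 := ha ▸ expTwoPiI_ne_zero _
  have c0 : c ≠ 0 := hc ▸ expTwoPiI_ne_zero _
  subst hy
  rw [psi3A, t1, t2, t3, t4]
  field_simp

theorem psi6A_eq : psi6A τ z = -2 * (y * (eulerProd q ^ 2 *
    (thetaProd (y ^ 6) (q ^ 3) * (thetaProd (-y) q * thetaProd (-y ^ 3) (q ^ 3))⁻¹))) := by
  have t1 := theta2_mul_mul ha hc hy hq h 1 1 (by norm_num)
  have t2 := theta1_mul_mul ha hc hy hq h 3 6 (by norm_num)
  have t3 := theta2_mul_mul ha hc hy hq h 3 3 (by norm_num)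
  have t4 := eta_mul ha hq 1
  have n5 := thetaProd_neg_pow_ne_zero h1 h2 h (d := 1) (by norm_num)
  have n6 := thetaProd_neg_pow_ne_zero h1 h2 h (d := 3) (by norm_num)
  have t7 := eulerProd_ne_zero (norm_pow_lt_one_of_norm_lt_one h (d := 1) (by norm_num))
  have t8 := eulerProd_ne_zero (norm_pow_lt_one_of_norm_lt_one h (d := 3) (by norm_num))
  simp only [Nat.cast_one, one_mul, pow_one, Nat.cast_ofNat] at t1 t2 t3 t4 n5 n6 t7 t8
  have a0 : a ≠ 0 := ha ▸ expTwoPiI_ne_zero _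
  have c0 : c ≠ 0 := hc ▸ expTwoPiI_ne_zero _
  subst hy
  rw [psi6A, t1, t2, t3, t4]
  field_simp
  rw [Complex.I_sq]
  ring

theorem psi8A_eq : psi8A τ z = -2 * (y * (eulerProd q ^ 2 *
    (thetaProd (y ^ 2) q * thetaProd (-y ^ 4) (q ^ 2) * (thetaProd (-y ^ 4) (q ^ 4))⁻¹))) := by
  have t1 := theta1_mul_mul ha hc hy hq h 1 2 (by norm_num)
  have t2 := theta2_mul_mul ha hc hy hq h 2 4 (by norm_num)
  have t3 := theta2_mul_mul ha hc hy hq h 4 4 (by norm_num)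
  have t4 := eta_mul ha hq 1
  have t5 := eta_mul ha hq 2
  have t6 := eta_mul ha hq 4
  have n7 := thetaProd_neg_pow_ne_zero h1 h2 h (d := 4) (by norm_num)
  have t8 := eulerProd_ne_zero (norm_pow_lt_one_of_norm_lt_one h (d := 1) (by norm_num))
  have t9 := eulerProd_ne_zero (norm_pow_lt_one_of_norm_lt_one h (d := 2) (by norm_num))
  have t10 := eulerProd_ne_zero (norm_pow_lt_one_of_norm_lt_one h (d := 4) (by norm_num))
  simp only [Nat.cast_one, one_mul, pow_one, Nat.cast_ofNat] at t1 t2 t3 t4 t5 t6 n7 t8 t9 t10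
  have a0 : a ≠ 0 := ha ▸ expTwoPiI_ne_zero _
  have c0 : c ≠ 0 := hc ▸ expTwoPiI_ne_zero _
  subst hy
  rw [psi8A, t1, t2, t3, t4, t5, t6]
  field_simp
  rw [Complex.I_sq]
  ring

-- The root `w = e(1/14)` plays for the shift by `k/7` the role of `c` for `z`: its square is the
-- seventh root of unity in the argument of the product.
omit h1 h2 in
theorem theta1_shift {w : ℂ} (hw : expTwoPiI (1 / 14) = w) (m k : ℕ) :
    theta1 τ (m * z + k / 7) = -Complex.I * a ^ 3 * (c ^ m * w ^ k) *
      (thetaProd ((w ^ 2) ^ k * y ^ m) q * eulerProd q) := by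
  refine theta1_eq_thetaProd ha ?_ (by rw [← hy]; ring) hq h
  rw [← hc, ← hw, ← expTwoPiI_natCast_mul, ← expTwoPiI_natCast_mul, ← expTwoPiI_add]
  congr 1
  ring

omit h1 h2 in
theorem theta1_shift_neg {w : ℂ} (hw : expTwoPiI (1 / 14) = w) (m k : ℕ) :
    theta1 τ (m * z - k / 7) = -Complex.I * a ^ 3 * (c ^ m * (w ^ k)⁻¹) *
      (thetaProd (((w ^ 2) ^ k)⁻¹ * y ^ m) q * eulerProd q) := by
  refine theta1_eq_thetaProd ha ?_ (by rw [← hy, mul_pow, inv_pow]; ring) hq h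
  rw [← hc, ← hw, ← expTwoPiI_natCast_mul, ← expTwoPiI_natCast_mul, ← expTwoPiI_neg,
    ← expTwoPiI_add]
  congr 1
  ring

omit h1 h2 in
theorem theta2_shift {w : ℂ} (hw : expTwoPiI (1 / 14) = w) (m k : ℕ) :
    theta2 τ (m * z + k / 7) = a ^ 3 * (c ^ m * w ^ k) *
      (thetaProd (-((w ^ 2) ^ k * y ^ m)) q * eulerProd q) := by
  refine theta2_eq_thetaProd ha ?_ (by rw [← hy]; ring) hq h
  rw [← hc, ← hw, ← expTwoPiI_natCast_mul, ← expTwoPiI_natCast_mul, ← expTwoPiI_add]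
  congr 1
  ring

omit h1 h2 in
theorem theta2_shift_neg {w : ℂ} (hw : expTwoPiI (1 / 14) = w) (m k : ℕ) :
    theta2 τ (m * z - k / 7) = a ^ 3 * (c ^ m * (w ^ k)⁻¹) *
      (thetaProd (-(((w ^ 2) ^ k)⁻¹ * y ^ m)) q * eulerProd q) := by
  refine theta2_eq_thetaProd ha ?_ (by rw [← hy, mul_pow, inv_pow]; ring) hq h
  rw [← hc, ← hw, ← expTwoPiI_natCast_mul, ← expTwoPiI_natCast_mul, ← expTwoPiI_neg,
    ← expTwoPiI_add]
  congr 1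
  ring

end Values

/-! ### Seventh roots of unity -/

section Seven

variable {ζ : ℂ} (hζ : IsPrimitiveRoot ζ 7)

include hζ

-- The cyclotomic polynomial of degree `6` divides the difference of the two exponent polynomials,
-- which has degree at most `6`, so the quotient is constant. Both sums have `r` terms, so the
-- difference vanishes at `1`, where the cyclotomic polynomial is `7`; the constant is therefore
-- zero.
open Polynomial in
theorem map_val_eq_of_sum_pow_eq {r : ℕ} {k k' : Fin r → ℕ} (hk : ∀ i, k i < 7)
    (hk' : ∀ i, k' i < 7) (h : ∑ i, ζ ^ k i = ∑ i, ζ ^ k' i) :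
    Finset.univ.val.map k = Finset.univ.val.map k' := by
  set p : ℚ[X] := ∑ i, X ^ k i - ∑ i, X ^ k' i with hp
  have h0 : aeval ζ p = 0 := by simp [hp, h]
  have h1 : p.natDegree ≤ 6 := by
    refine (natDegree_sub_le _ _).trans (max_le ?_ ?_) <;>
      refine natDegree_sum_le_of_forall_le _ _ fun i _ => ?_ <;> rw [natDegree_X_pow]
    · exact Nat.le_of_lt_succ (hk i)
    · exact Nat.le_of_lt_succ (hk' i)
  have hΦ : cyclotomic 7 ℚ ∣ p := by
    rw [cyclotomic_eq_minpoly_rat hζ (by norm_num)]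
    exact minpoly.dvd ℚ ζ h0
  have hp0 : p = 0 := by
    obtain ⟨Q, hQ⟩ := hΦ
    by_contra hne
    have hQ0 : Q ≠ 0 := by rintro rfl; exact hne (by rw [hQ, mul_zero])
    have hdeg : p.natDegree = 6 + Q.natDegree := by
      rw [hQ, natDegree_mul (cyclotomic_ne_zero 7 ℚ) hQ0, natDegree_cyclotomic]
      rfl
    obtain ⟨c, rfl⟩ := natDegree_eq_zero.1 (show Q.natDegree = 0 by omega)
    have : Fact (Nat.Prime 7) := ⟨by norm_num⟩
    have he := congrArg (eval 1) hQ
    rw [eval_mul, eval_one_cyclotomic_prime, eval_C] at he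
    simp [hp, eval_finsetSum] at he
    exact hQ0 (by rw [he, C_0])
  rw [hp, sub_eq_zero] at hp0
  ext n
  have := congrArg (fun P : ℚ[X] => P.coeff n) hp0
  simp only [finsetSum_coeff, coeff_X_pow, Finset.sum_boole] at this
  rw [Multiset.count_map, Multiset.count_map]
  exact_mod_cast this

theorem prod_comp_eq_of_sum_eq {r : ℕ} {x x' : Fin r → ℂ} (hx : ∀ i, x i ^ 7 = 1)
    (hx' : ∀ i, x' i ^ 7 = 1) (h : ∑ i, x i = ∑ i, x' i) (f : ℂ → ℂ) :
    ∏ i, f (x i) = ∏ i, f (x' i) := by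
  choose k hk hkx using fun i => hζ.eq_pow_of_pow_eq_one (hx i)
  choose k' hk' hkx' using fun i => hζ.eq_pow_of_pow_eq_one (hx' i)
  obtain rfl : (fun i => ζ ^ k i) = x := funext hkx
  obtain rfl : (fun i => ζ ^ k' i) = x' := funext hkx'
  have := congrArg (fun m : Multiset ℕ => (m.map fun n => f (ζ ^ n)).prod)
    (map_val_eq_of_sum_pow_eq hζ hk hk' h)
  rw [Multiset.map_map, Multiset.map_map] at this
  exact this

theorem sum_pow_seven : 1 + ζ + ζ ^ 2 + ζ ^ 3 + ζ ^ 4 + ζ ^ 5 + ζ ^ 6 = 0 := by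
  have := hζ.geom_sum_eq_zero (by norm_num)
  simpa [Finset.sum_range_succ] using this

theorem inv_eq_pow_six : ζ⁻¹ = ζ ^ 6 ∧ (ζ ^ 2)⁻¹ = ζ ^ 5 ∧ (ζ ^ 4)⁻¹ = ζ ^ 3 := by
  have h7 := hζ.pow_eq_one
  refine ⟨inv_eq_of_mul_eq_one_right ?_, inv_eq_of_mul_eq_one_right ?_,
    inv_eq_of_mul_eq_one_right ?_⟩ <;> rw [← h7] <;> ring

/-- Both `b7` and its conjugate are roots of `x² + x + 2`, whose roots are also the Gauss periods `ζ
+ ζ² + ζ⁴` and its inverse counterpart. Hence `s` is one of the periods, and a sum of seventh roots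
of unity of fixed length determines its terms. Deciding which period is `b7` is unnecessary. -/
theorem prod_comp_of_sum_eq_b7 {lam : Fin 3 → ℂ} {mu : Fin 4 → ℂ} (hlam : ∀ i, lam i ^ 7 = 1)
    (hmu : ∀ i, mu i ^ 7 = 1) {s : ℂ} (hs : s = b7 ∨ s = star b7) (h1 : ∑ i, lam i = s)
    (h2 : ∑ i, mu i = 1 + s) :
    (∀ f : ℂ → ℂ, ∏ i, f (lam i) = f ζ * f (ζ ^ 2) * f (ζ ^ 4) ∧
      ∏ i, f (mu i) = f 1 * f ζ * f (ζ ^ 2) * f (ζ ^ 4)) ∨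
    (∀ f : ℂ → ℂ, ∏ i, f (lam i) = f ζ⁻¹ * f (ζ ^ 2)⁻¹ * f (ζ ^ 4)⁻¹ ∧
      ∏ i, f (mu i) = f 1 * f ζ⁻¹ * f (ζ ^ 2)⁻¹ * f (ζ ^ 4)⁻¹) := by
  have h7 := hζ.pow_eq_one
  have hg := sum_pow_seven hζ
  obtain ⟨i1, i2, i4⟩ := inv_eq_pow_six hζ
  have hb : s ^ 2 + s + 2 = 0 := by
    have hr : ((Real.sqrt 7 : ℝ) : ℂ) ^ 2 = 7 := by
      rw [← Complex.ofReal_pow, Real.sq_sqrt (by norm_num)]; norm_num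
    rcases hs with rfl | rfl
    · rw [b7]
      linear_combination (1 / 4) * Complex.I ^ 2 * hr + (7 / 4) * Complex.I_sq
    · have : star b7 = (-1 - Complex.I * (Real.sqrt 7 : ℂ)) / 2 := by
        simp [b7, sub_eq_add_neg]
      rw [this]
      linear_combination (1 / 4) * Complex.I ^ 2 * hr + (7 / 4) * Complex.I_sq
  have hS : (s - (ζ + ζ ^ 2 + ζ ^ 4)) * (s - (ζ⁻¹ + (ζ ^ 2)⁻¹ + (ζ ^ 4)⁻¹)) = 0 := by
    rw [i1, i2, i4]
    linear_combination hb + (3 + ζ + ζ ^ 2 + ζ ^ 3) * h7 + (1 - s) * hg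
  have p2 : (ζ ^ 2) ^ 7 = 1 := by rw [← pow_mul, mul_comm, pow_mul, h7, one_pow]
  have p4 : (ζ ^ 4) ^ 7 = 1 := by rw [← pow_mul, mul_comm, pow_mul, h7, one_pow]
  rcases mul_eq_zero.1 hS with h | h
  · refine .inl fun f => ⟨?_, ?_⟩
    · rw [prod_comp_eq_of_sum_eq hζ (x' := ![ζ, ζ ^ 2, ζ ^ 4]) hlam
        (by intro i; fin_cases i <;> simp [h7, p2, p4])
        (by rw [h1, sub_eq_zero.1 h, Fin.sum_univ_three]; rfl) f, Fin.prod_univ_three]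
      rfl
    · rw [prod_comp_eq_of_sum_eq hζ (x' := ![1, ζ, ζ ^ 2, ζ ^ 4]) hmu
        (by intro i; fin_cases i <;> simp [h7, p2, p4])
        (by rw [h2, sub_eq_zero.1 h, Fin.sum_univ_four]; simp; ring) f, Fin.prod_univ_four]
      rfl
  · refine .inr fun f => ⟨?_, ?_⟩
    · rw [prod_comp_eq_of_sum_eq hζ (x' := ![ζ⁻¹, (ζ ^ 2)⁻¹, (ζ ^ 4)⁻¹]) hlam
        (by intro i; fin_cases i <;> simp [h7, p2, p4])
        (by rw [h1, sub_eq_zero.1 h, Fin.sum_univ_three]; rfl) f, Fin.prod_univ_three]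
      rfl
    · rw [prod_comp_eq_of_sum_eq hζ (x' := ![1, ζ⁻¹, (ζ ^ 2)⁻¹, (ζ ^ 4)⁻¹]) hmu
        (by intro i; fin_cases i <;> simp [h7, p2, p4])
        (by rw [h2, sub_eq_zero.1 h, Fin.sum_univ_four]; simp; ring) f, Fin.prod_univ_four]
      rfl

theorem prod_one_sub_pow_mul (t : ℂ) : ∏ i : Fin 7, (1 - ζ ^ (i : ℕ) * t) = 1 - t ^ 7 := by
  have h := hζ.pow_sub_pow_eq_prod_sub_mul 1 t (by norm_num)
  rw [one_pow] at h
  rw [h, Fin.prod_univ_eq_prod_range (fun i => 1 - ζ ^ i * t) 7]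
  have : Polynomial.nthRootsFinset 7 (1 : ℂ) = (Finset.range 7).image (ζ ^ ·) := by
    ext x
    rw [Polynomial.mem_nthRootsFinset (by norm_num), Finset.mem_image]
    constructor
    · intro hx
      obtain ⟨i, hi, rfl⟩ := hζ.eq_pow_of_pow_eq_one hx
      exact ⟨i, Finset.mem_range.2 hi, rfl⟩
    · rintro ⟨i, -, rfl⟩
      rw [← pow_mul, mul_comm, pow_mul, hζ.pow_eq_one, one_pow]
  rw [this, Finset.prod_image]
  intro i hi j hj hij
  exact hζ.pow_inj (Finset.mem_range.1 hi) (Finset.mem_range.1 hj) hij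

/-- Comes from `1 - t⁷ = ∏ (1 - ζ^k t)`, grouped by squares and non-squares modulo `7`; the two
groups are the bosonic eigenvalues of `g` and of `g⁻¹`, up to the common eigenvalue `1`. -/
theorem thetaProd_seven {q : ℂ} (hq : ‖q‖ < 1) (x : ℂ) :
    thetaProd (x ^ 7) (q ^ 7) = (thetaProd (1 * x) q * thetaProd (ζ * x) q *
        thetaProd (ζ ^ 2 * x) q * thetaProd (ζ ^ 4 * x) q) *
      (thetaProd (ζ⁻¹ * x) q * thetaProd ((ζ ^ 2)⁻¹ * x) q * thetaProd ((ζ ^ 4)⁻¹ * x) q) := by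
  obtain ⟨i1, i2, i4⟩ := inv_eq_pow_six hζ
  have h := prod_thetaProd hq (fun i : Fin 7 => ζ ^ (i : ℕ)) (fun _ : Fin 1 => 1) (fun _ => 7)
    (by simp) (fun t => by simpa using prod_one_sub_pow_mul hζ t)
    (fun t => by simpa using prod_one_sub_pow_mul hζ.inv t) x
  simp only [Finset.univ_unique, Finset.prod_singleton, one_mul, Fin.prod_univ_seven] at h
  rw [← h, i1, i2, i4]
  simp
  ring

end Seven

/-! ### Product formulas for the orders 7 and 14 -/

section Values

variable {τ z a c y q : ℂ} (ha : expTwoPiI (τ / 24) = a) (hc : expTwoPiI (z / 2) = c)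
  (hy : c ^ 2 = y) (hq : a ^ 24 = q) (h : ‖q‖ < 1) (h1 : ‖y⁻¹‖ < 1) (h2 : ‖y * q‖ < 1)
  {w ζ : ℂ} (hw : expTwoPiI (1 / 14) = w) (hwζ : w ^ 2 = ζ) (hw' : w ^ 7 = -1) (w0 : w ≠ 0)
  (hζ : IsPrimitiveRoot ζ 7)

theorem neg_pow_seven {R : Type*} [CommRing R] (x : R) : (-x) ^ 7 = -x ^ 7 := by ring

include ha hc hy hq h h1 h2 hw hwζ hw' w0 hζ

/-- The denominator contains all seven factors `thetaProd (ζ^k * y) q`. The numerator of each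
summand cancels three of them, which leaves the four of one of the two elements `g`, `g⁻¹`. -/
theorem psi7AB_eq : psi7AB τ z = -(y * (eulerProd q ^ 2 *
      ((thetaProd (ζ * y ^ 2) q * thetaProd (ζ ^ 2 * y ^ 2) q * thetaProd (ζ ^ 4 * y ^ 2) q) *
        (thetaProd (1 * y) q * thetaProd (ζ * y) q * thetaProd (ζ ^ 2 * y) q *
          thetaProd (ζ ^ 4 * y) q)⁻¹)) +
    y * (eulerProd q ^ 2 *
      ((thetaProd (ζ⁻¹ * y ^ 2) q * thetaProd ((ζ ^ 2)⁻¹ * y ^ 2) q *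
          thetaProd ((ζ ^ 4)⁻¹ * y ^ 2) q) *
        (thetaProd (1 * y) q * thetaProd (ζ⁻¹ * y) q * thetaProd ((ζ ^ 2)⁻¹ * y) q *
          thetaProd ((ζ ^ 4)⁻¹ * y) q)⁻¹))) := by
  have e := theta1_mul_mul ha hc hy hq h 7 7 (by norm_num)
  have s7 := thetaProd_seven hζ h (y)
  have n := thetaProd_pow_ne_zero h1 h2 h (d := 7) (by norm_num)
  have p := eulerProd_ne_zero (norm_pow_lt_one_of_norm_lt_one h (d := 7) (by norm_num))
  have p1 := eulerProd_ne_zero h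
  have e7 := eta_mul ha hq 7
  have e1 := eta_mul ha hq 1
  have a21 := theta1_shift ha hc hy hq h hw 2 1
  have b21 := theta1_shift_neg ha hc hy hq h hw 2 1
  have a22 := theta1_shift ha hc hy hq h hw 2 2
  have b22 := theta1_shift_neg ha hc hy hq h hw 2 2
  have a24 := theta1_shift ha hc hy hq h hw 2 4
  have b24 := theta1_shift_neg ha hc hy hq h hw 2 4
  have a11 := theta1_shift ha hc hy hq h hw 1 1
  have b11 := theta1_shift_neg ha hc hy hq h hw 1 1
  have a12 := theta1_shift ha hc hy hq h hw 1 2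
  have b12 := theta1_shift_neg ha hc hy hq h hw 1 2
  have a14 := theta1_shift ha hc hy hq h hw 1 4
  have b14 := theta1_shift_neg ha hc hy hq h hw 1 4
  -- The shifts satisfy `1 + 2 + 4 = 7` and `w⁷ = -1`; rewriting `w⁴` in this way lets the phases of
  -- the three factors cancel.
  have hw7 : w ^ 4 = -(w ^ 3)⁻¹ := by
    rw [eq_neg_iff_add_eq_zero, ← mul_left_inj' (pow_ne_zero 3 w0), add_mul,
      inv_mul_cancel₀ (pow_ne_zero 3 w0)]
    linear_combination hw'
  have a0 : a ≠ 0 := ha ▸ expTwoPiI_ne_zero _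
  have c0 : c ≠ 0 := hc ▸ expTwoPiI_ne_zero _
  simp only [hwζ, hw7, Nat.cast_one, one_mul, pow_one, Nat.cast_ofNat] at e s7 n e7 e1 a21 b21 a22 b22 a24 b24 a11 b11 a12 b12 a14 b14
  rw [s7] at e n
  simp only [mul_ne_zero_iff] at n
  obtain ⟨⟨⟨⟨n1, n2⟩, n3⟩, n4⟩, ⟨n5, n6⟩, n7⟩ := n
  rw [psi7AB, e, e7, e1, a21, b21, a22, b22, a24, b24, a11, b11, a12, b12, a14, b14]
  simp only [one_mul]
  generalize thetaProd (ζ * y ^ 2) q = A₁ at *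
  generalize thetaProd (ζ ^ 2 * y ^ 2) q = A₂ at *
  generalize thetaProd (ζ ^ 4 * y ^ 2) q = A₃ at *
  generalize thetaProd (ζ⁻¹ * y ^ 2) q = B₁ at *
  generalize thetaProd ((ζ ^ 2)⁻¹ * y ^ 2) q = B₂ at *
  generalize thetaProd ((ζ ^ 4)⁻¹ * y ^ 2) q = B₃ at *
  generalize thetaProd (ζ * y) q = C₁ at *
  generalize thetaProd (ζ ^ 2 * y) q = C₂ at *
  generalize thetaProd (ζ ^ 4 * y) q = C₃ at *
  generalize thetaProd (ζ⁻¹ * y) q = D₁ at *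
  generalize thetaProd ((ζ ^ 2)⁻¹ * y) q = D₂ at *
  generalize thetaProd ((ζ ^ 4)⁻¹ * y) q = D₃ at *
  generalize thetaProd (y) q = C₀ at *
  rw [← hy]
  have z0 : ζ ≠ 0 := hwζ ▸ pow_ne_zero 2 w0
  clear a21 b21 a22 b22 a24 b24 a11 b11 a12 b12 a14 b14 e e7 e1 s7
  field_simp
  have hI : Complex.I ^ 6 = -1 := by
    rw [show 6 = 4 + 2 from rfl, pow_add, Complex.I_pow_four, Complex.I_sq, one_mul]
  linear_combination (D₁ * D₂ * D₃ * A₁ * A₂ * A₃ + C₁ * C₂ * C₃ * B₁ * B₂ * B₃) * hI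

theorem psi14AB_eq : psi14AB τ z = -(y * (eulerProd q ^ 2 *
      ((thetaProd (ζ * y ^ 2) q * thetaProd (ζ ^ 2 * y ^ 2) q * thetaProd (ζ ^ 4 * y ^ 2) q) *
        (thetaProd (-(1 * y)) q * thetaProd (-(ζ * y)) q * thetaProd (-(ζ ^ 2 * y)) q *
          thetaProd (-(ζ ^ 4 * y)) q)⁻¹)) +
    y * (eulerProd q ^ 2 *
      ((thetaProd (ζ⁻¹ * y ^ 2) q * thetaProd ((ζ ^ 2)⁻¹ * y ^ 2) q *
          thetaProd ((ζ ^ 4)⁻¹ * y ^ 2) q) *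
        (thetaProd (-(1 * y)) q * thetaProd (-(ζ⁻¹ * y)) q * thetaProd (-((ζ ^ 2)⁻¹ * y)) q *
          thetaProd (-((ζ ^ 4)⁻¹ * y)) q)⁻¹))) := by
  have e := theta2_mul_mul ha hc hy hq h 7 7 (by norm_num)
  have s7 := thetaProd_seven hζ h (-y)
  have n := thetaProd_neg_pow_ne_zero h1 h2 h (d := 7) (by norm_num)
  have p := eulerProd_ne_zero (norm_pow_lt_one_of_norm_lt_one h (d := 7) (by norm_num))
  have p1 := eulerProd_ne_zero h
  have e7 := eta_mul ha hq 7
  have e1 := eta_mul ha hq 1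
  have a21 := theta1_shift ha hc hy hq h hw 2 1
  have b21 := theta1_shift_neg ha hc hy hq h hw 2 1
  have a22 := theta1_shift ha hc hy hq h hw 2 2
  have b22 := theta1_shift_neg ha hc hy hq h hw 2 2
  have a24 := theta1_shift ha hc hy hq h hw 2 4
  have b24 := theta1_shift_neg ha hc hy hq h hw 2 4
  have a11 := theta2_shift ha hc hy hq h hw 1 1
  have b11 := theta2_shift_neg ha hc hy hq h hw 1 1
  have a12 := theta2_shift ha hc hy hq h hw 1 2
  have b12 := theta2_shift_neg ha hc hy hq h hw 1 2
  have a14 := theta2_shift ha hc hy hq h hw 1 4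
  have b14 := theta2_shift_neg ha hc hy hq h hw 1 4
  have hw7 : w ^ 4 = -(w ^ 3)⁻¹ := by
    rw [eq_neg_iff_add_eq_zero, ← mul_left_inj' (pow_ne_zero 3 w0), add_mul,
      inv_mul_cancel₀ (pow_ne_zero 3 w0)]
    linear_combination hw'
  have a0 : a ≠ 0 := ha ▸ expTwoPiI_ne_zero _
  have c0 : c ≠ 0 := hc ▸ expTwoPiI_ne_zero _
  simp only [hwζ, hw7, Nat.cast_one, one_mul, pow_one, Nat.cast_ofNat, neg_pow_seven, mul_neg] at e s7 n e7 e1 a21 b21 a22 b22 a24 b24 a11 b11 a12 b12 a14 b14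
  rw [s7] at e n
  simp only [mul_ne_zero_iff] at n
  obtain ⟨⟨⟨⟨n1, n2⟩, n3⟩, n4⟩, ⟨n5, n6⟩, n7⟩ := n
  rw [psi14AB, e, e7, e1, a21, b21, a22, b22, a24, b24, a11, b11, a12, b12, a14, b14]
  simp only [one_mul]
  generalize thetaProd (ζ * y ^ 2) q = A₁ at *
  generalize thetaProd (ζ ^ 2 * y ^ 2) q = A₂ at *
  generalize thetaProd (ζ ^ 4 * y ^ 2) q = A₃ at *
  generalize thetaProd (ζ⁻¹ * y ^ 2) q = B₁ at *
  generalize thetaProd ((ζ ^ 2)⁻¹ * y ^ 2) q = B₂ at *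
  generalize thetaProd ((ζ ^ 4)⁻¹ * y ^ 2) q = B₃ at *
  generalize thetaProd (-(ζ * y)) q = C₁ at *
  generalize thetaProd (-(ζ ^ 2 * y)) q = C₂ at *
  generalize thetaProd (-(ζ ^ 4 * y)) q = C₃ at *
  generalize thetaProd (-(ζ⁻¹ * y)) q = D₁ at *
  generalize thetaProd (-((ζ ^ 2)⁻¹ * y)) q = D₂ at *
  generalize thetaProd (-((ζ ^ 4)⁻¹ * y)) q = D₃ at *
  generalize thetaProd (-y) q = C₀ at *
  rw [← hy]
  have z0 : ζ ≠ 0 := hwζ ▸ pow_ne_zero 2 w0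
  clear a21 b21 a22 b22 a24 b24 a11 b11 a12 b12 a14 b14 e e7 e1 s7
  field_simp
  rw [show Complex.I ^ 4 = 1 from Complex.I_pow_four]
  ring

end Values

/-! ### Theta products of eigenvalues from power sums -/

/-- On the unit circle inversion is conjugation, and integers are real; therefore `g` and `g⁻¹` have
the same characteristic polynomials when the character values are integers. -/
theorem sum_inv_pow_eq_conj {r : ℕ} {a : Fin r → ℂ} (ha : ∀ i, ‖a i‖ = 1) {k : ℕ} {p : ℤ}
    (h : ∑ i, a i ^ k = p) : ∑ i, (a i)⁻¹ ^ k = p := by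
  have := congrArg (starRingEnd ℂ) h
  rw [map_sum, map_intCast] at this
  rw [← this]
  exact Finset.sum_congr rfl fun i _ => by rw [Complex.inv_eq_conj (ha i), map_pow]

/-- Newton's identities: the elementary symmetric functions in terms of power sums. -/
theorem prod_one_sub_mul_of_powerSums_three {a : Fin 3 → ℂ} {p : Fin 3 → ℤ}
    (h : ∀ k, ∑ i, a i ^ (k.val + 1) = p k) (t : ℂ) :
    ∏ i, (1 - a i * t) = 1 - p 0 * t + (p 0 ^ 2 - p 1) / 2 * t ^ 2
      - (p 0 ^ 3 - 3 * p 0 * p 1 + 2 * p 2) / 6 * t ^ 3 := by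
  rw [← h 0, ← h 1, ← h 2]
  simp only [Fin.sum_univ_three, Fin.prod_univ_three, Fin.val_zero, Fin.val_one, Fin.val_two]
  ring

theorem prod_one_sub_mul_of_powerSums_four {a : Fin 4 → ℂ} {p : Fin 4 → ℤ}
    (h : ∀ k, ∑ i, a i ^ (k.val + 1) = p k) (t : ℂ) :
    ∏ i, (1 - a i * t) = 1 - p 0 * t + (p 0 ^ 2 - p 1) / 2 * t ^ 2
      - (p 0 ^ 3 - 3 * p 0 * p 1 + 2 * p 2) / 6 * t ^ 3
      + (p 0 ^ 4 - 6 * p 0 ^ 2 * p 1 + 3 * p 1 ^ 2 + 8 * p 0 * p 2 - 6 * p 3) / 24 * t ^ 4 := by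
  rw [← h 0, ← h 1, ← h 2, ← h 3]
  simp only [Fin.sum_univ_four, Fin.prod_univ_four, Fin.val_zero, Fin.val_one, Fin.val_two,
    show (3 : Fin 4).val = 3 from rfl]
  ring

theorem prod_thetaProd_of_powerSums_three {a : Fin 3 → ℂ} (ha : ∀ i, ‖a i‖ = 1) {p : Fin 3 → ℤ}
    (h : ∀ k, ∑ i, a i ^ (k.val + 1) = p k) {n : ℕ} (b : Fin n → ℂ) (d : Fin n → ℕ)
    (hd : ∀ j, d j ≠ 0) (hb : ∀ j, (b j)⁻¹ = b j)
    (hp : ∀ t : ℂ, 1 - p 0 * t + (p 0 ^ 2 - p 1) / 2 * t ^ 2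
      - (p 0 ^ 3 - 3 * p 0 * p 1 + 2 * p 2) / 6 * t ^ 3 = ∏ j, (1 - b j * t ^ d j))
    {q : ℂ} (hq : ‖q‖ < 1) (x : ℂ) :
    ∏ i, thetaProd (a i * x) q = ∏ j, thetaProd (b j * x ^ d j) (q ^ d j) ∧
      ∏ i, thetaProd ((a i)⁻¹ * x) q = ∏ j, thetaProd (b j * x ^ d j) (q ^ d j) := by
  have e1 := fun t => (prod_one_sub_mul_of_powerSums_three h t).trans (hp t)
  have e2 := fun t => (prod_one_sub_mul_of_powerSums_three
    (fun k => sum_inv_pow_eq_conj ha (h k)) t).trans (hp t)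
  exact ⟨prod_thetaProd hq a b d hd e1 (by simpa only [hb] using e2) x,
    prod_thetaProd hq _ b d hd e2 (by simpa only [hb, inv_inv] using e1) x⟩

theorem prod_thetaProd_of_powerSums_four {a : Fin 4 → ℂ} (ha : ∀ i, ‖a i‖ = 1) {p : Fin 4 → ℤ}
    (h : ∀ k, ∑ i, a i ^ (k.val + 1) = p k) {n : ℕ} (b : Fin n → ℂ) (d : Fin n → ℕ)
    (hd : ∀ j, d j ≠ 0) (hb : ∀ j, (b j)⁻¹ = b j)
    (hp : ∀ t : ℂ, 1 - p 0 * t + (p 0 ^ 2 - p 1) / 2 * t ^ 2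
      - (p 0 ^ 3 - 3 * p 0 * p 1 + 2 * p 2) / 6 * t ^ 3
      + (p 0 ^ 4 - 6 * p 0 ^ 2 * p 1 + 3 * p 1 ^ 2 + 8 * p 0 * p 2 - 6 * p 3) / 24 * t ^ 4
        = ∏ j, (1 - b j * t ^ d j))
    {q : ℂ} (hq : ‖q‖ < 1) (x : ℂ) :
    ∏ i, thetaProd (a i * x) q = ∏ j, thetaProd (b j * x ^ d j) (q ^ d j) ∧
      ∏ i, thetaProd ((a i)⁻¹ * x) q = ∏ j, thetaProd (b j * x ^ d j) (q ^ d j) := by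
  have e1 := fun t => (prod_one_sub_mul_of_powerSums_four h t).trans (hp t)
  have e2 := fun t => (prod_one_sub_mul_of_powerSums_four
    (fun k => sum_inv_pow_eq_conj ha (h k)) t).trans (hp t)
  exact ⟨prod_thetaProd hq a b d hd e1 (by simpa only [hb] using e2) x,
    prod_thetaProd hq _ b d hd e2 (by simpa only [hb, inv_inv] using e1) x⟩

/-! ### Comparison with the Jacobi forms -/

/-- The trace function in terms of the eigenvalues. -/
noncomputable def traceValue (lam : Fin 3 → ℂ) (mu : Fin 4 → ℂ) (y q : ℂ) : ℂ :=
  -(y * (eulerProd q ^ 2 * ((∏ i, thetaProd (lam i * y ^ 2) q) *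
      (∏ j, thetaProd (mu j * y) q)⁻¹))
    + y * (eulerProd q ^ 2 * ((∏ i, thetaProd ((lam i)⁻¹ * y ^ 2) q) *
      (∏ j, thetaProd ((mu j)⁻¹ * y) q)⁻¹)))

/-! ### Comparison for orders prime to 7 -/

section Classes

variable {lam : Fin 3 → ℂ} {mu : Fin 4 → ℂ} {τ z : ℂ}

theorem traceValue_of_eq {y q R S : ℂ}
    (hA : ∏ i, thetaProd (lam i * y ^ 2) q = R ∧ ∏ i, thetaProd ((lam i)⁻¹ * y ^ 2) q = R)
    (hB : ∏ i, thetaProd (mu i * y) q = S ∧ ∏ i, thetaProd ((mu i)⁻¹ * y) q = S) :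
    traceValue lam mu y q = -2 * (y * (eulerProd q ^ 2 * (R * S⁻¹))) := by
  rw [traceValue, hA.1, hA.2, hB.1, hB.2]
  ring

variable (hlam : ∀ i, ‖lam i‖ = 1) (hmu : ∀ i, ‖mu i‖ = 1)
  (h : ‖expTwoPiI τ‖ < 1) (h1 : ‖(expTwoPiI z)⁻¹‖ < 1) (h2 : ‖expTwoPiI z * expTwoPiI τ‖ < 1)

theorem expTwoPiI_div_pow (x : ℂ) {n : ℕ} (hn : n ≠ 0) : expTwoPiI (x / n) ^ n = expTwoPiI x := by
  rw [← expTwoPiI_natCast_mul, mul_div_cancel₀ _ (by exact_mod_cast hn)]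

/-- The power sums are character values of powers of `g`, and away from `7` these depend only on the
order `N / gcd(N, k + 1)`. -/
theorem sum_pow_of_orderOf {G : Type*} [Group G] {r : ℕ} {χ : G → ℂ} {g : G} {a : Fin r → ℂ}
    (h : ∀ k : ℕ, ∑ i, a i ^ k = χ (g ^ k)) {N : ℕ} (hN : orderOf g = N) {v : ℕ → ℤ}
    (hv : ∀ g, orderOf g ∣ N → χ g = v (orderOf g)) (k : ℕ) :
    ∑ i, a i ^ (k + 1) = (v (N / N.gcd (k + 1)) : ℂ) := by
  have : orderOf (g ^ (k + 1)) = N / N.gcd (k + 1) := by rw [orderOf_pow' _ k.succ_ne_zero, hN]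
  rw [h, hv _ (this ▸ Nat.div_dvd_of_dvd (Nat.gcd_dvd_left _ _)), this]

include hlam hmu h h1 h2

/-- In this and the next five lemmas the two vectors passed as `b`, `d` encode the characteristic
polynomial as `∏ (1 - b t^d)`. On `a⁺` and `b⁺` they are `(1-t)³`, `(1-t)⁴` for 1A; `(1-t)³`,
`(1+t)⁴` for 2A; `(1-t)(1+t)²`, `(1+t²)²` for 4A; `1-t³`, `(1-t)(1-t³)` for 3A; `1-t³`,
`(1+t)(1+t³)` for 6A; `(1-t)(1+t²)`, `1+t⁴` for 8A. -/
theorem traceValue_eq_psi1A (hA : ∀ k, ∑ i, lam i ^ (k.val + 1) = ((![3, 3, 3] : Fin 3 → ℤ) k : ℂ))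
    (hB : ∀ k, ∑ i, mu i ^ (k.val + 1) = ((![4, 4, 4, 4] : Fin 4 → ℤ) k : ℂ)) :
    traceValue lam mu (expTwoPiI z) (expTwoPiI τ) = psi1A τ z := by
  have e1 := prod_thetaProd_of_powerSums_three hlam hA ![1, 1, 1] ![1, 1, 1]
    (by intro j; fin_cases j <;> simp) (by intro j; fin_cases j <;> simp)
    (fun t => by simp [Fin.prod_univ_succ]; ring) h (expTwoPiI z ^ 2)
  have e2 := prod_thetaProd_of_powerSums_four hmu hB ![1, 1, 1, 1] ![1, 1, 1, 1]
    (by intro j; fin_cases j <;> simp) (by intro j; fin_cases j <;> simp)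
    (fun t => by simp [Fin.prod_univ_succ]; ring) h (expTwoPiI z)
  rw [traceValue_of_eq e1 e2, psi1A_eq rfl rfl (expTwoPiI_div_pow z two_ne_zero)
    (expTwoPiI_div_pow τ (by norm_num : 24 ≠ 0)) h h1 h2]
  simp [Fin.prod_univ_succ]
  ring_nf
  simp

theorem traceValue_eq_psi2A (hA : ∀ k, ∑ i, lam i ^ (k.val + 1) = ((![3, 3, 3] : Fin 3 → ℤ) k : ℂ))
    (hB : ∀ k, ∑ i, mu i ^ (k.val + 1) = ((![-4, 4, -4, 4] : Fin 4 → ℤ) k : ℂ)) :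
    traceValue lam mu (expTwoPiI z) (expTwoPiI τ) = psi2A τ z := by
  have e1 := prod_thetaProd_of_powerSums_three hlam hA ![1, 1, 1] ![1, 1, 1]
    (by intro j; fin_cases j <;> simp) (by intro j; fin_cases j <;> simp)
    (fun t => by simp [Fin.prod_univ_succ]; ring) h (expTwoPiI z ^ 2)
  have e2 := prod_thetaProd_of_powerSums_four hmu hB ![-1, -1, -1, -1] ![1, 1, 1, 1]
    (by intro j; fin_cases j <;> simp) (by intro j; fin_cases j <;> simp)
    (fun t => by simp [Fin.prod_univ_succ]; ring) h (expTwoPiI z)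
  rw [traceValue_of_eq e1 e2, psi2A_eq rfl rfl (expTwoPiI_div_pow z two_ne_zero)
    (expTwoPiI_div_pow τ (by norm_num : 24 ≠ 0)) h h1 h2]
  simp [Fin.prod_univ_succ]
  ring_nf
  simp

theorem traceValue_eq_psi4A (hA : ∀ k, ∑ i, lam i ^ (k.val + 1) = ((![-1, 3, -1] : Fin 3 → ℤ) k : ℂ))
    (hB : ∀ k, ∑ i, mu i ^ (k.val + 1) = ((![0, -4, 0, 4] : Fin 4 → ℤ) k : ℂ)) :
    traceValue lam mu (expTwoPiI z) (expTwoPiI τ) = psi4A τ z := by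
  have e1 := prod_thetaProd_of_powerSums_three hlam hA ![1, -1, -1] ![1, 1, 1]
    (by intro j; fin_cases j <;> simp) (by intro j; fin_cases j <;> simp)
    (fun t => by simp [Fin.prod_univ_succ]; ring) h (expTwoPiI z ^ 2)
  have e2 := prod_thetaProd_of_powerSums_four hmu hB ![-1, -1] ![2, 2]
    (by intro j; fin_cases j <;> simp) (by intro j; fin_cases j <;> simp)
    (fun t => by simp [Fin.prod_univ_succ]; ring) h (expTwoPiI z)
  rw [traceValue_of_eq e1 e2, psi4A_eq rfl rfl (expTwoPiI_div_pow z two_ne_zero)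
    (expTwoPiI_div_pow τ (by norm_num : 24 ≠ 0)) h h1 h2]
  simp [Fin.prod_univ_succ]
  ring_nf
  simp

theorem traceValue_eq_psi3A (hA : ∀ k, ∑ i, lam i ^ (k.val + 1) = ((![0, 0, 3] : Fin 3 → ℤ) k : ℂ))
    (hB : ∀ k, ∑ i, mu i ^ (k.val + 1) = ((![1, 1, 4, 1] : Fin 4 → ℤ) k : ℂ)) :
    traceValue lam mu (expTwoPiI z) (expTwoPiI τ) = psi3A τ z := by
  have e1 := prod_thetaProd_of_powerSums_three hlam hA ![1] ![3]
    (by simp) (by simp) (fun t => by simp; ring) h (expTwoPiI z ^ 2)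
  have e2 := prod_thetaProd_of_powerSums_four hmu hB ![1, 1] ![1, 3]
    (by intro j; fin_cases j <;> simp) (by intro j; fin_cases j <;> simp)
    (fun t => by simp [Fin.prod_univ_succ]; ring) h (expTwoPiI z)
  rw [traceValue_of_eq e1 e2, psi3A_eq rfl rfl (expTwoPiI_div_pow z two_ne_zero)
    (expTwoPiI_div_pow τ (by norm_num : 24 ≠ 0)) h h1 h2]
  simp [Fin.prod_univ_succ]
  ring_nf
  simp

theorem traceValue_eq_psi6A (hA : ∀ k, ∑ i, lam i ^ (k.val + 1) = ((![0, 0, 3] : Fin 3 → ℤ) k : ℂ))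
    (hB : ∀ k, ∑ i, mu i ^ (k.val + 1) = ((![-1, 1, -4, 1] : Fin 4 → ℤ) k : ℂ)) :
    traceValue lam mu (expTwoPiI z) (expTwoPiI τ) = psi6A τ z := by
  have e1 := prod_thetaProd_of_powerSums_three hlam hA ![1] ![3]
    (by simp) (by simp) (fun t => by simp; ring) h (expTwoPiI z ^ 2)
  have e2 := prod_thetaProd_of_powerSums_four hmu hB ![-1, -1] ![1, 3]
    (by intro j; fin_cases j <;> simp) (by intro j; fin_cases j <;> simp)
    (fun t => by simp [Fin.prod_univ_succ]; ring) h (expTwoPiI z)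
  rw [traceValue_of_eq e1 e2, psi6A_eq rfl rfl (expTwoPiI_div_pow z two_ne_zero)
    (expTwoPiI_div_pow τ (by norm_num : 24 ≠ 0)) h h1 h2]
  simp [Fin.prod_univ_succ]
  ring_nf
  simp

theorem traceValue_eq_psi8A (hA : ∀ k, ∑ i, lam i ^ (k.val + 1) = ((![1, -1, 1] : Fin 3 → ℤ) k : ℂ))
    (hB : ∀ k, ∑ i, mu i ^ (k.val + 1) = ((![0, 0, 0, -4] : Fin 4 → ℤ) k : ℂ)) :
    traceValue lam mu (expTwoPiI z) (expTwoPiI τ) = psi8A τ z := by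
  have e1 := prod_thetaProd_of_powerSums_three hlam hA ![1, -1] ![1, 2]
    (by intro j; fin_cases j <;> simp) (by intro j; fin_cases j <;> simp)
    (fun t => by simp [Fin.prod_univ_succ]; ring) h (expTwoPiI z ^ 2)
  have e2 := prod_thetaProd_of_powerSums_four hmu hB ![-1] ![4]
    (by simp) (by simp) (fun t => by simp; ring) h (expTwoPiI z)
  rw [traceValue_of_eq e1 e2, psi8A_eq rfl rfl (expTwoPiI_div_pow z two_ne_zero)
    (expTwoPiI_div_pow τ (by norm_num : 24 ≠ 0)) h h1 h2]
  simp [Fin.prod_univ_succ]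
  ring_nf
  simp

end Classes

theorem star_b7 : star b7 = -1 - b7 := by
  have : star b7 = (-1 - Complex.I * (Real.sqrt 7 : ℂ)) / 2 := by simp [b7, sub_eq_add_neg]
  rw [this, b7]
  ring

/-! ### Comparison for orders 7 and 14 -/

section Sevenfold

variable {lam : Fin 3 → ℂ} {mu : Fin 4 → ℂ} {τ z s : ℂ} (h : ‖expTwoPiI τ‖ < 1)
  (h1 : ‖(expTwoPiI z)⁻¹‖ < 1) (h2 : ‖expTwoPiI z * expTwoPiI τ‖ < 1)
  (hlam : ∀ i, lam i ^ 7 = 1) (hs : s = b7 ∨ s = star b7) (hA : ∑ i, lam i = s)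

theorem expTwoPiI_fourteenth_pow_seven : expTwoPiI (1 / 14) ^ 7 = -1 := by
  rw [← expTwoPiI_natCast_mul, expTwoPiI, ← Complex.exp_pi_mul_I]
  congr 1
  push_cast
  ring

theorem isPrimitiveRoot_expTwoPiI : IsPrimitiveRoot (expTwoPiI (1 / 14) ^ 2) 7 := by
  have := Complex.isPrimitiveRoot_exp 7 (by norm_num)
  convert this using 1
  rw [← expTwoPiI_natCast_mul, expTwoPiI]
  congr 1
  push_cast
  ring

include h h1 h2 hlam hs hA

/-- The two possible eigenvalue systems are inverse to each other, and exchanging them exchanges the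
two summands of `traceValue`. -/
theorem traceValue_eq_psi7AB (hmu : ∀ i, mu i ^ 7 = 1) (hB : ∑ i, mu i = 1 + s) :
    traceValue lam mu (expTwoPiI z) (expTwoPiI τ) = psi7AB τ z := by
  rw [psi7AB_eq rfl rfl (expTwoPiI_div_pow z two_ne_zero)
    (expTwoPiI_div_pow τ (by norm_num : 24 ≠ 0)) h h1 h2 rfl rfl expTwoPiI_fourteenth_pow_seven
    (expTwoPiI_ne_zero _) isPrimitiveRoot_expTwoPiI, traceValue]
  set y := expTwoPiI z
  set q := expTwoPiI τ
  rcases prod_comp_of_sum_eq_b7 isPrimitiveRoot_expTwoPiI hlam hmu hs hA hB with H | H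
  · rw [(H fun x => thetaProd (x * y ^ 2) q).1, (H fun x => thetaProd (x * y) q).2,
      (H fun x => thetaProd (x⁻¹ * y ^ 2) q).1, (H fun x => thetaProd (x⁻¹ * y) q).2, inv_one]
  · rw [(H fun x => thetaProd (x * y ^ 2) q).1, (H fun x => thetaProd (x * y) q).2,
      (H fun x => thetaProd (x⁻¹ * y ^ 2) q).1, (H fun x => thetaProd (x⁻¹ * y) q).2]
    simp only [inv_inv, inv_one]
    rw [add_comm]

theorem traceValue_eq_psi14AB (hmu : ∀ i, mu i ^ 7 = -1) (hB : ∑ i, mu i = -(1 + s)) :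
    traceValue lam mu (expTwoPiI z) (expTwoPiI τ) = psi14AB τ z := by
  rw [psi14AB_eq rfl rfl (expTwoPiI_div_pow z two_ne_zero)
    (expTwoPiI_div_pow τ (by norm_num : 24 ≠ 0)) h h1 h2 rfl rfl expTwoPiI_fourteenth_pow_seven
    (expTwoPiI_ne_zero _) isPrimitiveRoot_expTwoPiI, traceValue]
  set y := expTwoPiI z
  set q := expTwoPiI τ
  have e1 : ∀ i, thetaProd (mu i * y) q = thetaProd (-(-mu i * y)) q := fun i => by
    rw [neg_mul, neg_neg]
  have e2 : ∀ i, thetaProd ((mu i)⁻¹ * y) q = thetaProd (-((-mu i)⁻¹ * y)) q := fun i => by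
    rw [inv_neg, neg_mul, neg_neg]
  simp only [e1, e2]
  rcases prod_comp_of_sum_eq_b7 (mu := fun i => -mu i) isPrimitiveRoot_expTwoPiI hlam
    (fun i => by rw [neg_pow_seven, hmu, neg_neg]) hs hA
    (by rw [Finset.sum_neg_distrib, hB, neg_neg]) with H | H
  · rw [(H fun x => thetaProd (x * y ^ 2) q).1, (H fun x => thetaProd (-(x * y)) q).2,
      (H fun x => thetaProd (x⁻¹ * y ^ 2) q).1, (H fun x => thetaProd (-(x⁻¹ * y)) q).2, inv_one]
  · rw [(H fun x => thetaProd (x * y ^ 2) q).1, (H fun x => thetaProd (-(x * y)) q).2,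
      (H fun x => thetaProd (x⁻¹ * y ^ 2) q).1, (H fun x => thetaProd (-(x⁻¹ * y)) q).2]
    simp only [inv_inv, inv_one]
    rw [add_comm]

end Sevenfold

/-! ### Character values -/

/-- The values of `chi2` away from the multiples of `7`. -/
def chi2Val (n : ℕ) : ℤ :=
  match n with
  | 1 => 3
  | 2 => 3
  | 4 => -1
  | 8 => 1
  | _ => 0

/-- The values of `chi8` away from the multiples of `7`. -/
def chi8Val (n : ℕ) : ℤ :=
  match n with
  | 1 => 4
  | 2 => -4
  | 3 => 1
  | 6 => -1
  | _ => 0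

section Characters

variable {G : Type*} [Group G] {u g : G}

theorem chi2_eq_chi2Val (h7 : ¬ 7 ∣ orderOf g) : chi2 u g = chi2Val (orderOf g) := by
  unfold chi2 chi2Val
  generalize orderOf g = n at h7
  split <;> simp_all

theorem chi8_eq_chi8Val (h7 : ¬ 7 ∣ orderOf g) : chi8 u g = chi8Val (orderOf g) := by
  unfold chi8 chi8Val
  generalize orderOf g = n at h7
  split <;> simp_all

/-- Since `b7` and its conjugate add to `-1`, `-star b7 = 1 + b7`: the eigenvalues on `b⁺` will be
those on `a⁺` together with `1`. -/
theorem characters_of_orderOf_eq_seven (hg : orderOf g = 7) :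
    (chi2 u g = b7 ∨ chi2 u g = star b7) ∧ chi8 u g = 1 + chi2 u g := by
  rw [chi2, chi8, hg]
  simp only [star_b7]
  split_ifs
  · exact ⟨.inl rfl, by ring⟩
  · exact ⟨.inr rfl, by ring⟩

theorem characters_of_orderOf_eq_fourteen (hg : orderOf g = 14) :
    (chi2 u g = b7 ∨ chi2 u g = star b7) ∧ chi8 u g = -(1 + chi2 u g) := by
  rw [chi2, chi8, hg]
  simp only [star_b7]
  split_ifs
  · exact ⟨.inl rfl, by ring⟩
  · exact ⟨.inr rfl, by ring⟩

end Characters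

/-- The order of `g` selects the branch of `psi`. For orders `2`, `4` and `6` the branch also
requires a root in the ambient group, which is found already inside the subgroup. -/
theorem traceValue_eq_psi {H : Subgroup UmbralGroup}
    (e : H ≃* Matrix.SpecialLinearGroup (Fin 2) (ZMod 7)) (u g : H) {lam : Fin 3 → ℂ}
    {mu : Fin 4 → ℂ} (hlam : ∀ i, lam i ^ orderOf g = 1) (hmu : ∀ i, mu i ^ orderOf g = 1)
    (nlam : ∀ i, ‖lam i‖ = 1) (nmu : ∀ i, ‖mu i‖ = 1)
    (hA : ∀ k : ℕ, ∑ i, lam i ^ k = chi2 u (g ^ k)) (hB : ∀ k : ℕ, ∑ i, mu i ^ k = chi8 u (g ^ k))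
    {τ z : ℂ} (h : ‖expTwoPiI τ‖ < 1) (h1 : ‖(expTwoPiI z)⁻¹‖ < 1)
    (h2 : ‖expTwoPiI z * expTwoPiI τ‖ < 1) :
    traceValue lam mu (expTwoPiI z) (expTwoPiI τ) = psi (g : UmbralGroup) τ z := by
  have hco : orderOf (g : UmbralGroup) = orderOf g := Subgroup.orderOf_coe g
  have vA : ∀ {N : ℕ}, orderOf g = N → ¬ 7 ∣ N → ∀ k : ℕ,
      ∑ i, lam i ^ (k + 1) = (chi2Val (N / N.gcd (k + 1)) : ℂ) := fun hN h7 =>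
    sum_pow_of_orderOf hA hN fun g' hg' => chi2_eq_chi2Val fun h' => h7 (h'.trans hg')
  have vB : ∀ {N : ℕ}, orderOf g = N → ¬ 7 ∣ N → ∀ k : ℕ,
      ∑ i, mu i ^ (k + 1) = (chi8Val (N / N.gcd (k + 1)) : ℂ) := fun hN h7 =>
    sum_pow_of_orderOf hB hN fun g' hg' => chi8_eq_chi8Val fun h' => h7 (h'.trans hg')
  have table : ∀ {N n : ℕ} {v : ℕ → ℤ} {p : Fin n → ℤ}, (∀ k : Fin n, v (N / N.gcd (k + 1)) = p k) →
      ∀ {r : ℕ} {a : Fin r → ℂ}, (∀ k : ℕ, ∑ i, a i ^ (k + 1) = (v (N / N.gcd (k + 1)) : ℂ)) →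
      ∀ k : Fin n, ∑ i, a i ^ (k.val + 1) = (p k : ℂ) := fun hv _ _ ha k => by rw [ha, hv]
  rcases orderOf_cases e g with hN | hN | hN | hN | hN | hN | hN | hN <;> rw [psi, hco, hN]
  · rw [if_pos rfl, traceValue_eq_psi1A nlam nmu h h1 h2
      (table (by decide) (vA hN (by norm_num))) (table (by decide) (vB hN (by norm_num)))]
  · obtain ⟨k, hk⟩ := exists_pow_four_eq e hN
    rw [if_neg (by norm_num), if_pos ⟨rfl, k, by rw [← hk]; rfl⟩, traceValue_eq_psi2A nlam nmu h h1 h2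
      (table (by decide) (vA hN (by norm_num))) (table (by decide) (vB hN (by norm_num)))]
  · obtain ⟨k, hk⟩ := exists_sq_eq e hN
    rw [if_neg (by norm_num), if_neg (by norm_num), if_pos ⟨rfl, k, by rw [← hk]; rfl⟩,
      traceValue_eq_psi4A nlam nmu h h1 h2
      (table (by decide) (vA hN (by norm_num))) (table (by decide) (vB hN (by norm_num)))]
  · rw [if_neg (by norm_num), if_neg (by norm_num), if_neg (by norm_num), if_pos rfl,
      traceValue_eq_psi3A nlam nmu h h1 h2
      (table (by decide) (vA hN (by norm_num))) (table (by decide) (vB hN (by norm_num)))]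
  · obtain ⟨k, hk⟩ := exists_pow_four_eq e (g := g ^ 3) (by
      rw [orderOf_pow' _ (by norm_num), hN]; rfl)
    rw [if_neg (by norm_num), if_neg (by norm_num), if_neg (by norm_num), if_neg (by norm_num),
      if_pos ⟨rfl, k, congrArg Subtype.val hk⟩, traceValue_eq_psi6A nlam nmu h h1 h2
      (table (by decide) (vA hN (by norm_num))) (table (by decide) (vB hN (by norm_num)))]
  · rw [if_neg (by norm_num), if_neg (by norm_num), if_neg (by norm_num), if_neg (by norm_num),
      if_neg (by norm_num), if_pos rfl, traceValue_eq_psi8A nlam nmu h h1 h2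
      (table (by decide) (vA hN (by norm_num))) (table (by decide) (vB hN (by norm_num)))]
  · rw [if_neg (by norm_num), if_neg (by norm_num), if_neg (by norm_num), if_neg (by norm_num),
      if_neg (by norm_num), if_neg (by norm_num), if_pos rfl]
    rw [hN] at hlam hmu
    obtain ⟨hs, hs'⟩ := characters_of_orderOf_eq_seven (u := u) hN
    exact traceValue_eq_psi7AB h h1 h2 hlam hs (by simpa using hA 1) hmu
      (by rw [← hs']; simpa using hB 1)
  · rw [if_neg (by norm_num), if_neg (by norm_num), if_neg (by norm_num), if_neg (by norm_num),
      if_neg (by norm_num), if_neg (by norm_num), if_neg (by norm_num), if_pos rfl]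
    rw [hN] at hlam hmu
    obtain ⟨hs, hs'⟩ := characters_of_orderOf_eq_fourteen (u := u) hN
    -- The seventh power is the central involution, with traces `3` and `-4`. The numbers `lam i ^
    -- 7` and `mu i ^ 7` are signs, so these extreme traces force all of them to be `1` and `-1`
    -- respectively.
    have h7 : orderOf (g ^ 7) = 2 := by rw [orderOf_pow' _ (by norm_num), hN]; rfl
    have hA7 := hA 7
    have hB7 := hB 7
    rw [chi2_eq_chi2Val (by rw [h7]; norm_num), h7] at hA7
    rw [chi8_eq_chi8Val (by rw [h7]; norm_num), h7] at hB7
    have sq : ∀ x : ℂ, x ^ 14 = 1 → x ^ 7 = 1 ∨ x ^ 7 = -1 := fun x hx =>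
      mul_self_eq_one_iff.1 (by rw [← pow_add]; exact hx)
    have hlam' : ∀ i, lam i ^ 7 = 1 := by
      rw [Fin.sum_univ_three] at hA7
      intro i
      rcases sq _ (hlam 0) with a0 | a0 <;> rcases sq _ (hlam 1) with a1 | a1 <;>
      rcases sq _ (hlam 2) with a2 | a2 <;> rw [a0, a1, a2] at hA7 <;>
      first
      | (exfalso; norm_num [chi2Val] at hA7; done)
      | (fin_cases i <;> assumption)
    have hmu' : ∀ i, mu i ^ 7 = -1 := by
      rw [Fin.sum_univ_four] at hB7
      intro i
      rcases sq _ (hmu 0) with a0 | a0 <;> rcases sq _ (hmu 1) with a1 | a1 <;>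
      rcases sq _ (hmu 2) with a2 | a2 <;> rcases sq _ (hmu 3) with a3 | a3 <;>
      rw [a0, a1, a2, a3] at hB7 <;>
      first
      | (exfalso; norm_num [chi8Val] at hB7; done)
      | (fin_cases i <;> assumption)
    exact traceValue_eq_psi14AB h h1 h2 hlam' hs (by simpa using hA 1) hmu'
      (by rw [← hs']; simpa using hB 1)

end UmbralFour

/-! ### The proposition -/

theorem proposition1
    {E A B : Type*} [AddCommGroup E] [Module ℂ E] [AddCommGroup A] [Module ℂ A]
    [AddCommGroup B] [Module ℂ B]
    (PE : PolarizedSpace (-1) E (Fin 1)) (PA : PolarizedSpace (-1) A (Fin 3))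
    (PB : PolarizedSpace 1 B (Fin 4))
    (H : Subgroup UmbralGroup)
    (hH : Nonempty (H ≃* Matrix.SpecialLinearGroup (Fin 2) (ZMod 7)))
    (u : H) (hu : orderOf u = 7)
    (ρ : H →* LinearMap.GeneralLinearGroup ℂ PA.pos)
    (ρ' : H →* LinearMap.GeneralLinearGroup ℂ PB.pos)
    (hρ : ∀ g, LinearMap.trace ℂ PA.pos (ρ g) = chi2 u g)
    (hρ' : ∀ g, LinearMap.trace ℂ PB.pos (ρ' g) = chi8 u g) :
    (PE.ZeroModesAreCoefficients ∧ PA.ZeroModesAreCoefficients ∧ PB.ZeroModesAreCoefficients) ∧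
    DirectSum.IsInternal (fun p : ℤ × ℕ => bigraded PE PA PB p.1 p.2) ∧
    (∀ k n, FiniteDimensional ℂ (bigraded PE PA PB k n)) ∧
    (∀ n, ∃ K : ℤ, ∀ k, K < k → bigraded PE PA PB k n = ⊥) ∧
    ∀ g : H, ∃ hinv : ∀ k n, ∀ w ∈ bigraded PE PA PB k n,
        traceOp PE PA PB ρ ρ' g w ∈ bigraded PE PA PB k n,
      ∀ τ z : ℂ, 0 < -z.im → -z.im < τ.im →
        HasSum (fun p : ℤ × ℕ =>
          LinearMap.trace ℂ (bigraded PE PA PB p.1 p.2)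
            ((traceOp PE PA PB ρ ρ' g).restrict (hinv p.1 p.2)) *
              expTwoPiI z ^ p.1 * expTwoPiI τ ^ p.2)
          (psi (g : UmbralGroup) τ z) := by
  have hs : (-1 : ℂ) * -1 = 1 := by norm_num
  set b := wBasis (PE.frame PE.bpos) (PA.frame PA.bpos) (PB.frame PB.bpos)
  have hb : ∀ k n, bigraded PE PA PB k n = fibre b biDeg (k, n) := bigraded_eq _ _ _
  refine ⟨⟨PE.zeroModesAreCoefficients hs, PA.zeroModesAreCoefficients hs,
    PB.zeroModesAreCoefficients (one_mul 1)⟩, ?_, fun k n => ?_, fun n => ⟨1 + 2 * n, fun k hk => ?_⟩,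
    fun g => ?_⟩
  · rw [show (fun p : ℤ × ℕ => bigraded PE PA PB p.1 p.2) = fibre b biDeg from
      funext fun p => hb p.1 p.2]
    exact isInternal_fibre b biDeg
  · rw [hb]
    have : Finite (biDeg ⁻¹' {(k, n)}) := (finite_biDeg_fibre (k, n)).to_subtype
    exact (fibreBasis b biDeg (k, n)).finiteDimensional_of_finite
  · rw [hb, Submodule.eq_bot_iff]
    intro w hw
    rw [mem_fibre] at hw
    rw [← b.repr.map_eq_zero_iff]
    ext i
    by_contra hi
    have hd := hw i hi
    have hj : jDeg i = k := congrArg Prod.fst hd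
    have hl : lDeg i = n := congrArg Prod.snd hd
    have := jDeg_le i
    rw [hj, hl] at this
    omega
  · obtain ⟨e⟩ := hH
    have hN : orderOf g ≠ 0 := by
      rcases orderOf_cases e g with h | h | h | h | h | h | h | h <;> rw [h] <;> norm_num
    -- The eigenbases depend on `g`, unlike the frames used above for the grading; the bigraded
    -- pieces are the same for both.
    obtain ⟨bA, lam, hA, lamN, nlam, sA⟩ := exists_eigenvalues PA.bpos ρ (chi2 u) hρ g rfl hN
    obtain ⟨bB, mu, hB, muN, nmu, sB⟩ := exists_eigenvalues PB.bpos ρ' (chi8 u) hρ' g rfl hN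
    obtain ⟨hinv, hsum⟩ := hasSum_traceOp (PE := PE) ρ ρ' g bA bB lam mu
      (fun i h => by simpa [h] using nlam i) nmu hA hB
    refine ⟨hinv, fun τ z hz hτ => ?_⟩
    have hπ := Real.pi_pos
    have h : ‖expTwoPiI τ‖ < 1 := by
      rw [norm_expTwoPiI, Real.exp_lt_one_iff]
      have h0 : 0 < τ.im := hz.trans hτ
      have : 0 < 2 * Real.pi * τ.im := by positivity
      linarith
    -- The domain `0 < -Im z < Im τ` is the annulus `1 < |y| < |q|⁻¹`.
    have h1 : ‖(expTwoPiI z)⁻¹‖ < 1 := by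
      rw [← expTwoPiI_neg, norm_expTwoPiI, Real.exp_lt_one_iff, Complex.neg_im]
      have : 0 < 2 * Real.pi * -z.im := by positivity
      linarith
    have h2 : ‖expTwoPiI z * expTwoPiI τ‖ < 1 := by
      rw [← expTwoPiI_add, norm_expTwoPiI, Real.exp_lt_one_iff, Complex.add_im]
      have h0 : 0 < z.im + τ.im := by linarith
      have : 0 < 2 * Real.pi * (z.im + τ.im) := by positivity
      linarith
    rw [← traceValue_eq_psi e u g lamN muN nlam nmu sA sB h h1 h2]
    exact hsum _ _ (expTwoPiI_ne_zero z) h1 h2
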